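/- Let $\mathbb{T}^2=\mathbb{R}^2/\Lambda$ be a flat $2$-torus ($\Lambda$ a lattice of rank two), let $\mathbb{T}^2\times\mathbb{R}$ carry the flat product metric $g_0$, with $z$ the coordinate on $\mathbb{R}$, and let $\Delta$ be the Laplacian of $g_0$. Then $-\Delta_{\mathbb{T}^2}$ has a smallest positive eigenvalue $\lambda_1$, and the following hold. (1) Let $p\in\mathbb{T}^2\times\mathbb{R}$ with $z(p)=0$. For every $R>0$ there is a unique function $V_R$ on $(\mathbb{T}^2\times[-R,R])\setminus\{p\}$ which is continuous, is smooth for $|z|<R$, is locally integrable for $|z|<R$ with $-\Delta V_R=2\pi\delta_p$ there in the sense of distributions, and vanishes for $z=\pm R$. With $C_R=\sup_{\partial B_1(p)}V_R$ (for $R>1$), the functions $V_R-C_R$ converge as $R\to\infty$, uniformly on compact subsets of $(\mathbb{T}^2\times\mathbb{R})\setminus\{p\}$, to a function $V_\infty$ which is smooth off $p$, takes both positive and negative values, and satisfies $-\Delta V_\infty=2\pi\delta_p$ on $\mathbb{T}^2\times\mathbb{R}$ in the sense of distributions. There are constants $\beta_\pm, k_\pm\in\mathbb{R}$ with $$k_-=-k_+=\frac{\pi}{\mathrm{Area}_{g_0}(\mathbb{T}^2)}>0$$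 such that the average of $V_\infty$ over the fiber $\mathbb{T}^2\times\{z\}$ equals $k_+z+\beta_+$ for $z>0$ and $k_-z+\beta_-$ for $z<0$, and for every integer $k\ge 0$, uniformly in the torus variable, $$|\nabla^k_{g_0}(V_\infty-(k_-z+\beta_-))|=O(e^{\sqrt{\lambda_1}z})\ \ (z\to-\infty),\qquad |\nabla^k_{g_0}(V_\infty-(k_+z+\beta_+))|=O(e^{-\sqrt{\lambda_1}z})\ \ (z\to+\infty).$$ (2) Let $p_1,\dots,p_{m_0}$ be $m_0\ge 1$ distinct points of $\mathbb{T}^2\times\mathbb{R}$. Then there is a function $V_\infty$, smooth off these points and taking both positive and negative values, with $-\Delta V_\infty=2\pi\sum_{j=1}^{m_0}\delta_{p_j}$ on $\mathbb{T}^2\times\mathbb{R}$ in the sense of distributions, and there are constants $\beta_\pm,k_\pm\in\mathbb{R}$ with $$k_-=-k_+=\frac{\pi m_0}{\mathrm{Area}_{g_0}(\mathbb{T}^2)}>0$$ such that the average of $V_\infty$ over $\mathbb{T}^2\times\{z\}$ equals $k_+z+\beta_+$ for $z>\max_j z(p_j)$ and $k_-z+\beta_-$ for $z<\min_j z(p_j)$,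 and the two asymptotic estimates of (1) hold for every integer $k\ge 0$. -/

import Mathlib

open Set Filter Topology MeasureTheory Asymptotics
open scoped ContDiff InnerProductSpace

noncomputable section

namespace FlatCylinder

/-- The Euclidean plane. -/
abbrev Plane : Type := EuclideanSpace ℝ (Fin 2)

/-- Euclidean 3-space `ℝ² × ℝ` with coordinates `(x, y, z)`, the universal cover of the cylinder. -/
abbrev Cover : Type := EuclideanSpace ℝ (Fin 3)

/-- The lattice `ℤ b₀ + ℤ b₁` in the plane spanned by a real basis `b`. -/
abbrev lattice (b : Module.Basis (Fin 2) ℝ Plane) : AddSubgroup Plane :=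
  (Submodule.span ℤ (Set.range b)).toAddSubgroup

/-- The flat torus `𝕋² = ℝ² / (ℤ b₀ + ℤ b₁)`; every flat 2-torus is isometric to one of these. -/
abbrev Torus (b : Module.Basis (Fin 2) ℝ Plane) : Type := Plane ⧸ lattice b

/-- The flat cylinder `𝕋² × ℝ`; a point is a pair `(q, z)`. -/
abbrev Cyl (b : Module.Basis (Fin 2) ℝ Plane) : Type := Torus b × ℝ

variable (b : Module.Basis (Fin 2) ℝ Plane)

/-- The universal covering of the cylinder. As the metrics are flat, it is a local isometry, and
`v ↦ x + covering b v` is the Riemannian exponential map at the point `x`. -/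
def covering (v : Cover) : Cyl b := (QuotientAddGroup.mk !₂[v 0, v 1], v 2)

/-- A function on the cylinder, read in normal coordinates centred at `x`. -/
def inCoords (f : Cyl b → ℝ) (x : Cyl b) : Cover → ℝ := fun v => f (x + covering b v)

/-- A function on the torus, read in normal coordinates centred at `q`. -/
def inTorusCoords (h : Torus b → ℝ) (q : Torus b) : Plane → ℝ :=
  fun v => h (q + QuotientAddGroup.mk v)

/-- `f` is smooth near the point `x`. -/
def SmoothAt (f : Cyl b → ℝ) (x : Cyl b) : Prop := ContDiffAt ℝ ∞ (inCoords b f x) 0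

/-- The Laplacian of a function on the cylinder, with the sign convention
`Δ = ∂ₓ² + ∂ᵧ² + ∂_z²`. -/
def laplacian (f : Cyl b → ℝ) (x : Cyl b) : ℝ := Laplacian.laplacian (inCoords b f x) 0

/-- The norm `|∇ᵏ f|` of the `k`-th covariant derivative at `x`. -/
def normNabla (k : ℕ) (f : Cyl b → ℝ) (x : Cyl b) : ℝ :=
  ‖iteratedFDeriv ℝ k (inCoords b f x) 0‖

/-- The area measure of the flat torus: Lebesgue measure on the fundamental parallelogram. -/
def torusMeasure : Measure (Torus b) :=
  (volume.restrict (ZSpan.fundamentalDomain b)).map QuotientAddGroup.mk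

/-- The total area of the torus. -/
def area : ℝ := (torusMeasure b).real univ

/-- The Riemannian volume of the cylinder. -/
def cylMeasure : Measure (Cyl b) := (torusMeasure b).prod volume

/-- The Riemannian distance of the product metric on the cylinder. -/
def cylDist (x y : Cyl b) : ℝ := √(dist x.1 y.1 ^ 2 + (x.2 - y.2) ^ 2)

/-- `μ` is an eigenvalue of `-Δ` on the torus. -/
def IsTorusEigenvalue (μ : ℝ) : Prop :=
  ∃ h : Torus b → ℝ, h ≠ 0 ∧
    (∀ q, ContDiffAt ℝ ∞ (inTorusCoords b h q) 0) ∧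
    ∀ q, -Laplacian.laplacian (inTorusCoords b h q) 0 = μ * h q

/-- `λ₁` is the smallest positive eigenvalue of `-Δ` on the torus. -/
def IsFirstEigenvalue (lam : ℝ) : Prop := IsLeast {μ : ℝ | 0 < μ ∧ IsTorusEigenvalue b μ} lam

/-- Test functions on an open subset `U` of the cylinder. -/
def IsTestFunction (U : Set (Cyl b)) (φ : Cyl b → ℝ) : Prop :=
  (∀ x, SmoothAt b φ x) ∧ HasCompactSupport φ ∧ tsupport φ ⊆ U

/-- `-Δ V = 2π ∑_{p ∈ P} δ_p` on the open set `U`: the function `V` (whose values at the poles are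
irrelevant) is smooth in `U` away from `P`, is locally integrable in `U`, and satisfies the
equation in the sense of distributions. -/
def SolvesPoisson (U : Set (Cyl b)) (P : Finset (Cyl b)) (V : Cyl b → ℝ) : Prop :=
  (∀ x ∈ U, x ∉ P → SmoothAt b V x) ∧
  LocallyIntegrableOn V U (cylMeasure b) ∧
  ∀ φ : Cyl b → ℝ, IsTestFunction b U φ →
    ∫ x, V x * (-laplacian b φ x) ∂(cylMeasure b) = 2 * Real.pi * ∑ p ∈ P, φ p

/-- The Dirichlet Green's function on `𝕋² × [-R, R]`: `-Δ V = 2π δ_p` for `-R < z < R`, and `V`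
extends continuously by `0` to `z = ±R`. Values for `|z| > R` are irrelevant. -/
def IsDirichletGreen (p : Cyl b) (R : ℝ) (V : Cyl b → ℝ) : Prop :=
  SolvesPoisson b {x | |x.2| < R} {p} V ∧
  ContinuousOn V ({x | |x.2| ≤ R} \ {p}) ∧
  ∀ x : Cyl b, |x.2| = R → V x = 0

/-- The supremum of `f` over the unit sphere `∂B₁(p)`. -/
def supUnitSphere (f : Cyl b → ℝ) (p : Cyl b) : ℝ := sSup (f '' {x | cylDist b x p = 1})

/-- `V` takes positive and negative values away from the set `P`. -/
def SignChanging (P : Finset (Cyl b)) (V : Cyl b → ℝ) : Prop :=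
  (∃ x ∉ P, 0 < V x) ∧ ∃ x ∉ P, V x < 0

/-- The average of `V` over the fiber `𝕋² × {z}`. -/
def fiberAverage (V : Cyl b → ℝ) (z : ℝ) : ℝ := ⨍ q, V (q, z) ∂(torusMeasure b)

/-- On the end `z → +∞` of the cylinder (beyond all the poles) the fiber averages of `V` are
given by the linear function `κ z + β`, and all derivatives of `V - (κ z + β)` are
`O(exp(-√λ z))`, uniformly in the torus variable. -/
def LinearAtTop (P : Finset (Cyl b)) (lam : ℝ) (V : Cyl b → ℝ) (κ β : ℝ) : Prop :=
  (∀ z : ℝ, (∀ p ∈ P, p.2 < z) → fiberAverage b V z = κ * z + β) ∧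
  ∀ k : ℕ, normNabla b k (fun x => V x - (κ * x.2 + β))
    =O[comap (fun x : Cyl b => x.2) atTop] fun x => Real.exp (-√lam * x.2)

/-- The analogue of `LinearAtTop` on the end `z → -∞`, with rate `O(exp(√λ z))`. -/
def LinearAtBot (P : Finset (Cyl b)) (lam : ℝ) (V : Cyl b → ℝ) (κ β : ℝ) : Prop :=
  (∀ z : ℝ, (∀ p ∈ P, z < p.2) → fiberAverage b V z = κ * z + β) ∧
  ∀ k : ℕ, normNabla b k (fun x => V x - (κ * x.2 + β))
    =O[comap (fun x : Cyl b => x.2) atBot] fun x => Real.exp (√lam * x.2)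

end FlatCylinder

end

open FlatCylinder

/-! Everything rests on one Green's function G = `green` of the whole cylinder, with pole at the
origin. On ℝ³ the function 1/(2|v|) satisfies -Δ = 2πδ. Cut off near its pole and pushed down to the
cylinder, it becomes a function S with -ΔS = 2πδ + ρ, where ρ is smooth, compactly supported, of
mass -2π, and even in the height. It remains to solve -Δu = -ρ and put G = S + u.

With A the area of the torus, separation of variables proposes the fundamental solution E =
-|z|/(2A) + ∑_{k≠0} exp(-√λ_k |z|) cos_k / (2A√λ_k), but coefficients of size 1/|k| are not summable
over ℤ². Dividing the k-th term by λ_k gives an absolutely convergent kernel K = `kernelOsc`, and E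
= -|z|/(2A) + (-Δ_T)K holds weakly, where Δ_T is the Laplacian in the torus variable: this is
`test_representation`, which combines Fourier inversion on the torus with one-dimensional
fundamental solutions in z. Moving Δ_T onto ρ gives u = (|z|/(2A)) * ρ - K * (-Δ_T ρ). Beyond the
support of ρ the first summand is exactly -π|z|/A, because ρ has mass -2π and no first moment in the
height. The second decays like exp(-√λ₁|z|) with all derivatives, because K does and the derivatives
can be put on the smooth density. Slopes and asymptotics follow (`green_eq_of_height`,
`norm_iteratedFDeriv_oscPart_le`).

The Fourier coefficients of a weakly harmonic function along the fibers are weak solutions of a'' =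
λa with λ ≥ 0. After mollification a² is convex, so a obeys a maximum principle even if a is not
known to be continuous at one height (`sq_le_max_of_weak`). This yields uniqueness of the Dirichlet
Green's function (`eq_zero_of_weakly_harmonic`), and applied to G + π|z|/A it shows that the fiber
averages of G are exactly linear on each side (`fiberAverage_green`).

The Dirichlet Green's function V_R is G + πR/A plus alternating reflected images of the decaying
part of G at the heights ±2R, ±4R, …; on |z| = R the images telescope against the decaying part
itself (`imageSum_boundary`). For |z| ≤ R the image sum is O(exp(-√λ₁ R)), so V_R - πR/A converges
to G, and its supremum over the unit sphere converges too; in V_R - C_R the divergent constant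
cancels. Several poles are handled by adding translates of G. The sum tends to +∞ at the poles and,
having negative slope, to -∞ as z → +∞, so it changes sign. -/

noncomputable section

namespace FlatCylinder

/-! ### Integration by parts along one-parameter subgroups. -/

section Invariant

variable {X : Type*} [TopologicalSpace X] [AddCommGroup X] [IsTopologicalAddGroup X] [T2Space X]
  [MeasurableSpace X] [BorelSpace X] (μ : Measure X) [μ.IsAddRightInvariant]
  [IsFiniteMeasureOnCompacts μ]

/-- A derivative along a one-parameter subgroup integrates to zero. -/
theorem integral_lineDeriv_eq_zero (θ : ℝ →+ X) (hθ : Continuous θ) {G H : X → ℝ}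
    (hG : Continuous G) (hH : Continuous H) (cG : HasCompactSupport G) (cH : HasCompactSupport H)
    (hd : ∀ x, HasDerivAt (fun t => G (x + θ t)) (H x) 0) : ∫ x, H x ∂μ = 0 := by
  obtain ⟨C, hC⟩ := cH.exists_bound_of_continuous hH
  -- K contains every point that a translation with |t| ≤ 1 carries into the support of H, so C
  -- times its indicator dominates all the difference quotients at once.
  set K : Set X := (fun p : X × ℝ => p.1 - θ p.2) '' (tsupport H ×ˢ Icc (-1) 1) with hK
  have hKc : IsCompact K := (cH.isCompact.prod isCompact_Icc).image (by fun_prop)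
  have key := hasDerivAt_integral_of_dominated_loc_of_deriv_le (μ := μ)
    (F := fun t x => G (x + θ t)) (F' := fun t x => H (x + θ t)) (x₀ := 0)
    (s := Icc (-1) 1) (bound := K.indicator fun _ => C) (Icc_mem_nhds (by norm_num) (by norm_num))
    (Eventually.of_forall fun t => (by fun_prop : Continuous fun x => G (x + θ t)).aestronglyMeasurable)
    (by simpa using hG.integrable_of_hasCompactSupport cG)
    (by simpa using hH.aestronglyMeasurable)
    (Eventually.of_forall fun x t ht => by
      by_cases hx : x ∈ K
      · rw [indicator_of_mem hx]; exact hC _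
      · rw [indicator_of_notMem hx]
        have : x + θ t ∉ tsupport H := fun h => hx ⟨(x + θ t, t), ⟨h, ht⟩, by simp⟩
        rw [image_eq_zero_of_notMem_tsupport this, norm_zero])
    ((integrable_indicator_iff hKc.measurableSet).2
      (integrableOn_const hKc.measure_lt_top.ne))
    (Eventually.of_forall fun x t _ => by
      have h1 := hd (x + θ t)
      rw [← sub_self t] at h1
      have h2 := h1.comp_sub_const t t
      refine h2.congr_of_eventuallyEq (Eventually.of_forall fun s => ?_)
      simp [add_assoc])
  have h2 := key.2
  simp only [map_zero, add_zero] at h2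
  -- By translation invariance the integral of the translated G does not depend on t; its
  -- derivative, the integral of H, is therefore zero.
  have h3 : (fun t => ∫ x, G (x + θ t) ∂μ) = fun _ => ∫ x, G x ∂μ := by
    funext t
    exact integral_add_right_eq_self (μ := μ) G (θ t)
  rw [h3] at h2
  exact h2.unique (hasDerivAt_const _ _)

omit [T2Space X] [MeasurableSpace X] [BorelSpace X] in
theorem lineDeriv_support_subset (θ : ℝ →+ X) (hθ : Continuous θ) {G H : X → ℝ}
    (hd : ∀ x, HasDerivAt (fun t => G (x + θ t)) (H x) 0) :
    Function.support H ⊆ tsupport G := by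
  intro x hx
  by_contra hn
  have h0 : ∀ᶠ y in 𝓝 x, G y = 0 := by
    filter_upwards [(isClosed_tsupport G).isOpen_compl.mem_nhds hn] with y hy
      using image_eq_zero_of_notMem_tsupport hy
  have ht : Tendsto (fun t => x + θ t) (𝓝 0) (𝓝 x) := by
    have : Continuous fun t => x + θ t := by fun_prop
    simpa using this.tendsto 0
  exact hx ((hd x).unique ((hasDerivAt_const _ _).congr_of_eventuallyEq (ht.eventually h0)))

omit [T2Space X] [MeasurableSpace X] [BorelSpace X] in
theorem lineDeriv_hasCompactSupport (θ : ℝ →+ X) (hθ : Continuous θ) {G H : X → ℝ}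
    (cG : HasCompactSupport G)
    (hd : ∀ x, HasDerivAt (fun t => G (x + θ t)) (H x) 0) : HasCompactSupport H :=
  cG.mono' (lineDeriv_support_subset θ hθ hd)

/-- Green's second identity along a one-parameter subgroup. -/
theorem integral_mul_lineDeriv_two (θ : ℝ →+ X) (hθ : Continuous θ) {g g₁ g₂ φ φ₁ φ₂ : X → ℝ}
    (hg : Continuous g) (hg₁ : Continuous g₁) (hg₂ : Continuous g₂)
    (hφ : Continuous φ) (hφ₁ : Continuous φ₁) (hφ₂ : Continuous φ₂) (cφ : HasCompactSupport φ)
    (dg : ∀ x, HasDerivAt (fun t => g (x + θ t)) (g₁ x) 0)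
    (dg₁ : ∀ x, HasDerivAt (fun t => g₁ (x + θ t)) (g₂ x) 0)
    (dφ : ∀ x, HasDerivAt (fun t => φ (x + θ t)) (φ₁ x) 0)
    (dφ₁ : ∀ x, HasDerivAt (fun t => φ₁ (x + θ t)) (φ₂ x) 0) :
    ∫ x, g x * φ₂ x ∂μ = ∫ x, g₂ x * φ x ∂μ := by
  have cφ₁ := lineDeriv_hasCompactSupport θ hθ cφ dφ
  have cφ₂ := lineDeriv_hasCompactSupport θ hθ cφ₁ dφ₁
  have i1 : Integrable (fun x => g x * φ₂ x) μ :=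
    (hg.mul hφ₂).integrable_of_hasCompactSupport cφ₂.mul_left
  have i2 : Integrable (fun x => g₂ x * φ x) μ :=
    (hg₂.mul hφ).integrable_of_hasCompactSupport cφ.mul_left
  rw [← sub_eq_zero, ← integral_sub i1 i2]
  -- The Wronskian g φ₁ - g₁ φ has derivative g φ₂ - g₂ φ along θ, the mixed terms cancelling, and φ
  -- gives it compact support.
  refine integral_lineDeriv_eq_zero μ θ hθ (G := fun x => g x * φ₁ x - g₁ x * φ x)
    (by fun_prop) (by fun_prop)
    (cφ₁.mul_left.sub cφ.mul_left) (cφ₂.mul_left.sub cφ.mul_left) fun x => ?_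
  have := ((dg x).mul (dφ₁ x)).sub ((dg₁ x).mul (dφ x))
  simp only [map_zero, add_zero] at this
  convert! this using 1
  ring

end Invariant

/-! ### Second partial derivatives on Euclidean space. -/

section Directional

variable {n : ℕ}

/-- The second partial derivative in the direction of a coordinate axis. -/
def dd (i : Fin n) (f : EuclideanSpace ℝ (Fin n) → ℝ) (v : EuclideanSpace ℝ (Fin n)) : ℝ :=
  iteratedFDeriv ℝ 2 f v fun _ => EuclideanSpace.single i 1

theorem laplacian_eq_sum_dd (f : EuclideanSpace ℝ (Fin n) → ℝ) (v : EuclideanSpace ℝ (Fin n)) :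
    Laplacian.laplacian f v = ∑ i, dd i f v := by
  rw [InnerProductSpace.laplacian_eq_iteratedFDeriv_orthonormalBasis f
    (EuclideanSpace.basisFun (Fin n) ℝ)]
  simp only [dd, EuclideanSpace.basisFun_apply]
  refine Finset.sum_congr rfl fun i _ => congrArg _ ?_
  funext j; fin_cases j <;> rfl

theorem hasDerivAt_line {f : EuclideanSpace ℝ (Fin n) → ℝ} {v : EuclideanSpace ℝ (Fin n)}
    (hf : DifferentiableAt ℝ f v) (w : EuclideanSpace ℝ (Fin n)) :
    HasDerivAt (fun t : ℝ => f (v + t • w)) (fderiv ℝ f v w) 0 := by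
  have h1 : HasDerivAt (fun t : ℝ => v + t • w) w 0 := by
    simpa using ((hasDerivAt_id (0:ℝ)).smul_const w).const_add v
  have h2 : HasFDerivAt f (fderiv ℝ f v) (v + (0:ℝ) • w) := by simpa using hf.hasFDerivAt
  exact h2.comp_hasDerivAt (0:ℝ) h1

theorem hasDerivAt_line_two {f : EuclideanSpace ℝ (Fin n) → ℝ} {v : EuclideanSpace ℝ (Fin n)}
    (hf : ContDiffAt ℝ 2 f v) (i : Fin n) :
    HasDerivAt (fun t : ℝ => fderiv ℝ f (v + t • EuclideanSpace.single i 1)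
      (EuclideanSpace.single i 1)) (dd i f v) 0 := by
  have h0 : DifferentiableAt ℝ (fderiv ℝ f) v :=
    (hf.fderiv_right (m := 1) (by norm_num)).differentiableAt (by norm_num)
  have h1 : HasDerivAt (fun t : ℝ => v + t • EuclideanSpace.single i (1:ℝ))
      (EuclideanSpace.single i 1) 0 := by
    simpa using ((hasDerivAt_id (0:ℝ)).smul_const (EuclideanSpace.single i (1:ℝ))).const_add v
  have h2 : HasFDerivAt (fderiv ℝ f) (fderiv ℝ (fderiv ℝ f) v)
      (v + (0:ℝ) • EuclideanSpace.single i (1:ℝ)) := by simpa using h0.hasFDerivAt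
  have h3 := h2.comp_hasDerivAt (0:ℝ) h1
  have h4 := (ContinuousLinearMap.apply ℝ ℝ
    (EuclideanSpace.single i (1:ℝ) : EuclideanSpace ℝ (Fin n))).hasFDerivAt.comp_hasDerivAt (0:ℝ) h3
  have h5 : dd i f v = fderiv ℝ (fderiv ℝ f) v (EuclideanSpace.single i 1)
      (EuclideanSpace.single i 1) := by
    rw [dd, iteratedFDeriv_two_apply]
  rw [h5]
  exact h4

/-- Reduces a second partial derivative to two differentiations in one variable: near v the function
f₁ must agree with the first derivative of f, because f is C² there. -/
theorem dd_eq_of_hasDerivAt {f f₁ : EuclideanSpace ℝ (Fin n) → ℝ} {v : EuclideanSpace ℝ (Fin n)}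
    {i : Fin n} {c : ℝ} (hf : ContDiffAt ℝ 2 f v)
    (h₁ : ∀ᶠ w in 𝓝 v, HasDerivAt (fun t : ℝ => f (w + t • EuclideanSpace.single i 1)) (f₁ w) 0)
    (h₂ : HasDerivAt (fun t : ℝ => f₁ (v + t • EuclideanSpace.single i 1)) c 0) :
    dd i f v = c := by
  have hev : ∀ᶠ w in 𝓝 v, f₁ w = fderiv ℝ f w (EuclideanSpace.single i 1) := by
    have hd : ∀ᶠ w in 𝓝 v, ContDiffAt ℝ 2 f w := hf.eventually (by simp)
    filter_upwards [h₁, hd] with w h hw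
    exact h.unique (hasDerivAt_line (hw.differentiableAt (by norm_num)) _)
  have hc : Tendsto (fun t : ℝ => v + t • EuclideanSpace.single i (1:ℝ)) (𝓝 0) (𝓝 v) := by
    have : Continuous fun t : ℝ => v + t • EuclideanSpace.single i (1:ℝ) := by fun_prop
    simpa using this.tendsto 0
  exact (hasDerivAt_line_two hf i).unique
    (h₂.congr_of_eventuallyEq ((hc.eventually hev).mono fun t ht => ht.symm))

theorem contDiff_dd {f : EuclideanSpace ℝ (Fin n) → ℝ} (hf : ContDiff ℝ ∞ f) (i : Fin n) :
    ContDiff ℝ ∞ (dd i f) := by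
  have h1 : ContDiff ℝ ∞ (iteratedFDeriv ℝ 2 f) :=
    hf.iteratedFDeriv_right (m := ∞) (by norm_cast)
  have : dd i f = fun v => ContinuousMultilinearMap.apply ℝ (fun _ : Fin 2 => EuclideanSpace ℝ (Fin n)) ℝ
      (fun _ => EuclideanSpace.single i 1) (iteratedFDeriv ℝ 2 f v) := rfl
  rw [this]
  exact (ContinuousLinearMap.contDiff _).comp h1

theorem dd_comp_add_left (i : Fin n) (f : EuclideanSpace ℝ (Fin n) → ℝ)
    (a v : EuclideanSpace ℝ (Fin n)) : dd i (fun w => f (a + w)) v = dd i f (a + v) := by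
  simp only [dd, iteratedFDeriv_comp_add_left]

theorem dd_congr {f g : EuclideanSpace ℝ (Fin n) → ℝ} {v : EuclideanSpace ℝ (Fin n)} {i : Fin n}
    (h : f =ᶠ[𝓝 v] g) : dd i f v = dd i g v := by
  simp only [dd, (h.iteratedFDeriv ℝ 2).eq_of_nhds]

/-- The one-parameter group of translations along a coordinate axis. -/
def axis (i : Fin n) : ℝ →+ EuclideanSpace ℝ (Fin n) where
  toFun t := t • EuclideanSpace.single i 1
  map_zero' := by simp
  map_add' s t := add_smul _ _ _

theorem continuous_axis (i : Fin n) : Continuous (axis i : ℝ → EuclideanSpace ℝ (Fin n)) := by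
  change Continuous fun t : ℝ => t • EuclideanSpace.single i (1:ℝ)
  fun_prop

theorem continuous_fderiv_single {f : EuclideanSpace ℝ (Fin n) → ℝ} (hf : ContDiff ℝ ∞ f)
    (w : EuclideanSpace ℝ (Fin n)) : Continuous fun v => fderiv ℝ f v w :=
  (hf.continuous_fderiv (by simp)).clm_apply continuous_const

/-- Integration by parts for the second partial derivatives on Euclidean space. -/
theorem integral_mul_dd {f φ : EuclideanSpace ℝ (Fin n) → ℝ} (hf : ContDiff ℝ ∞ f)
    (hφ : ContDiff ℝ ∞ φ) (cφ : HasCompactSupport φ) (i : Fin n) :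
    ∫ v, f v * dd i φ v = ∫ v, dd i f v * φ v :=
  integral_mul_lineDeriv_two volume (axis i) (continuous_axis i)
    hf.continuous (continuous_fderiv_single hf _) (contDiff_dd hf i).continuous
    hφ.continuous (continuous_fderiv_single hφ _) (contDiff_dd hφ i).continuous cφ
    (fun v => hasDerivAt_line (hf.differentiable (by simp) v) _)
    (fun v => hasDerivAt_line_two (hf.contDiffAt.of_le (by norm_cast)) i)
    (fun v => hasDerivAt_line (hφ.differentiable (by simp) v) _)
    (fun v => hasDerivAt_line_two (hφ.contDiffAt.of_le (by norm_cast)) i)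

theorem hasCompactSupport_dd {φ : EuclideanSpace ℝ (Fin n) → ℝ} (hφ : ContDiff ℝ ∞ φ)
    (cφ : HasCompactSupport φ) (i : Fin n) : HasCompactSupport (dd i φ) :=
  lineDeriv_hasCompactSupport (axis i) (continuous_axis i)
    (lineDeriv_hasCompactSupport (axis i) (continuous_axis i) cφ
      (fun v => hasDerivAt_line (hφ.differentiable (by simp) v) _))
    (fun v => hasDerivAt_line_two (hφ.contDiffAt.of_le (by norm_cast)) i)

theorem dd_eq_zero_of_notMem_tsupport {φ : EuclideanSpace ℝ (Fin n) → ℝ}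
    {v : EuclideanSpace ℝ (Fin n)} (hv : v ∉ tsupport φ) (i : Fin n) : dd i φ v = 0 := by
  have : φ =ᶠ[𝓝 v] fun _ => 0 := by
    filter_upwards [(isClosed_tsupport φ).isOpen_compl.mem_nhds hv] with w hw
      using image_eq_zero_of_notMem_tsupport hw
  rw [dd_congr this]
  simp [dd]

end Directional

end FlatCylinder

end

/-! ### The universal covering, calculus through lifts, and the Haar measure of the cylinder. -/

noncomputable section

namespace FlatCylinder

open scoped Pointwise

/-- The horizontal part of a vector of the universal cover. -/
def hor : Cover →L[ℝ] Plane :=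
  LinearMap.toContinuousLinearMap
    { toFun := fun v => !₂[v 0, v 1]
      map_add' := fun v w => by ext i; fin_cases i <;> simp
      map_smul' := fun c v => by ext i; fin_cases i <;> simp }

theorem hor_apply (v : Cover) : hor v = !₂[v 0, v 1] := rfl

/-- The vector with given horizontal part and height. -/
def joinHeight (w : Plane) (z : ℝ) : Cover := !₂[w 0, w 1, z]

@[simp] theorem hor_joinHeight (w : Plane) (z : ℝ) : hor (joinHeight w z) = w := by
  ext i; fin_cases i <;> simp [hor_apply, joinHeight]

@[simp] theorem joinHeight_two (w : Plane) (z : ℝ) : joinHeight w z 2 = z := by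
  simp [joinHeight]

theorem joinHeight_hor (v : Cover) : joinHeight (hor v) (v 2) = v := by
  ext i; fin_cases i <;> simp [hor_apply, joinHeight]

theorem continuous_joinHeight : Continuous fun p : Plane × ℝ => joinHeight p.1 p.2 := by
  unfold joinHeight
  refine (PiLp.continuous_toLp 2 _).comp (continuous_pi fun i => ?_)
  fin_cases i <;> simp <;> fun_prop

/-- Splitting of the universal cover into plane and height. -/
def splitEquiv : Cover ≃ᵐ Plane × ℝ where
  toFun v := (hor v, v 2)
  invFun p := joinHeight p.1 p.2
  left_inv v := joinHeight_hor v
  right_inv p := by simp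
  measurable_toFun := by
    have : Continuous fun v : Cover => (hor v, v 2) := by fun_prop
    exact this.measurable
  measurable_invFun := continuous_joinHeight.measurable

theorem measurePreserving_splitEquiv : MeasurePreserving splitEquiv := by
  have h1 := EuclideanSpace.volume_preserving_symm_measurableEquiv_toLp (Fin 3)
  have h2 := volume_preserving_piFinSuccAbove (fun _ : Fin 3 => ℝ) 2
  have h3 : MeasurePreserving (Prod.swap : ℝ × (Fin 2 → ℝ) → (Fin 2 → ℝ) × ℝ) :=
    Measure.measurePreserving_swap
  have h4 := ((EuclideanSpace.volume_preserving_symm_measurableEquiv_toLp (Fin 2)).symm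
    (MeasurableEquiv.toLp 2 (Fin 2 → ℝ)).symm).prod (MeasurePreserving.id (volume : Measure ℝ))
  have h5 := h4.comp (h3.comp (h2.comp h1))
  convert! h5 using 1
  funext v
  refine Prod.ext ?_ rfl
  ext i
  fin_cases i <;> rfl

variable (b : Module.Basis (Fin 2) ℝ Plane)

theorem covering_eq (v : Cover) : covering b v = (QuotientAddGroup.mk (hor v), v 2) := rfl

/-- The covering as a homomorphism. -/
def coveringHom : Cover →+ Cyl b where
  toFun := covering b
  map_zero' := by
    rw [covering_eq, map_zero]; rfl
  map_add' v w := by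
    simp only [covering_eq, map_add]; rfl

theorem covering_add (v w : Cover) : covering b (v + w) = covering b v + covering b w :=
  map_add (coveringHom b) v w

theorem covering_zero : covering b 0 = 0 := map_zero (coveringHom b)

theorem covering_neg (v : Cover) : covering b (-v) = -covering b v := map_neg (coveringHom b) v

theorem covering_sub (v w : Cover) : covering b (v - w) = covering b v - covering b w :=
  map_sub (coveringHom b) v w

@[simp] theorem covering_snd (v : Cover) : (covering b v).2 = v 2 := rfl

theorem continuous_covering : Continuous (covering b) := by
  have h : Continuous fun v : Cover => (QuotientAddGroup.mk (hor v) : Torus b) :=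
    continuous_quotient_mk'.comp hor.continuous
  exact h.prodMk (by fun_prop)

theorem covering_joinHeight (w : Plane) (z : ℝ) :
    covering b (joinHeight w z) = (QuotientAddGroup.mk w, z) := by
  rw [covering_eq, hor_joinHeight, joinHeight_two]

theorem covering_surjective : Function.Surjective (covering b) := by
  rintro ⟨q, z⟩
  obtain ⟨w, rfl⟩ := QuotientAddGroup.mk_surjective q
  exact ⟨joinHeight w z, covering_joinHeight b w z⟩

theorem isOpenMap_covering : IsOpenMap (covering b) := by
  have h1 : IsOpenMap fun v : Cover => (hor v, v 2) := by
    have h := (Homeomorph.mk splitEquiv.toEquiv (by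
      change Continuous fun v : Cover => (hor v, v 2); fun_prop) continuous_joinHeight).isOpenMap
    exact h
  have h2 : IsOpenMap (Prod.map (QuotientAddGroup.mk : Plane → Torus b) (id : ℝ → ℝ)) :=
    (QuotientAddGroup.isOpenMap_coe).prodMap IsOpenMap.id
  exact h2.comp h1

theorem isOpenQuotientMap_covering : IsOpenQuotientMap (covering b) :=
  ⟨covering_surjective b, continuous_covering b, isOpenMap_covering b⟩

variable {b}

theorem continuous_iff_comp_covering {Y : Type*} [TopologicalSpace Y] {f : Cyl b → Y} :
    Continuous f ↔ Continuous (f ∘ covering b) :=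
  (isOpenQuotientMap_covering b).isQuotientMap.continuous_iff

theorem continuousAt_iff_comp_covering {Y : Type*} [TopologicalSpace Y] {f : Cyl b → Y}
    {v : Cover} : ContinuousAt f (covering b v) ↔ ContinuousAt (f ∘ covering b) v :=
  (isOpenQuotientMap_covering b).continuousAt_comp_iff.symm

/-- Normal coordinates at `covering b v` are a translate of the lift of f. Smoothness and
derivatives on the cylinder thus become statements about `f ∘ covering b` on ℝ³. -/
theorem inCoords_covering (f : Cyl b → ℝ) (v : Cover) :
    inCoords b f (covering b v) = fun w => (f ∘ covering b) (v + w) := by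
  funext w; simp [inCoords, covering_add]

theorem smoothAt_covering {f : Cyl b → ℝ} {v : Cover} :
    SmoothAt b f (covering b v) ↔ ContDiffAt ℝ ∞ (f ∘ covering b) v := by
  rw [SmoothAt, inCoords_covering]
  constructor
  · intro h
    have h2 : ContDiffAt ℝ ∞ (fun w : Cover => w - v) v := by fun_prop
    have h4 : ContDiffAt ℝ ∞ (fun w => (f ∘ covering b) (v + w)) ((fun w : Cover => w - v) v) := by
      simpa only [sub_self] using h
    simpa [Function.comp_def] using
      ContDiffAt.comp (g := fun w => (f ∘ covering b) (v + w)) (f := fun w : Cover => w - v) v h4 h2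
  · intro h
    have h2 : ContDiffAt ℝ ∞ (fun w : Cover => v + w) 0 := by fun_prop
    have h3 : ContDiffAt ℝ ∞ (f ∘ covering b) (v + 0) := by simpa using h
    exact h3.comp 0 h2

theorem smooth_iff {f : Cyl b → ℝ} :
    (∀ x, SmoothAt b f x) ↔ ContDiff ℝ ∞ (f ∘ covering b) := by
  rw [contDiff_iff_contDiffAt, (covering_surjective b).forall]
  simp only [smoothAt_covering]

/-- Second partial derivatives on the cylinder. -/
def pd (i : Fin 3) (f : Cyl b → ℝ) (x : Cyl b) : ℝ := dd i (inCoords b f x) 0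

theorem pd_covering (i : Fin 3) (f : Cyl b → ℝ) (v : Cover) :
    pd i f (covering b v) = dd i (f ∘ covering b) v := by
  rw [pd, inCoords_covering, dd_comp_add_left, add_zero]

theorem pd_comp_covering (i : Fin 3) (f : Cyl b → ℝ) :
    pd i f ∘ covering b = dd i (f ∘ covering b) := funext fun v => pd_covering i f v

theorem laplacian_eq_sum_pd (f : Cyl b → ℝ) (x : Cyl b) :
    laplacian b f x = ∑ i, pd i f x := laplacian_eq_sum_dd _ _

theorem normNabla_covering (k : ℕ) (f : Cyl b → ℝ) (v : Cover) :
    normNabla b k f (covering b v) = ‖iteratedFDeriv ℝ k (f ∘ covering b) v‖ := by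
  rw [normNabla, inCoords_covering, iteratedFDeriv_comp_add_left, add_zero]

variable (b)

theorem measurable_torus_mk : Measurable (QuotientAddGroup.mk : Plane → Torus b) :=
  Continuous.measurable QuotientAddGroup.continuous_mk

/-- A translate of a fundamental domain is a fundamental domain, and lattice-invariant sets have the
same measure in any two of them. This gives invariance of the torus measure, and later allows
integration over the parallelogram centred at the origin. -/
theorem torusMeasure_eq_map_vadd (c : Plane) :
    (volume.restrict (c +ᵥ ZSpan.fundamentalDomain b)).map QuotientAddGroup.mk
      = torusMeasure b := by
  have hD := ZSpan.isAddFundamentalDomain' b (volume : Measure Plane)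
  have hmk := measurable_torus_mk b
  have : Countable (lattice b) :=
    inferInstanceAs (Countable (Submodule.span ℤ (Set.range b)))
  have : VAddCommClass Plane (lattice b) Plane := ⟨fun m n x => by
    simp only [AddSubgroup.vadd_def, vadd_eq_add]; abel⟩
  ext A hA
  rw [torusMeasure, Measure.map_apply hmk hA, Measure.map_apply hmk hA,
    Measure.restrict_apply (hmk hA), Measure.restrict_apply (hmk hA)]
  refine (hD.vadd_of_comm c).measure_set_eq hD (hmk hA) fun g => ?_
  ext x
  simp only [mem_preimage, AddSubgroup.vadd_def, vadd_eq_add]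
  rw [show ((↑((g : Plane) + x) : Torus b)) = (x : Torus b) from ?_]
  exact (QuotientAddGroup.eq.2 (by simp)).symm

theorem torusMeasure_univ : torusMeasure b univ = volume (ZSpan.fundamentalDomain b) := by
  have hmk := measurable_torus_mk b
  rw [torusMeasure, Measure.map_apply hmk MeasurableSet.univ]
  simp

instance : IsFiniteMeasure (torusMeasure b) :=
  ⟨by rw [torusMeasure_univ]; exact (ZSpan.fundamentalDomain_isBounded b).measure_lt_top⟩

theorem area_pos : 0 < area b := by
  rw [area, Measure.real, ENNReal.toReal_pos_iff]
  refine ⟨pos_iff_ne_zero.2 ?_, measure_lt_top _ _⟩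
  rw [torusMeasure_univ]
  exact ZSpan.measure_fundamentalDomain_ne_zero b

/-- Translation by the class of c carries Lebesgue measure on the parallelogram to Lebesgue measure
on its translate by c, which induces the same measure on the torus. -/
instance : (torusMeasure b).IsAddLeftInvariant := ⟨fun q => by
  obtain ⟨c, rfl⟩ := QuotientAddGroup.mk_surjective q
  have hmk := measurable_torus_mk b
  conv_rhs => rw [← torusMeasure_eq_map_vadd b c]
  rw [torusMeasure, Measure.map_map (by fun_prop) hmk]
  have h1 : (fun x : Torus b => (c : Torus b) + x) ∘ QuotientAddGroup.mk
      = QuotientAddGroup.mk ∘ fun x : Plane => c + x := by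
    funext x; rfl
  rw [h1, ← Measure.map_map hmk (by fun_prop)]
  congr 1
  ext A hA
  rw [Measure.map_apply (by fun_prop) hA, Measure.restrict_apply (measurable_const_add c hA),
    Measure.restrict_apply hA, ← measure_preimage_add (volume : Measure Plane) c (A ∩ _),
    preimage_inter]
  congr 2
  ext x
  simp [mem_vadd_set_iff_neg_vadd_mem]⟩

instance : CompactSpace (Torus b) := by
  have h : (univ : Set (Torus b)) =
      QuotientAddGroup.mk '' (closure (ZSpan.fundamentalDomain b)) := by
    refine (eq_univ_of_forall fun q => ?_).symm
    obtain ⟨c, rfl⟩ := QuotientAddGroup.mk_surjective q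
    refine ⟨ZSpan.fract b c, subset_closure (ZSpan.fract_mem_fundamentalDomain b c), ?_⟩
    refine QuotientAddGroup.eq.2 ?_
    rw [ZSpan.fract_apply]
    simp
  exact ⟨h ▸ ((ZSpan.fundamentalDomain_isBounded b).isCompact_closure).image
    continuous_quotient_mk'⟩

instance : (torusMeasure b).IsAddHaarMeasure := by
  have : (torusMeasure b).IsOpenPosMeasure :=
    isOpenPosMeasure_of_addLeftInvariant_of_compact univ isCompact_univ (by
      intro h
      have := area_pos b
      rw [area, Measure.real, h] at this
      simp at this)
  exact {}

instance : (cylMeasure b).IsAddHaarMeasure := by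
  unfold cylMeasure; infer_instance

instance : SFinite (cylMeasure b) := by unfold cylMeasure; infer_instance

end FlatCylinder

end

/-! ### Fourier series on the torus. -/

noncomputable section

namespace FlatCylinder

variable (b : Module.Basis (Fin 2) ℝ Plane)

/-- The integral linear form with coefficients `k` in the lattice coordinates. -/
def latticeForm (k : Fin 2 → ℤ) : Plane →L[ℝ] ℝ :=
  LinearMap.toContinuousLinearMap (∑ i, (k i : ℝ) • b.coord i)

theorem latticeForm_apply (k : Fin 2 → ℤ) (v : Plane) :
    latticeForm b k v = ∑ i, (k i : ℝ) * b.repr v i := by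
  simp [latticeForm]

theorem mem_lattice_iff (v : Plane) : v ∈ lattice b ↔ ∀ i, ∃ n : ℤ, (n : ℝ) = b.repr v i := by
  change v ∈ Submodule.span ℤ (Set.range b) ↔ _
  rw [Module.Basis.mem_span_iff_repr_mem]
  simp

/-- Lattice coordinates modulo one, as a homomorphism on the plane. -/
def planeToUnit : Plane →+ UnitAddTorus (Fin 2) where
  toFun v i := (b.repr v i : UnitAddCircle)
  map_zero' := by funext i; simp
  map_add' v w := by funext i; simp

theorem planeToUnit_eq_zero_iff (v : Plane) : planeToUnit b v = 0 ↔ v ∈ lattice b := by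
  rw [mem_lattice_iff, funext_iff]
  refine forall_congr' fun i => ?_
  change ((b.repr v i : ℝ) : UnitAddCircle) = 0 ↔ _
  rw [AddCircle.coe_eq_zero_iff]
  simp

/-- The isomorphism of the torus with the unit torus given by lattice coordinates. -/
def toUnit : Torus b ≃+ UnitAddTorus (Fin 2) :=
  AddEquiv.ofBijective
    (QuotientAddGroup.lift (lattice b) (planeToUnit b)
      fun v hv => (planeToUnit_eq_zero_iff b v).2 hv) <| by
    constructor
    · rw [injective_iff_map_eq_zero]
      intro q hq
      obtain ⟨v, rfl⟩ := QuotientAddGroup.mk_surjective q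
      exact (QuotientAddGroup.eq_zero_iff v).2 ((planeToUnit_eq_zero_iff b v).1 hq)
    · intro x
      have : ∀ i, ∃ t : ℝ, (t : UnitAddCircle) = x i := fun i => QuotientAddGroup.mk_surjective (x i)
      choose t ht using this
      refine ⟨QuotientAddGroup.mk (b.equivFun.symm t), ?_⟩
      funext i
      change ((b.repr (b.equivFun.symm t) i : ℝ) : UnitAddCircle) = x i
      rw [← ht i, ← Module.Basis.equivFun_apply, LinearEquiv.apply_symm_apply]

theorem toUnit_mk (v : Plane) : toUnit b (QuotientAddGroup.mk v) = planeToUnit b v := rfl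

theorem continuous_toUnit : Continuous (toUnit b) := by
  have h : Continuous (planeToUnit b) := by
    refine continuous_pi fun i => ?_
    have h1 : Continuous fun v : Plane => b.repr v i :=
      (LinearMap.toContinuousLinearMap (b.coord i)).continuous
    exact (AddCircle.continuous_mk' 1).comp h1
  exact h.quotient_lift _

/-- The isomorphism with the unit torus as a homeomorphism. -/
def unitHomeo : Torus b ≃ₜ UnitAddTorus (Fin 2) :=
  Continuous.homeoOfEquivCompactToT2 (f := (toUnit b).toEquiv) (continuous_toUnit b)

/-- The normalised Haar measure on the unit torus. -/
abbrev unitMeasure : Measure (UnitAddTorus (Fin 2)) :=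
  Measure.pi fun _ => (AddCircle.haarAddCircle : Measure UnitAddCircle)

/-- Uniqueness of Haar measure; the factor is the total mass because `unitMeasure` is a probability
measure. -/
theorem map_toUnit : (torusMeasure b).map (toUnit b) =
    (torusMeasure b univ) • unitMeasure := by
  have h1 : ((torusMeasure b).map (toUnit b)).IsAddHaarMeasure :=
    (toUnit b).isAddHaarMeasure_map _ (continuous_toUnit b) (unitHomeo b).symm.continuous
  obtain ⟨c, hc⟩ : ∃ c : NNReal, (torusMeasure b).map (toUnit b) = c • unitMeasure :=
    ⟨_, Measure.isAddLeftInvariant_eq_smul ((torusMeasure b).map (toUnit b)) unitMeasure⟩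
  have h3 : torusMeasure b univ = c := by
    have h4 : (torusMeasure b).map (toUnit b) univ = (c • unitMeasure) univ := by rw [hc]
    rw [Measure.map_apply (continuous_toUnit b).measurable MeasurableSet.univ, preimage_univ,
      Measure.smul_apply, measure_univ (μ := unitMeasure)] at h4
    rw [h4, ENNReal.smul_def, smul_eq_mul, mul_one]
  rw [hc, h3]
  rfl

theorem integral_torus_eq {E : Type*} [NormedAddCommGroup E] [NormedSpace ℝ E]
    (f : Torus b → E) :
    ∫ x, f ((toUnit b).symm x) ∂unitMeasure = (area b)⁻¹ • ∫ q, f q ∂(torusMeasure b) := by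
  have h1 : ∫ x, f ((toUnit b).symm x) ∂((torusMeasure b).map (toUnit b)) =
      ∫ q, f q ∂(torusMeasure b) := by
    have := (unitHomeo b).measurableEmbedding.integral_map (μ := torusMeasure b)
      (fun x => f ((toUnit b).symm x))
    refine this.trans (integral_congr_ae (Eventually.of_forall fun q => ?_))
    exact congrArg f ((toUnit b).symm_apply_apply q)
  rw [← h1, map_toUnit, integral_smul_measure, smul_smul]
  change _ = ((area b)⁻¹ * area b) • _
  rw [inv_mul_cancel₀ (area_pos b).ne', one_smul]

/-- The real characters of the torus. -/
def cosT (k : Fin 2 → ℤ) (q : Torus b) : ℝ := (UnitAddTorus.mFourier k (toUnit b q)).re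

/-- The imaginary parts of the characters of the torus. -/
def sinT (k : Fin 2 → ℤ) (q : Torus b) : ℝ := (UnitAddTorus.mFourier k (toUnit b q)).im

theorem continuous_cosT (k : Fin 2 → ℤ) : Continuous (cosT b k) :=
  Complex.continuous_re.comp ((UnitAddTorus.mFourier k).continuous.comp (continuous_toUnit b))

theorem continuous_sinT (k : Fin 2 → ℤ) : Continuous (sinT b k) :=
  Complex.continuous_im.comp ((UnitAddTorus.mFourier k).continuous.comp (continuous_toUnit b))

theorem mFourier_toUnit (k : Fin 2 → ℤ) (v : Plane) :
    UnitAddTorus.mFourier k (toUnit b (QuotientAddGroup.mk v)) =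
      Complex.exp ((2 * Real.pi * latticeForm b k v : ℝ) * Complex.I) := by
  rw [toUnit_mk, latticeForm_apply]
  simp only [UnitAddTorus.mFourier, ContinuousMap.coe_mk, planeToUnit, AddMonoidHom.coe_mk,
    ZeroHom.coe_mk, fourier_coe_apply, ← Complex.exp_sum]
  congr 1
  push_cast
  rw [Finset.mul_sum, Finset.sum_mul]
  refine Finset.sum_congr rfl fun i _ => ?_
  ring

theorem cosT_mk (k : Fin 2 → ℤ) (v : Plane) :
    cosT b k (QuotientAddGroup.mk v) = Real.cos (2 * Real.pi * latticeForm b k v) := by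
  rw [cosT, mFourier_toUnit, Complex.exp_ofReal_mul_I_re]

theorem sinT_mk (k : Fin 2 → ℤ) (v : Plane) :
    sinT b k (QuotientAddGroup.mk v) = Real.sin (2 * Real.pi * latticeForm b k v) := by
  rw [sinT, mFourier_toUnit, Complex.exp_ofReal_mul_I_im]

theorem abs_cosT_le (k : Fin 2 → ℤ) (q : Torus b) : |cosT b k q| ≤ 1 := by
  obtain ⟨v, rfl⟩ := QuotientAddGroup.mk_surjective q
  rw [cosT_mk]; exact Real.abs_cos_le_one _

theorem abs_sinT_le (k : Fin 2 → ℤ) (q : Torus b) : |sinT b k q| ≤ 1 := by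
  obtain ⟨v, rfl⟩ := QuotientAddGroup.mk_surjective q
  rw [sinT_mk]; exact Real.abs_sin_le_one _

theorem cosT_zero (q : Torus b) : cosT b 0 q = 1 := by
  simp [cosT, UnitAddTorus.mFourier_zero]

theorem cosT_at_zero (k : Fin 2 → ℤ) : cosT b k 0 = 1 := by
  have := cosT_mk b k 0
  simpa using this

variable {b}

theorem integrable_torus {f : Torus b → ℝ} (hf : Continuous f) :
    Integrable f (torusMeasure b) :=
  hf.integrable_of_hasCompactSupport (HasCompactSupport.of_compactSpace f)

/-- The k-th coefficient pairs g with the character of -k, the conjugate of that of k, whence the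
minus sign before the sine integral. -/
theorem mFourierCoeff_torus {g : Torus b → ℝ} (hg : Continuous g) (k : Fin 2 → ℤ) :
    UnitAddTorus.mFourierCoeff (fun x => (g ((toUnit b).symm x) : ℂ)) k =
      (((area b)⁻¹ * ∫ q, cosT b k q * g q ∂(torusMeasure b) : ℝ) : ℂ) -
      (((area b)⁻¹ * ∫ q, sinT b k q * g q ∂(torusMeasure b) : ℝ) : ℂ) * Complex.I := by
  have h0 : UnitAddTorus.mFourierCoeff (fun x => (g ((toUnit b).symm x) : ℂ)) k =
      ∫ x, (fun q : Torus b => UnitAddTorus.mFourier (-k) (toUnit b q) * (g q : ℂ))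
        ((toUnit b).symm x) ∂unitMeasure := by
    simp only [AddEquiv.apply_symm_apply]
    rfl
  have h1 : ∀ q : Torus b, UnitAddTorus.mFourier (-k) (toUnit b q) * (g q : ℂ) =
      ((cosT b k q * g q : ℝ) : ℂ) - ((sinT b k q * g q : ℝ) : ℂ) * Complex.I := by
    intro q
    rw [UnitAddTorus.mFourier_neg]
    apply Complex.ext <;> simp [cosT, sinT]
  have i1 : Integrable (fun q => cosT b k q * g q) (torusMeasure b) :=
    integrable_torus ((continuous_cosT b k).mul hg)
  have i2 : Integrable (fun q => sinT b k q * g q) (torusMeasure b) :=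
    integrable_torus ((continuous_sinT b k).mul hg)
  rw [h0]
  refine (integral_torus_eq b (fun q : Torus b =>
    UnitAddTorus.mFourier (-k) (toUnit b q) * (g q : ℂ))).trans ?_
  simp only [h1]
  rw [integral_sub i1.ofReal (i2.ofReal.mul_const _), integral_mul_const, integral_complex_ofReal,
    integral_complex_ofReal]
  push_cast
  simp only [Complex.real_smul]
  push_cast
  ring

theorem summable_mFourierCoeff {g : Torus b → ℝ} (hg : Continuous g)
    (hc : Summable fun k => ∫ q, cosT b k q * g q ∂(torusMeasure b))
    (hs : Summable fun k => ∫ q, sinT b k q * g q ∂(torusMeasure b)) :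
    Summable (UnitAddTorus.mFourierCoeff fun x => (g ((toUnit b).symm x) : ℂ)) := by
  have : UnitAddTorus.mFourierCoeff (fun x => (g ((toUnit b).symm x) : ℂ)) = _ :=
    funext (mFourierCoeff_torus hg)
  rw [this]
  exact (Complex.ofRealCLM.summable (hc.mul_left _)).sub
    ((Complex.ofRealCLM.summable (hs.mul_left _)).mul_right _)

theorem hasSum_fourier {g : Torus b → ℝ} (hg : Continuous g)
    (hc : Summable fun k => ∫ q, cosT b k q * g q ∂(torusMeasure b))
    (hs : Summable fun k => ∫ q, sinT b k q * g q ∂(torusMeasure b)) (q : Torus b) :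
    HasSum (fun k => UnitAddTorus.mFourierCoeff (fun x => (g ((toUnit b).symm x) : ℂ)) k *
      UnitAddTorus.mFourier k (toUnit b q)) (g q : ℂ) := by
  have hcont : Continuous fun x => (g ((toUnit b).symm x) : ℂ) :=
    Complex.continuous_ofReal.comp (hg.comp (unitHomeo b).symm.continuous)
  have := UnitAddTorus.hasSum_mFourier_series_apply_of_summable
    (f := ⟨_, hcont⟩) (summable_mFourierCoeff hg hc hs) (toUnit b q)
  simpa using this

/-- Fourier inversion at the origin of the torus. -/
theorem hasSum_fourier_zero {g : Torus b → ℝ} (hg : Continuous g)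
    (hc : Summable fun k => ∫ q, cosT b k q * g q ∂(torusMeasure b))
    (hs : Summable fun k => ∫ q, sinT b k q * g q ∂(torusMeasure b)) :
    HasSum (fun k => (area b)⁻¹ * ∫ q, cosT b k q * g q ∂(torusMeasure b)) (g 0) := by
  have h := Complex.hasSum_re (hasSum_fourier hg hc hs 0)
  convert! h using 2 with k
  have h1 : UnitAddTorus.mFourier k (toUnit b 0) = 1 := by
    simp [UnitAddTorus.mFourier]
  rw [h1, mFourierCoeff_torus hg, mul_one, Complex.sub_re, Complex.ofReal_re, Complex.mul_re]
  simp

/-- Vanishing coefficients are summable, so the Fourier series converges pointwise to g, and it is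
the zero series. -/
theorem eq_zero_of_fourier_eq_zero {g : Torus b → ℝ} (hg : Continuous g)
    (hc : ∀ k, ∫ q, cosT b k q * g q ∂(torusMeasure b) = 0)
    (hs : ∀ k, ∫ q, sinT b k q * g q ∂(torusMeasure b) = 0) (q : Torus b) : g q = 0 := by
  have h := hasSum_fourier hg (by simp [hc]) (by simp [hs]) q
  simp only [mFourierCoeff_torus hg, hc, hs] at h
  have h2 : HasSum (fun _ : Fin 2 → ℤ => (0:ℂ)) (g q : ℂ) := by simpa using h
  exact_mod_cast h2.unique hasSum_zero

end FlatCylinder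

end

/-! ### Eigenfunctions and the first eigenvalue of the torus. -/

noncomputable section

namespace FlatCylinder

variable {b : Module.Basis (Fin 2) ℝ Plane}

/-- Second partial derivatives on the torus. -/
def ddT (i : Fin 2) (h : Torus b → ℝ) (q : Torus b) : ℝ := dd i (inTorusCoords b h q) 0

/-- A function on the torus, read on the universal covering plane. -/
abbrev liftT (h : Torus b → ℝ) : Plane → ℝ := fun v => h (QuotientAddGroup.mk v)

theorem inTorusCoords_mk (h : Torus b → ℝ) (v : Plane) :
    inTorusCoords b h (QuotientAddGroup.mk v) = fun w => liftT h (v + w) := rfl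

theorem ddT_mk (i : Fin 2) (h : Torus b → ℝ) (v : Plane) :
    ddT i h (QuotientAddGroup.mk v) = dd i (liftT h) v := by
  rw [ddT, inTorusCoords_mk, dd_comp_add_left, add_zero]

theorem torus_smooth_iff {h : Torus b → ℝ} :
    (∀ q, ContDiffAt ℝ ∞ (inTorusCoords b h q) 0) ↔ ContDiff ℝ ∞ (liftT h) := by
  rw [contDiff_iff_contDiffAt]
  constructor
  · intro H v
    have h1 := H (QuotientAddGroup.mk v)
    rw [inTorusCoords_mk] at h1
    have h2 : ContDiffAt ℝ ∞ (fun w : Plane => w - v) v := by fun_prop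
    have h4 : ContDiffAt ℝ ∞ (fun w => liftT h (v + w)) ((fun w : Plane => w - v) v) := by
      simpa only [sub_self] using h1
    simpa [Function.comp_def] using
      ContDiffAt.comp (g := fun w => liftT h (v + w)) (f := fun w : Plane => w - v) v h4 h2
  · intro H q
    obtain ⟨v, rfl⟩ := QuotientAddGroup.mk_surjective q
    rw [inTorusCoords_mk]
    have h2 : ContDiffAt ℝ ∞ (fun w : Plane => v + w) 0 := by fun_prop
    have h3 : ContDiffAt ℝ ∞ (liftT h) (v + 0) := H _
    exact h3.comp 0 h2

theorem continuous_torus_iff {Y : Type*} [TopologicalSpace Y] {h : Torus b → Y} :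
    Continuous h ↔ Continuous fun v : Plane => h (QuotientAddGroup.mk v) :=
  QuotientAddGroup.isOpenQuotientMap_mk.isQuotientMap.continuous_iff

/-- Translations of the torus along a coordinate axis of the plane. -/
def axisT (b : Module.Basis (Fin 2) ℝ Plane) (i : Fin 2) : ℝ →+ Torus b :=
  (QuotientAddGroup.mk' (lattice b)).comp (axis i)

theorem continuous_axisT (i : Fin 2) : Continuous (axisT b i : ℝ → Torus b) :=
  QuotientAddGroup.continuous_mk.comp (continuous_axis i)

theorem mk_add_axisT (v : Plane) (i : Fin 2) (t : ℝ) :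
    (QuotientAddGroup.mk v : Torus b) + axisT b i t =
      QuotientAddGroup.mk (v + t • EuclideanSpace.single i 1) := rfl

/-- First partial derivatives on the torus. -/
def d1T (i : Fin 2) (h : Torus b → ℝ) (q : Torus b) : ℝ :=
  fderiv ℝ (inTorusCoords b h q) 0 (EuclideanSpace.single i 1)

theorem d1T_mk (i : Fin 2) (h : Torus b → ℝ) (v : Plane) :
    d1T i h (QuotientAddGroup.mk v) = fderiv ℝ (liftT h) v (EuclideanSpace.single i 1) := by
  rw [d1T, inTorusCoords_mk, fderiv_comp_add_left, add_zero]

section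

variable {h : Torus b → ℝ} (hh : ContDiff ℝ ∞ (liftT h)) (i : Fin 2)
include hh

theorem hasDerivAt_torus (q : Torus b) :
    HasDerivAt (fun t => h (q + axisT b i t)) (d1T i h q) 0 := by
  obtain ⟨v, rfl⟩ := QuotientAddGroup.mk_surjective q
  rw [d1T_mk]
  exact hasDerivAt_line (hh.differentiable (by simp) v) _

theorem hasDerivAt_torus_two (q : Torus b) :
    HasDerivAt (fun t => d1T i h (q + axisT b i t)) (ddT i h q) 0 := by
  obtain ⟨v, rfl⟩ := QuotientAddGroup.mk_surjective q
  simp only [mk_add_axisT, d1T_mk, ddT_mk]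
  exact hasDerivAt_line_two (hh.contDiffAt.of_le (by norm_cast)) i

theorem continuous_d1T : Continuous (d1T i h) := by
  rw [continuous_torus_iff]
  simp only [d1T_mk]
  exact continuous_fderiv_single hh _

theorem continuous_ddT : Continuous (ddT i h) := by
  rw [continuous_torus_iff]
  simp only [ddT_mk]
  exact (contDiff_dd hh i).continuous

end

theorem integral_torus_mul_ddT {e h : Torus b → ℝ} (he : ContDiff ℝ ∞ (liftT e))
    (hh : ContDiff ℝ ∞ (liftT h)) (i : Fin 2) :
    ∫ q, e q * ddT i h q ∂(torusMeasure b) = ∫ q, ddT i e q * h q ∂(torusMeasure b) :=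
  integral_mul_lineDeriv_two _ (axisT b i) (continuous_axisT i)
    (continuous_torus_iff.2 he.continuous) (continuous_d1T he i) (continuous_ddT he i)
    (continuous_torus_iff.2 hh.continuous) (continuous_d1T hh i) (continuous_ddT hh i)
    (HasCompactSupport.of_compactSpace h)
    (hasDerivAt_torus he i) (hasDerivAt_torus_two he i) (hasDerivAt_torus hh i)
    (hasDerivAt_torus_two hh i)

/-- Smooth joint eigenfunctions of the second partial derivatives of the torus. -/
def IsMode (e : Torus b → ℝ) (c : Fin 2 → ℝ) : Prop :=
  ContDiff ℝ ∞ (liftT e) ∧ ∀ i q, ddT i e q = -(c i) * e q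

variable (b)

/-- The eigenvalues of the second derivatives on the characters. -/
def freq (k : Fin 2 → ℤ) (i : Fin 2) : ℝ :=
  (2 * Real.pi * latticeForm b k (EuclideanSpace.single i 1)) ^ 2

/-- The eigenvalue of the Laplacian on a character. -/
def lam (k : Fin 2 → ℤ) : ℝ := ∑ i, freq b k i

theorem isMode_cosT (k : Fin 2 → ℤ) : IsMode (cosT b k) (freq b k) := by
  have h0 : liftT (cosT b k) = fun v => Real.cos (2 * Real.pi * latticeForm b k v) :=
    funext (cosT_mk b k)
  have h1 : ContDiff ℝ ∞ (liftT (cosT b k)) := by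
    rw [h0]; fun_prop
  refine ⟨h1, fun i q => ?_⟩
  obtain ⟨v, rfl⟩ := QuotientAddGroup.mk_surjective q
  rw [ddT_mk]
  have hl : ∀ w : Plane, HasDerivAt (fun t : ℝ => 2 * Real.pi * latticeForm b k
      (w + t • EuclideanSpace.single i 1))
      (2 * Real.pi * latticeForm b k (EuclideanSpace.single i 1)) 0 := by
    intro w
    simp only [map_add, map_smul, smul_eq_mul]
    simpa using (((hasDerivAt_id (0:ℝ)).mul_const (latticeForm b k
      (EuclideanSpace.single i 1))).const_add (latticeForm b k w)).const_mul (2 * Real.pi)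
  refine dd_eq_of_hasDerivAt (f₁ := fun v => -Real.sin (2 * Real.pi * latticeForm b k v) *
    (2 * Real.pi * latticeForm b k (EuclideanSpace.single i 1)))
    (h1.contDiffAt.of_le (by norm_cast)) (Eventually.of_forall fun w => ?_) ?_
  · rw [h0]
    simpa using (hl w).cos
  · convert! ((hl v).sin.neg.mul_const
      (2 * Real.pi * latticeForm b k (EuclideanSpace.single i 1))) using 1
    rw [cosT_mk, freq]
    simp
    ring

theorem isMode_sinT (k : Fin 2 → ℤ) : IsMode (sinT b k) (freq b k) := by
  have h0 : liftT (sinT b k) = fun v => Real.sin (2 * Real.pi * latticeForm b k v) :=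
    funext (sinT_mk b k)
  have h1 : ContDiff ℝ ∞ (liftT (sinT b k)) := by
    rw [h0]; fun_prop
  refine ⟨h1, fun i q => ?_⟩
  obtain ⟨v, rfl⟩ := QuotientAddGroup.mk_surjective q
  rw [ddT_mk]
  have hl : ∀ w : Plane, HasDerivAt (fun t : ℝ => 2 * Real.pi * latticeForm b k
      (w + t • EuclideanSpace.single i 1))
      (2 * Real.pi * latticeForm b k (EuclideanSpace.single i 1)) 0 := by
    intro w
    simp only [map_add, map_smul, smul_eq_mul]
    simpa using (((hasDerivAt_id (0:ℝ)).mul_const (latticeForm b k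
      (EuclideanSpace.single i 1))).const_add (latticeForm b k w)).const_mul (2 * Real.pi)
  refine dd_eq_of_hasDerivAt (f₁ := fun v => Real.cos (2 * Real.pi * latticeForm b k v) *
    (2 * Real.pi * latticeForm b k (EuclideanSpace.single i 1)))
    (h1.contDiffAt.of_le (by norm_cast)) (Eventually.of_forall fun w => ?_) ?_
  · rw [h0]
    simpa using (hl w).sin
  · convert! ((hl v).cos.mul_const
      (2 * Real.pi * latticeForm b k (EuclideanSpace.single i 1))) using 1
    rw [sinT_mk, freq]
    simp
    ring

theorem freq_nonneg (k : Fin 2 → ℤ) (i : Fin 2) : 0 ≤ freq b k i := sq_nonneg _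

theorem lam_nonneg (k : Fin 2 → ℤ) : 0 ≤ lam b k := Finset.sum_nonneg fun i _ => freq_nonneg b k i

theorem latticeForm_basis (k : Fin 2 → ℤ) (j : Fin 2) : latticeForm b k (b j) = k j := by
  rw [latticeForm_apply]
  simp [Finsupp.single_apply]

theorem lam_zero : lam b 0 = 0 := by
  simp [lam, freq, latticeForm_apply]

/-- The integer k j is the value of the linear form at the basis vector b j, so Cauchy–Schwarz
bounds its square by ‖b j‖² times the squared norm of the form, which is lam / (4π²). Quadratic
growth gives both the existence of a smallest eigenvalue and the summability of the kernel. -/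
theorem exists_lam_ge : ∃ c : ℝ, 0 < c ∧ ∀ k, c * ‖k‖ ^ 2 ≤ lam b k := by
  set B : ℝ := 1 + ‖b 0‖ ^ 2 + ‖b 1‖ ^ 2 with hB
  have hBpos : 0 < B := by positivity
  refine ⟨4 * Real.pi ^ 2 / B, by positivity, fun k => ?_⟩
  have hj : ∀ j, (k j : ℝ) ^ 2 * (4 * Real.pi ^ 2) ≤ B * lam b k := by
    intro j
    have h1 : (k j : ℝ) = ∑ i, b j i * latticeForm b k (EuclideanSpace.single i 1) := by
      rw [← latticeForm_basis b k j]
      conv_lhs => rw [← (EuclideanSpace.basisFun (Fin 2) ℝ).sum_repr (b j)]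
      simp
    have h2 : (k j : ℝ) ^ 2 ≤ (∑ i, b j i ^ 2) *
        ∑ i, latticeForm b k (EuclideanSpace.single i 1) ^ 2 := by
      rw [h1]; exact Finset.sum_mul_sq_le_sq_mul_sq _ _ _
    have h3 : ∑ i, b j i ^ 2 ≤ B := by
      have h4 : ∑ i, b j i ^ 2 = ‖b j‖ ^ 2 := by
        rw [EuclideanSpace.real_norm_sq_eq]
      rw [h4, hB]
      fin_cases j <;> simp <;> nlinarith [sq_nonneg ‖b 0‖, sq_nonneg ‖b 1‖]
    have h5 : lam b k = 4 * Real.pi ^ 2 *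
        ∑ i, latticeForm b k (EuclideanSpace.single i 1) ^ 2 := by
      simp only [lam, freq, Finset.mul_sum]
      exact Finset.sum_congr rfl fun i _ => by ring
    rw [h5]
    have h6 : (k j : ℝ) ^ 2 ≤ B * ∑ i, latticeForm b k (EuclideanSpace.single i 1) ^ 2 :=
      h2.trans (mul_le_mul_of_nonneg_right h3 (Finset.sum_nonneg fun i _ => sq_nonneg _))
    nlinarith [Real.pi_pos, sq_nonneg Real.pi]
  obtain ⟨j, hjn⟩ : ∃ j, ‖k‖ = |(k j : ℝ)| := by
    rcases le_total ‖k 0‖ ‖k 1‖ with h | h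
    · refine ⟨1, le_antisymm ((pi_norm_le_iff_of_nonneg (abs_nonneg _)).2 fun i => ?_)
        (norm_le_pi_norm k 1)⟩
      fin_cases i
      · exact h
      · exact le_rfl
    · refine ⟨0, le_antisymm ((pi_norm_le_iff_of_nonneg (abs_nonneg _)).2 fun i => ?_)
        (norm_le_pi_norm k 0)⟩
      fin_cases i
      · exact le_rfl
      · exact h
  rw [hjn, sq_abs, div_mul_eq_mul_div, div_le_iff₀ hBpos]
  linarith [hj j]

theorem one_le_norm_of_ne_zero {k : Fin 2 → ℤ} (hk : k ≠ 0) : 1 ≤ ‖k‖ := by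
  obtain ⟨i, hi⟩ := Function.ne_iff.1 hk
  refine le_trans ?_ (norm_le_pi_norm k i)
  rw [Int.norm_eq_abs]
  exact_mod_cast Int.one_le_abs hi

theorem lam_pos {k : Fin 2 → ℤ} (hk : k ≠ 0) : 0 < lam b k := by
  obtain ⟨c, hc, h⟩ := exists_lam_ge b
  have := one_le_norm_of_ne_zero hk
  exact lt_of_lt_of_le (by positivity) (h k)

/-- By quadratic growth only finitely many frequencies lie below the level of the reference
frequency u, so the minimum is over a finite nonempty set. -/
theorem exists_min_lam : ∃ k₁ : Fin 2 → ℤ, k₁ ≠ 0 ∧ ∀ k ≠ 0, lam b k₁ ≤ lam b k := by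
  obtain ⟨c, hc, h⟩ := exists_lam_ge b
  set u : Fin 2 → ℤ := fun _ => 1
  have hu : u ≠ 0 := fun h => one_ne_zero (congrFun h 0)
  have hfin : {k : Fin 2 → ℤ | k ≠ 0 ∧ lam b k ≤ lam b u}.Finite := by
    have hb : (Metric.closedBall (0 : Fin 2 → ℤ) √(lam b u / c)).Finite :=
      (isCompact_closedBall _ _).finite_of_discrete
    refine hb.subset fun k hk => ?_
    rw [mem_closedBall_zero_iff]
    apply Real.le_sqrt_of_sq_le
    rw [le_div_iff₀ hc]
    linarith [h k, hk.2]
  obtain ⟨k₁, hk₁, hmin⟩ := Set.exists_min_image _ (lam b) hfin ⟨u, hu, le_rfl⟩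
  refine ⟨k₁, hk₁.1, fun k hk => ?_⟩
  rcases le_total (lam b k) (lam b u) with hle | hle
  · exact hmin k ⟨hk, hle⟩
  · exact hk₁.2.trans hle

/-- The smallest positive eigenvalue of the torus. -/
def lamOne : ℝ := lam b (exists_min_lam b).choose

theorem lamOne_pos : 0 < lamOne b := lam_pos b (exists_min_lam b).choose_spec.1

theorem lamOne_le {k : Fin 2 → ℤ} (hk : k ≠ 0) : lamOne b ≤ lam b k :=
  (exists_min_lam b).choose_spec.2 k hk

variable {b}

theorem laplacian_torus_eq (h : Torus b → ℝ) (q : Torus b) :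
    Laplacian.laplacian (inTorusCoords b h q) 0 = ∑ i, ddT i h q := laplacian_eq_sum_dd _ _

/-- Symmetry of the Laplacian: both μ and the sum of the c i come out of the same integral, so it
vanishes when they differ. -/
theorem isMode_orthogonal {e h : Torus b → ℝ} {c : Fin 2 → ℝ} (he : IsMode e c)
    (hh : ContDiff ℝ ∞ (liftT h)) {μ : ℝ} (hμ : ∀ q, -∑ i, ddT i h q = μ * h q)
    (hne : μ ≠ ∑ i, c i) : ∫ q, e q * h q ∂(torusMeasure b) = 0 := by
  have hec : Continuous e := continuous_torus_iff.2 he.1.continuous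
  have hhc : Continuous h := continuous_torus_iff.2 hh.continuous
  have h1 : ∀ i, ∫ q, e q * ddT i h q ∂(torusMeasure b) =
      -(c i) * ∫ q, e q * h q ∂(torusMeasure b) := by
    intro i
    rw [integral_torus_mul_ddT he.1 hh, ← integral_const_mul]
    refine integral_congr_ae (Eventually.of_forall fun q => ?_)
    simp only [he.2]; ring
  have h2 : ∫ q, μ * (e q * h q) ∂(torusMeasure b) =
      -∑ i, ∫ q, e q * ddT i h q ∂(torusMeasure b) := by
    rw [← integral_finsetSum (f := fun i q => e q * ddT i h q) _
      fun i _ => integrable_torus (hec.mul (continuous_ddT hh i)), ← integral_neg]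
    refine integral_congr_ae (Eventually.of_forall fun q => ?_)
    simp only
    rw [← Finset.mul_sum, ← mul_neg, hμ]
    ring
  rw [integral_const_mul] at h2
  simp only [h1, ← Finset.sum_mul, Finset.sum_neg_distrib] at h2
  have h3 : (μ - ∑ i, c i) * ∫ q, e q * h q ∂(torusMeasure b) = 0 := by linarith
  exact (mul_eq_zero.1 h3).resolve_left (sub_ne_zero.2 hne)

/-- An eigenfunction with 0 < μ < `lamOne b` would be orthogonal to the constant mode because μ ≠ 0,
and to every other character by minimality; then all its Fourier coefficients vanish. -/
theorem isFirstEigenvalue_lamOne : IsFirstEigenvalue b (lamOne b) := by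
  refine ⟨⟨lamOne_pos b, cosT b (exists_min_lam b).choose, ?_, ?_, ?_⟩, ?_⟩
  · intro h
    simpa [cosT_at_zero] using congrFun h 0
  · exact torus_smooth_iff.2 (isMode_cosT b _).1
  · intro q
    rw [laplacian_torus_eq]
    simp only [(isMode_cosT b _).2, ← Finset.sum_mul, Finset.sum_neg_distrib]
    rw [lamOne, lam]; ring
  · rintro μ ⟨hμ, h, hne, hs, heq⟩
    have hs' := torus_smooth_iff.1 hs
    by_contra! hlt
    apply hne
    funext q
    have hk : ∀ k, μ ≠ ∑ i, freq b k i := by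
      intro k hk
      by_cases h0 : k = 0
      · subst h0
        exact hμ.ne' (hk.trans (lam_zero b))
      · exact absurd (lamOne_le b h0) (not_le.2 (lt_of_eq_of_lt (show lam b k = μ from hk.symm) hlt))
    simp only [laplacian_torus_eq] at heq
    exact eq_zero_of_fourier_eq_zero (continuous_torus_iff.2 hs'.continuous)
      (fun k => isMode_orthogonal (isMode_cosT b k) hs' heq (hk k))
      (fun k => isMode_orthogonal (isMode_sinT b k) hs' heq (hk k)) q

end FlatCylinder

end

/-! ### Ordinary differential equations in the height variable. -/

noncomputable section

namespace FlatCylinder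

/-- The function `exp (-μ |z|)` is a fundamental solution of `μ² - d²/dz²` up to the factor `2μ`. -/
theorem integral_exp_mul_helmholtz {c c₁ c₂ : ℝ → ℝ} (hc : ∀ z, HasDerivAt c (c₁ z) z)
    (hc₁ : ∀ z, HasDerivAt c₁ (c₂ z) z) (hc₂ : Continuous c₂) (sc : HasCompactSupport c) (μ : ℝ) :
    ∫ z, Real.exp (-μ * |z|) * (μ ^ 2 * c z - c₂ z) = 2 * μ * c 0 := by
  have cc : Continuous c := continuous_iff_continuousAt.2 fun z => (hc z).continuousAt
  have cc₁ : Continuous c₁ := continuous_iff_continuousAt.2 fun z => (hc₁ z).continuousAt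
  have e1 : deriv c = c₁ := funext fun z => (hc z).deriv
  have e2 : deriv c₁ = c₂ := funext fun z => (hc₁ z).deriv
  have sc₁ : HasCompactSupport c₁ := e1 ▸ sc.deriv
  have sc₂ : HasCompactSupport c₂ := e2 ▸ sc₁.deriv
  have hint : Integrable fun z => Real.exp (-μ * |z|) * (μ ^ 2 * c z - c₂ z) :=
    (by fun_prop : Continuous fun z => Real.exp (-μ * |z|) * (μ ^ 2 * c z - c₂ z)
      ).integrable_of_hasCompactSupport ((sc.mul_left.sub sc₂).mul_left)
  -- For z > 0 the integrand is the derivative of -exp(-μz)(μc + c₁). The slope c₁ 0 in the boundary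
  -- term cancels against the left half-line.
  have hright : ∫ z in Ioi (0:ℝ), Real.exp (-μ * |z|) * (μ ^ 2 * c z - c₂ z) =
      μ * c 0 + c₁ 0 := by
    have h := integral_Ioi_of_hasDerivAt_of_tendsto (a := 0)
      (f := fun z => -(Real.exp (-μ * z) * (μ * c z + c₁ z)))
      (f' := fun z => Real.exp (-μ * z) * (μ ^ 2 * c z - c₂ z)) (m := 0)
      (by fun_prop)
      (fun z _ => by
        have h1 : HasDerivAt (fun z => Real.exp (-μ * z)) (Real.exp (-μ * z) * -μ) z := by
          simpa using ((hasDerivAt_id z).const_mul (-μ)).exp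
        convert! (h1.mul (((hc z).const_mul μ).add (hc₁ z))).neg using 1
        simp only [Pi.add_apply]
        ring)
      (hint.integrableOn.congr_fun (fun z hz => by
        simp only [abs_of_pos (mem_Ioi.1 hz)]) measurableSet_Ioi)
      (by
        have : HasCompactSupport fun z => -(Real.exp (-μ * z) * (μ * c z + c₁ z)) :=
          ((sc.mul_left.add sc₁).mul_left).neg
        exact (this.is_zero_at_infty.mono_left atTop_le_cocompact))
    rw [setIntegral_congr_fun (g := fun z => Real.exp (-μ * z) * (μ ^ 2 * c z - c₂ z))
      measurableSet_Ioi fun z hz => by simp only [abs_of_pos (mem_Ioi.1 hz)], h]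
    simp
  have hleft : ∫ z in Iic (0:ℝ), Real.exp (-μ * |z|) * (μ ^ 2 * c z - c₂ z) =
      μ * c 0 - c₁ 0 := by
    have h := integral_Iic_of_hasDerivAt_of_tendsto (a := 0)
      (f := fun z => Real.exp (μ * z) * (μ * c z - c₁ z))
      (f' := fun z => Real.exp (μ * z) * (μ ^ 2 * c z - c₂ z)) (m := 0)
      (by fun_prop)
      (fun z _ => by
        have h1 : HasDerivAt (fun z => Real.exp (μ * z)) (Real.exp (μ * z) * μ) z := by
          simpa using ((hasDerivAt_id z).const_mul μ).exp
        convert! (h1.mul (((hc z).const_mul μ).sub (hc₁ z))) using 1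
        simp only [Pi.sub_apply]
        ring)
      (hint.integrableOn.congr_fun (fun z hz => by
        simp only [abs_of_nonpos (mem_Iic.1 hz)]; ring_nf) measurableSet_Iic)
      (by
        have : HasCompactSupport fun z => Real.exp (μ * z) * (μ * c z - c₁ z) :=
          (sc.mul_left.sub sc₁).mul_left
        exact (this.is_zero_at_infty.mono_left atBot_le_cocompact))
    rw [setIntegral_congr_fun (g := fun z => Real.exp (μ * z) * (μ ^ 2 * c z - c₂ z))
      measurableSet_Iic fun z hz => by simp only [abs_of_nonpos (mem_Iic.1 hz)]; ring_nf, h]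
    simp
  rw [← integral_add_compl measurableSet_Iic hint, compl_Iic, hleft, hright]
  ring

/-- The function `|z| / 2` is a fundamental solution of `d²/dz²`. -/
theorem integral_abs_mul_second_deriv {c c₁ c₂ : ℝ → ℝ} (hc : ∀ z, HasDerivAt c (c₁ z) z)
    (hc₁ : ∀ z, HasDerivAt c₁ (c₂ z) z) (hc₂ : Continuous c₂) (sc : HasCompactSupport c) :
    ∫ z, |z| * c₂ z = 2 * c 0 := by
  have cc : Continuous c := continuous_iff_continuousAt.2 fun z => (hc z).continuousAt
  have cc₁ : Continuous c₁ := continuous_iff_continuousAt.2 fun z => (hc₁ z).continuousAt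
  have e1 : deriv c = c₁ := funext fun z => (hc z).deriv
  have e2 : deriv c₁ = c₂ := funext fun z => (hc₁ z).deriv
  have sc₁ : HasCompactSupport c₁ := e1 ▸ sc.deriv
  have sc₂ : HasCompactSupport c₂ := e2 ▸ sc₁.deriv
  have hint : Integrable fun z => |z| * c₂ z :=
    (by fun_prop : Continuous fun z => |z| * c₂ z).integrable_of_hasCompactSupport sc₂.mul_left
  -- For z > 0 the integrand has the primitive z c₁ - c, which is -c 0 at the origin and vanishes at
  -- infinity.
  have hright : ∫ z in Ioi (0:ℝ), |z| * c₂ z = c 0 := by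
    have h := integral_Ioi_of_hasDerivAt_of_tendsto (a := 0)
      (f := fun z => z * c₁ z - c z) (f' := fun z => z * c₂ z) (m := 0)
      (by fun_prop)
      (fun z _ => by
        convert! ((hasDerivAt_id z).mul (hc₁ z)).sub (hc z) using 1
        simp)
      (hint.integrableOn.congr_fun (fun z hz => by
        simp only [abs_of_pos (mem_Ioi.1 hz)]) measurableSet_Ioi)
      (by
        have : HasCompactSupport fun z => z * c₁ z - c z := sc₁.mul_left.sub sc
        exact (this.is_zero_at_infty.mono_left atTop_le_cocompact))
    rw [setIntegral_congr_fun (g := fun z => z * c₂ z)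
      measurableSet_Ioi fun z hz => by simp only [abs_of_pos (mem_Ioi.1 hz)], h]
    simp
  have hleft : ∫ z in Iic (0:ℝ), |z| * c₂ z = c 0 := by
    have h := integral_Iic_of_hasDerivAt_of_tendsto (a := 0)
      (f := fun z => -(z * c₁ z - c z)) (f' := fun z => -(z * c₂ z)) (m := 0)
      (by fun_prop)
      (fun z _ => by
        convert! (((hasDerivAt_id z).mul (hc₁ z)).sub (hc z)).neg using 1
        simp)
      (hint.integrableOn.congr_fun (fun z hz => by
        simp only [abs_of_nonpos (mem_Iic.1 hz)]; ring_nf) measurableSet_Iic)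
      (by
        have : HasCompactSupport fun z => -(z * c₁ z - c z) := (sc₁.mul_left.sub sc).neg
        exact (this.is_zero_at_infty.mono_left atBot_le_cocompact))
    rw [setIntegral_congr_fun (g := fun z => -(z * c₂ z))
      measurableSet_Iic fun z hz => by simp only [abs_of_nonpos (mem_Iic.1 hz)]; ring_nf, h]
    simp
  rw [← integral_add_compl measurableSet_Iic hint, compl_Iic, hleft, hright]
  ring

/-- A solution of `u'' = lam u` with `lam ≥ 0` obeys the maximum principle on an interval. -/
theorem sq_le_max_of_deriv_two {u u₁ : ℝ → ℝ} {lam l : ℝ} (hlam : 0 ≤ lam) 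
    (h1 : ∀ z ∈ Icc (-l) l, HasDerivAt u (u₁ z) z)
    (h2 : ∀ z ∈ Icc (-l) l, HasDerivAt u₁ (lam * u z) z) {z : ℝ} (hz : z ∈ Icc (-l) l) :
    u z ^ 2 ≤ max (u (-l) ^ 2) (u l ^ 2) := by
  have hd1 : ∀ z ∈ Icc (-l) l, HasDerivAt (fun z => u z ^ 2) (2 * (u z * u₁ z)) z := by
    intro z hz
    convert! (h1 z hz).pow 2 using 1
    simp; ring
  have hd2 : ∀ z ∈ Icc (-l) l, HasDerivAt (fun z => 2 * (u z * u₁ z))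
      (2 * (u₁ z ^ 2 + lam * u z ^ 2)) z := by
    intro z hz
    convert! ((h1 z hz).mul (h2 z hz)).const_mul 2 using 1
    ring
  -- The second derivative of u² is 2(u'² + lam u²) ≥ 0, so u² is convex and is bounded by its
  -- values at the endpoints.
  have hconv : ConvexOn ℝ (Icc (-l) l) fun z => u z ^ 2 := by
    refine convexOn_of_hasDerivWithinAt2_nonneg (f' := fun z => 2 * (u z * u₁ z))
      (f'' := fun z => 2 * (u₁ z ^ 2 + lam * u z ^ 2)) (convex_Icc _ _)
      (fun z hz => (hd1 z hz).continuousAt.continuousWithinAt)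
      (fun z hz => (hd1 z (interior_subset hz)).hasDerivWithinAt)
      (fun z hz => (hd2 z (interior_subset hz)).hasDerivWithinAt)
      (fun z _ => by positivity)
  have hll : -l ≤ l := hz.1.trans hz.2
  exact hconv.le_max_of_mem_Icc (left_mem_Icc.2 hll) (right_mem_Icc.2 hll) hz

end FlatCylinder

end

/-! ### Maximum principle for weak solutions of a'' = λa. -/

noncomputable section

namespace FlatCylinder

open scoped Convolution in
/-- The maximum principle for weak solutions of `a'' = lam a` that are continuous off the origin. -/
theorem sq_le_max_of_weak {a : ℝ → ℝ} {R lam : ℝ} (hlam : 0 ≤ lam)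
    (hint : ∀ l < R, IntegrableOn a (Icc (-l) l))
    (hcont : ContinuousOn a (Icc (-R) R \ {0}))
    (hweak : ∀ χ : ℝ → ℝ, ContDiff ℝ ∞ χ → HasCompactSupport χ → tsupport χ ⊆ Ioo (-R) R →
      ∫ z, a z * (lam * χ z - deriv (deriv χ) z) = 0)
    {z l : ℝ} (hz0 : z ≠ 0) (hzl : |z| < l) (hlR : l < R) :
    a z ^ 2 ≤ max (a (-l) ^ 2) (a l ^ 2) := by
  have hl0 : 0 < l := (abs_nonneg z).trans_lt hzl
  -- L leaves room for mollification: the bump radii (L - l)/(n + 2) are below L - l and tend to 0,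
  -- so on [-l, l] the mollified function sees only values of a on (-L, L).
  obtain ⟨L, hlL, hLR⟩ := exists_between hlR
  set g : ℝ → ℝ := (Icc (-L) L).indicator a with hg
  have gint : Integrable g := (integrable_indicator_iff measurableSet_Icc).2 (hint L hLR)
  have gloc : LocallyIntegrable g := gint.locallyIntegrable
  set φ : ℕ → ContDiffBump (0 : ℝ) := fun n =>
    ⟨(L - l) / (n + 3), (L - l) / (n + 2), by have := sub_pos.2 hlL; positivity, by
      have := sub_pos.2 hlL
      gcongr; norm_num⟩ with hφ
  have hrOut : ∀ n, (φ n).rOut = (L - l) / (n + 2) := fun n => rfl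
  have hrlt : ∀ n, (φ n).rOut < L - l := by
    intro n
    rw [hrOut]
    apply div_lt_self (sub_pos.2 hlL)
    have : (0:ℝ) ≤ n := n.cast_nonneg
    linarith
  have hrto : Tendsto (fun n => (φ n).rOut) atTop (𝓝 0) := by
    simp only [hrOut]
    exact tendsto_const_nhds.div_atTop (tendsto_atTop_add_const_right _ _ tendsto_natCast_atTop_atTop)
  set ρ : ℕ → ℝ → ℝ := fun n => (φ n).normed volume with hρ
  have ρs : ∀ n, ContDiff ℝ ∞ (ρ n) := fun n => (φ n).contDiff_normed
  have ρc : ∀ n, HasCompactSupport (ρ n) := fun n => (φ n).hasCompactSupport_normed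
  have ρ1s : ∀ n, ContDiff ℝ ∞ (deriv (ρ n)) := fun n => by
    have := (contDiff_infty_iff_deriv.1 (ρs n)).2
    exact this
  set u : ℕ → ℝ → ℝ := fun n => (ρ n ⋆[ContinuousLinearMap.lsmul ℝ ℝ, volume] g) with hu
  set u₁ : ℕ → ℝ → ℝ := fun n => (deriv (ρ n) ⋆[ContinuousLinearMap.lsmul ℝ ℝ, volume] g) with hu₁
  have d1 : ∀ n x, HasDerivAt (u n) (u₁ n x) x := fun n x =>
    (ρc n).hasDerivAt_convolution_left _ ((ρs n).of_le (by norm_cast)) gloc x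
  -- The weak equation is tested with s ↦ ρ n (x - s). Differentiating twice in s produces two minus
  -- signs which cancel, so the mollification solves the equation classically.
  have d2 : ∀ n, ∀ x ∈ Icc (-l) l, HasDerivAt (u₁ n) (lam * u n x) x := by
    intro n x hx
    have h := (ρc n).deriv.hasDerivAt_convolution_left (ContinuousLinearMap.lsmul ℝ ℝ)
      ((ρ1s n).of_le (by norm_cast)) gloc x
    convert! h using 1
    have hχs : ContDiff ℝ ∞ fun s => ρ n (x - s) := (ρs n).comp (by fun_prop)
    have hχd : deriv (fun s => ρ n (x - s)) = fun s => -deriv (ρ n) (x - s) := by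
      funext s; exact deriv_comp_const_sub (ρ n) x s
    have hχdd : deriv (deriv (fun s => ρ n (x - s))) = fun s => deriv (deriv (ρ n)) (x - s) := by
      rw [hχd]; funext s
      rw [deriv.fun_neg, deriv_comp_const_sub, neg_neg]
    have hsub : tsupport (fun s => ρ n (x - s)) ⊆ Icc (x - (φ n).rOut) (x + (φ n).rOut) := by
      refine closure_minimal (fun s hs => ?_) isClosed_Icc
      have h1 : x - s ∈ Function.support (ρ n) := hs
      rw [hρ, (φ n).support_normed_eq, mem_ball_zero_iff, Real.norm_eq_abs, abs_lt] at h1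
      constructor <;> linarith [h1.1, h1.2]
    have hIcc : Icc (x - (φ n).rOut) (x + (φ n).rOut) ⊆ Ioo (-L) L := fun s hs =>
      ⟨by linarith [hs.1, hx.1, hrlt n], by linarith [hs.2, hx.2, hrlt n]⟩
    have hχc : HasCompactSupport fun s => ρ n (x - s) :=
      isCompact_Icc.of_isClosed_subset (isClosed_tsupport _) hsub
    have hw := hweak _ hχs hχc (hsub.trans (hIcc.trans (Ioo_subset_Ioo (by linarith) hLR.le)))
    rw [hχdd] at hw
    have hval : ∀ f : ℝ → ℝ, (f ⋆[ContinuousLinearMap.lsmul ℝ ℝ, volume] g) x =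
        ∫ s, g s * f (x - s) := by
      intro f
      rw [convolution_lsmul_swap]
      exact integral_congr_ae (Eventually.of_forall fun s => by simp [mul_comm])
    have hi : ∀ f : ℝ → ℝ, Continuous f → HasCompactSupport f →
        Integrable fun s => g s * f (x - s) := by
      intro f hf hc
      obtain ⟨C, hC⟩ := hc.exists_bound_of_continuous hf
      exact gint.mul_bdd (c := C) (by fun_prop : Continuous fun s => f (x - s)).aestronglyMeasurable
        (Eventually.of_forall fun s => hC _)
    rw [hu]
    simp only [hval]
    rw [← integral_const_mul, ← sub_eq_zero, ← integral_sub
      ((hi _ (ρs n).continuous (ρc n)).const_mul _) (hi _ ((ρ1s n).continuous_deriv (by simp))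
        (ρc n).deriv.deriv), ← hw]
    refine integral_congr_ae (Eventually.of_forall fun s => ?_)
    by_cases hs : s ∈ Icc (-L) L
    · simp only [hg, indicator_of_mem hs]; ring
    · have hn : s ∉ tsupport fun s => ρ n (x - s) := fun h =>
        hs (Ioo_subset_Icc_self (hIcc (hsub h)))
      have h1 : ρ n (x - s) = 0 :=
        image_eq_zero_of_notMem_tsupport (f := fun s => ρ n (x - s)) hn
      have h2 : deriv (deriv (ρ n)) (x - s) = 0 := by
        have h3 := congrFun hχdd s
        rw [← h3]
        exact image_eq_zero_of_notMem_tsupport fun h =>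
          hn (tsupport_deriv_subset (tsupport_deriv_subset h))
      simp only [hg, indicator_of_notMem hs, h1, h2]; ring
  -- Mollifications converge wherever a is continuous. Nothing is claimed at 0, and the points z, -l
  -- and l at which the limit is taken are all nonzero.
  have lim : ∀ x, x ≠ 0 → |x| < L → Tendsto (fun n => u n x) atTop (𝓝 (a x)) := by
    intro x hx hxL
    have hxI : x ∈ Ioo (-L) L := abs_lt.1 hxL
    have hev : g =ᶠ[𝓝 x] a := by
      filter_upwards [Ioo_mem_nhds hxI.1 hxI.2] with s hs
      rw [hg, indicator_of_mem (Ioo_subset_Icc_self hs)]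
    have hac : ContinuousAt a x := by
      refine hcont.continuousAt (inter_mem (Icc_mem_nhds ?_ ?_) (isOpen_compl_singleton.mem_nhds hx))
      · linarith [hxI.1]
      · linarith [hxI.2]
    refine ContDiffBump.convolution_tendsto_right (g := fun _ => g) (k := fun _ => x) hrto
      (Eventually.of_forall fun _ => gint.aestronglyMeasurable) ?_ tendsto_const_nhds
    have : Tendsto g (𝓝 x) (𝓝 (a x)) := hac.tendsto.congr' hev.symm
    exact this.comp tendsto_snd
  have key : ∀ n, u n z ^ 2 ≤ max (u n (-l) ^ 2) (u n l ^ 2) := fun n =>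
    sq_le_max_of_deriv_two hlam (fun x _ => d1 n x) (d2 n) (abs_le.1 hzl.le)
  exact le_of_tendsto_of_tendsto' ((lim z hz0 (hzl.trans hlL)).pow 2)
    (((lim (-l) (by linarith : -l < 0).ne (by rwa [abs_neg, abs_of_pos hl0])).pow 2).max
      ((lim l hl0.ne' (by rwa [abs_of_pos hl0])).pow 2)) key

/-- Weak solutions of `a'' = lam a` on an interval, continuous up to the boundary and off the
origin, and vanishing at the boundary, are zero. -/
theorem eq_zero_of_weak {a : ℝ → ℝ} {R lam : ℝ} (hlam : 0 ≤ lam)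
    (hint : ∀ l < R, IntegrableOn a (Icc (-l) l))
    (hcont : ContinuousOn a (Icc (-R) R \ {0})) (haR : a R = 0) (haR' : a (-R) = 0)
    (hweak : ∀ χ : ℝ → ℝ, ContDiff ℝ ∞ χ → HasCompactSupport χ → tsupport χ ⊆ Ioo (-R) R →
      ∫ z, a z * (lam * χ z - deriv (deriv χ) z) = 0)
    {z : ℝ} (hz0 : z ≠ 0) (hz : |z| ≤ R) : a z = 0 := by
  rcases hz.eq_or_lt with h | h
  · rcases abs_choice z with h' | h'
    · rw [← h', h, haR]
    · rw [← neg_neg z, ← h', h, haR']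
  have hR : 0 < R := (abs_nonneg z).trans_lt h
  have t1 : Tendsto a (𝓝[<] R) (𝓝 0) := by
    have h1 := hcont R ⟨⟨by linarith, le_rfl⟩, hR.ne'⟩
    rw [ContinuousWithinAt, haR] at h1
    refine h1.mono_left (nhdsWithin_le_iff.2 ?_)
    filter_upwards [Ioo_mem_nhdsLT hR] with s hs
    exact ⟨⟨by linarith [hs.1], hs.2.le⟩, hs.1.ne'⟩
  have t2 : Tendsto (fun l => a (-l)) (𝓝[<] R) (𝓝 0) := by
    have h1 := hcont (-R) ⟨⟨le_rfl, by linarith⟩, by simpa using hR.ne'⟩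
    rw [ContinuousWithinAt, haR'] at h1
    refine h1.comp (tendsto_nhdsWithin_iff.2 ⟨?_, ?_⟩)
    · exact (continuous_neg.tendsto R).mono_left nhdsWithin_le_nhds
    · filter_upwards [Ioo_mem_nhdsLT hR] with s hs
      exact ⟨⟨by linarith [hs.2], by linarith [hs.1]⟩, by simpa using hs.1.ne'⟩
  -- Let l increase to R in the maximum principle: both endpoint values tend to 0.
  have h3 : a z ^ 2 ≤ 0 := by
    have h4 : Tendsto (fun l => max (a (-l) ^ 2) (a l ^ 2)) (𝓝[<] R) (𝓝 0) := by
      simpa using (t2.pow 2).max (t1.pow 2)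
    refine ge_of_tendsto h4 ?_
    filter_upwards [Ioo_mem_nhdsLT h] with l hl
    exact sq_le_max_of_weak hlam hint hcont hweak hz0 hl.1 hl.2
  exact pow_eq_zero_iff (two_ne_zero) |>.1 (le_antisymm h3 (sq_nonneg _))

end FlatCylinder

end

/-! ### The Newton kernel as fundamental solution on ℝ³. -/

noncomputable section

namespace FlatCylinder

theorem hasDerivAt_inv_sqrt {x : ℝ} (hx : 0 < x) :
    HasDerivAt (fun x => (√x)⁻¹) (-(1 / 2) * (√x)⁻¹ ^ 3) x := by
  have h := (Real.hasDerivAt_sqrt hx.ne').inv (Real.sqrt_pos.2 hx).ne'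
  convert! h using 1
  have := (Real.sqrt_pos.2 hx).ne'
  field_simp

theorem inv_sqrt_sq_mul {x : ℝ} (hx : 0 < x) : (√x)⁻¹ ^ 2 * x = 1 := by
  rw [inv_pow, Real.sq_sqrt hx.le, inv_mul_cancel₀ hx.ne']

/-- The regularised Newton kernel `(|v|² + c)^(-1/2)`. -/
def newton (c : ℝ) (v : Cover) : ℝ := (√(‖v‖ ^ 2 + c))⁻¹

theorem newton_zero (v : Cover) : newton 0 v = ‖v‖⁻¹ := by
  rw [newton, add_zero, Real.sqrt_sq (norm_nonneg v)]

theorem contDiffAt_newton {c : ℝ} {v : Cover} (h : 0 < ‖v‖ ^ 2 + c) :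
    ContDiffAt ℝ ∞ (newton c) v := by
  have h1 : ContDiffAt ℝ ∞ (fun v : Cover => ‖v‖ ^ 2 + c) v :=
    ((contDiff_norm_sq ℝ).add contDiff_const).contDiffAt
  exact (h1.sqrt h.ne').inv (Real.sqrt_pos.2 h).ne'

theorem hasDerivAt_norm_sq_line (w : Cover) (i : Fin 3) (c : ℝ) :
    HasDerivAt (fun t : ℝ => ‖w + t • EuclideanSpace.single i (1:ℝ)‖ ^ 2 + c) (2 * w i) 0 := by
  have h : (fun t : ℝ => ‖w + t • EuclideanSpace.single i (1:ℝ)‖ ^ 2 + c) =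
      fun t => ‖w‖ ^ 2 + t * (2 * w i) + t ^ 2 + c := by
    funext t
    rw [norm_add_sq_real, inner_smul_right, norm_smul, EuclideanSpace.inner_single_right]
    simp
    ring
  rw [h]
  have h1 := ((((hasDerivAt_id (0:ℝ)).mul_const (2 * w i)).const_add (‖w‖ ^ 2)).add
    ((hasDerivAt_id (0:ℝ)).pow 2)).add_const c
  convert! h1 using 1
  simp

theorem dd_newton {c : ℝ} {v : Cover} (h : 0 < ‖v‖ ^ 2 + c) (i : Fin 3) :
    dd i (newton c) v = -newton c v ^ 3 + 3 * v i ^ 2 * newton c v ^ 5 := by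
  have hd : ∀ w : Cover, 0 < ‖w‖ ^ 2 + c → HasDerivAt
      (fun t : ℝ => newton c (w + t • EuclideanSpace.single i 1)) (-(w i) * newton c w ^ 3) 0 := by
    intro w hw
    have h1 := hasDerivAt_norm_sq_line w i c
    have h2 : HasDerivAt (fun x => (√x)⁻¹) (-(1 / 2) * (√(‖w‖ ^ 2 + c))⁻¹ ^ 3)
        (‖w + (0:ℝ) • EuclideanSpace.single i (1:ℝ)‖ ^ 2 + c) := by
      simpa using hasDerivAt_inv_sqrt hw
    convert! h2.comp (0:ℝ) h1 using 1
    rw [newton]; ring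
  have hev : ∀ᶠ w : Cover in 𝓝 v, 0 < ‖w‖ ^ 2 + c :=
    (by fun_prop : Continuous fun w : Cover => ‖w‖ ^ 2 + c).continuousAt.eventually (lt_mem_nhds h)
  refine dd_eq_of_hasDerivAt (f₁ := fun w => -(w i) * newton c w ^ 3)
    ((contDiffAt_newton h).of_le (by norm_cast)) (hev.mono hd) ?_
  have h3 : HasDerivAt (fun t : ℝ => (v + t • EuclideanSpace.single i (1:ℝ)) i) 1 0 := by
    simpa using (hasDerivAt_id (0:ℝ)).const_add (v i)
  convert! h3.neg.mul ((hd v h).pow 3) using 1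
  simp
  ring

/-- The sum is -3ν³ + 3|v|²ν⁵ with ν = `newton c v`, and ν²(|v|² + c) = 1. For c = 0 this is
harmonicity; for c > 0 the right side is minus an approximate identity of mass 4π. -/
theorem sum_dd_newton {c : ℝ} {v : Cover} (h : 0 < ‖v‖ ^ 2 + c) :
    ∑ i, dd i (newton c) v = -(3 * c * newton c v ^ 5) := by
  simp only [dd_newton h]
  rw [Finset.sum_add_distrib, ← Finset.sum_mul, ← Finset.mul_sum,
    ← EuclideanSpace.real_norm_sq_eq]
  have := inv_sqrt_sq_mul h
  rw [← newton] at this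
  simp only [Finset.sum_const, Finset.card_univ, Fintype.card_fin]
  set r := newton c v
  linear_combination (3 * r ^ 3) * this

theorem integral_newton_mul {c : ℝ} (hc : 0 < c) {φ : Cover → ℝ} (hφ : ContDiff ℝ ∞ φ)
    (cφ : HasCompactSupport φ) :
    ∫ v, newton c v * ∑ i, dd i φ v = -∫ v, 3 * c * newton c v ^ 5 * φ v := by
  have hs : ContDiff ℝ ∞ (newton c) :=
    contDiff_iff_contDiffAt.2 fun v => contDiffAt_newton (by positivity)
  have i1 : ∀ i, Integrable fun v => newton c v * dd i φ v := fun i =>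
    (hs.continuous.mul (contDiff_dd hφ i).continuous).integrable_of_hasCompactSupport
      (hasCompactSupport_dd hφ cφ i).mul_left
  have i2 : ∀ i, Integrable fun v => dd i (newton c) v * φ v := fun i =>
    ((contDiff_dd hs i).continuous.mul hφ.continuous).integrable_of_hasCompactSupport cφ.mul_left
  simp only [Finset.mul_sum]
  rw [integral_finsetSum _ fun i _ => i1 i]
  simp only [integral_mul_dd hs hφ cφ]
  rw [← integral_finsetSum _ fun i _ => i2 i, ← integral_neg]
  refine integral_congr_ae (Eventually.of_forall fun v => ?_)
  simp only
  rw [← Finset.sum_mul, sum_dd_newton (by positivity)]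
  ring

theorem newton_smul {ε : ℝ} (hε : 0 < ε) (w : Cover) :
    newton (ε ^ 2) (ε • w) = ε⁻¹ * newton 1 w := by
  rw [newton, newton, norm_smul, Real.norm_eq_abs, abs_of_pos hε,
    show (ε * ‖w‖) ^ 2 + ε ^ 2 = ε ^ 2 * (‖w‖ ^ 2 + 1) by ring, Real.sqrt_mul (by positivity),
    Real.sqrt_sq hε.le, mul_inv]

/-- An explicit primitive, rising from 0 to 1 on the half-line, of the radial density y² · 3(y² +
1)^(-5/2) that polar coordinates produce. -/
theorem hasDerivAt_newton_profile (y : ℝ) :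
    HasDerivAt (fun y => (y * (√(y ^ 2 + 1))⁻¹) ^ 3) (y ^ 2 * (3 * (√(y ^ 2 + 1))⁻¹ ^ 5)) y := by
  have hpos : 0 < y ^ 2 + 1 := by positivity
  have h1 : HasDerivAt (fun y : ℝ => y ^ 2 + 1) (2 * y) y := by
    simpa using (hasDerivAt_pow 2 y).add_const 1
  have h2 := (hasDerivAt_inv_sqrt hpos).comp y h1
  have h3 := ((hasDerivAt_id y).mul h2).pow 3
  convert! h3 using 1
  have := inv_sqrt_sq_mul hpos
  simp only [Function.comp_apply, Pi.mul_apply, id]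
  set r := (√(y ^ 2 + 1))⁻¹
  push_cast
  linear_combination (3 * y ^ 2 * r ^ 3) * this

theorem tendsto_newton_profile :
    Tendsto (fun y : ℝ => (y * (√(y ^ 2 + 1))⁻¹) ^ 3) atTop (𝓝 1) := by
  have h0 : Tendsto (fun y : ℝ => y ^ 2 + 1) atTop atTop :=
    tendsto_atTop_add_const_right _ _ (tendsto_pow_atTop two_ne_zero)
  have h1 : Tendsto (fun y : ℝ => √(1 - (y ^ 2 + 1)⁻¹)) atTop (𝓝 1) := by
    have := (tendsto_inv_atTop_zero.comp h0).const_sub 1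
    simpa using this.sqrt
  have h2 : (fun y : ℝ => √(1 - (y ^ 2 + 1)⁻¹)) =ᶠ[atTop] fun y => y * (√(y ^ 2 + 1))⁻¹ := by
    filter_upwards [eventually_ge_atTop 0] with y hy
    have : 1 - (y ^ 2 + 1)⁻¹ = y ^ 2 * (y ^ 2 + 1)⁻¹ := by field_simp; ring
    rw [this, Real.sqrt_mul (by positivity), Real.sqrt_sq hy, Real.sqrt_inv]
  simpa using (h1.congr' h2).pow 3

/-- In polar coordinates the integral is the dimension 3, times the volume 4π/3 of the unit ball,
times a radial integral equal to 1. -/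
theorem integrable_newton_five :
    Integrable (fun w : Cover => 3 * newton 1 w ^ 5) ∧ ∫ w : Cover, 3 * newton 1 w ^ 5 = 4 * Real.pi := by
  have hd : ∀ y ∈ Ioi (0:ℝ), HasDerivAt (fun y => (y * (√(y ^ 2 + 1))⁻¹) ^ 3)
      (y ^ 2 * (3 * (√(y ^ 2 + 1))⁻¹ ^ 5)) y := fun y _ => hasDerivAt_newton_profile y
  have hc : ContinuousWithinAt (fun y : ℝ => (y * (√(y ^ 2 + 1))⁻¹) ^ 3) (Ici 0) 0 :=
    (hasDerivAt_newton_profile 0).continuousAt.continuousWithinAt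
  have hi := integrableOn_Ioi_deriv_of_nonneg hc hd (fun y _ => by positivity)
    tendsto_newton_profile
  have hval := integral_Ioi_of_hasDerivAt_of_tendsto hc hd hi tendsto_newton_profile
  have hdim : Module.finrank ℝ Cover = 3 := by simp
  constructor
  · refine (integrable_fun_norm_addHaar (volume : Measure Cover)
      (f := fun y => 3 * (√(y ^ 2 + 1))⁻¹ ^ 5)).2 ?_
    rw [hdim]
    simpa using hi
  · have h := integral_fun_norm_addHaar (volume : Measure Cover)
      (fun y => 3 * (√(y ^ 2 + 1))⁻¹ ^ 5)
    refine h.trans ?_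
    rw [hdim, Measure.real, EuclideanSpace.volume_ball_fin_three]
    simp only [smul_eq_mul, Nat.add_one_sub_one, nsmul_eq_mul]
    rw [hval]
    simp [ENNReal.toReal_ofReal (show (0:ℝ) ≤ Real.pi * 4 / 3 by positivity)]
    ring

/-- In dimension three the polar weight y² absorbs the singularity 1/y. -/
theorem integrable_inv_norm_mul {h : Cover → ℝ} (hh : Continuous h) (ch : HasCompactSupport h) :
    Integrable fun v => ‖v‖⁻¹ * h v := by
  obtain ⟨C, hC⟩ := ch.exists_bound_of_continuous hh
  obtain ⟨ρ, hρ0, hρ⟩ := ch.isBounded.subset_ball_lt 0 0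
  have hdim : Module.finrank ℝ Cover = 3 := by simp
  have h1 : IntegrableOn (fun v : Cover => ‖v‖⁻¹) (Metric.ball 0 ρ) := by
    refine (integrableOn_fun_norm_addHaar (volume : Measure Cover) (f := fun y => y⁻¹)).2 ?_
    rw [hdim]
    have : IntegrableOn (fun y : ℝ => y) (Ioo 0 ρ) :=
      (continuous_id.integrableOn_Icc (a := 0) (b := ρ)).mono_set Ioo_subset_Icc_self
    refine this.congr_fun (fun y hy => ?_) measurableSet_Ioo
    have := hy.1.ne'
    simp
    field_simp
  have h2 : IntegrableOn (fun v : Cover => ‖v‖⁻¹ * h v) (Metric.ball 0 ρ) :=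
    h1.mul_bdd (c := C) hh.aestronglyMeasurable (Eventually.of_forall hC)
  refine (integrableOn_iff_integrable_of_support_subset fun v hv => hρ ?_).1 h2
  exact subset_tsupport _ (right_ne_zero_of_mul hv)

/-- The Newton kernel is a fundamental solution of the Laplacian. -/
theorem integral_inv_norm_mul_laplacian {φ : Cover → ℝ} (hφ : ContDiff ℝ ∞ φ)
    (cφ : HasCompactSupport φ) :
    ∫ v, ‖v‖⁻¹ * ∑ i, dd i φ v = -(4 * Real.pi * φ 0) := by
  set D : Cover → ℝ := fun v => ∑ i, dd i φ v with hD
  have Dc : Continuous D := continuous_finsetSum _ fun i _ => (contDiff_dd hφ i).continuous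
  have Dcs : HasCompactSupport D := by
    refine cφ.mono' fun v hv => ?_
    by_contra hn
    exact hv (Finset.sum_eq_zero fun i _ => dd_eq_zero_of_notMem_tsupport hn i)
  set ε : ℕ → ℝ := fun n => 1 / ((n : ℝ) + 1) with hε
  have εpos : ∀ n, 0 < ε n := fun n => by positivity
  have εlim : Tendsto ε atTop (𝓝 0) := tendsto_one_div_add_atTop_nhds_zero_nat
  -- The kernel is regularised with c = ε², and the unregularised kernel, which is integrable
  -- against D, dominates.
  have L1 : Tendsto (fun n => ∫ v, newton (ε n ^ 2) v * D v) atTop (𝓝 (∫ v, ‖v‖⁻¹ * D v)) := by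
    refine tendsto_integral_of_dominated_convergence (fun v => ‖‖v‖⁻¹ * D v‖) (fun n => ?_)
      (integrable_inv_norm_mul Dc Dcs).norm (fun n => ?_) ?_
    · have hs : ContDiff ℝ ∞ (newton (ε n ^ 2)) := contDiff_iff_contDiffAt.2 fun v =>
        contDiffAt_newton (by have := εpos n; positivity)
      exact (hs.continuous.mul Dc).aestronglyMeasurable
    · have h0 : ∀ᵐ v : Cover, v ≠ 0 := by
        simp [ae_iff]
      filter_upwards [h0] with v hv
      rw [norm_mul, norm_mul]
      refine mul_le_mul_of_nonneg_right ?_ (norm_nonneg _)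
      rw [newton, norm_inv, norm_inv]
      refine inv_anti₀ (norm_pos_iff.2 (norm_ne_zero_iff.2 hv)) ?_
      rw [Real.norm_of_nonneg (norm_nonneg v), Real.norm_of_nonneg (Real.sqrt_nonneg _)]
      exact Real.le_sqrt_of_sq_le (by nlinarith [sq_nonneg (ε n)])
    · have h0 : ∀ᵐ v : Cover, v ≠ 0 := by
        simp [ae_iff]
      filter_upwards [h0] with v hv
      have h1 : Tendsto (fun n => √(‖v‖ ^ 2 + ε n ^ 2)) atTop (𝓝 ‖v‖) := by
        have := ((εlim.pow 2).const_add (‖v‖ ^ 2)).sqrt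
        simpa [Real.sqrt_sq (norm_nonneg v)] using this
      exact (h1.inv₀ (norm_ne_zero_iff.2 hv)).mul_const _
  -- After integration by parts the substitution v = εw turns the shrinking density into the fixed
  -- one of mass 4π, with φ evaluated at εw, which tends to φ 0.
  have L2 : Tendsto (fun n => ∫ v, newton (ε n ^ 2) v * D v) atTop (𝓝 (-(4 * Real.pi * φ 0))) := by
    have hrw : ∀ n, ∫ v, newton (ε n ^ 2) v * D v =
        -∫ w, 3 * newton 1 w ^ 5 * φ (ε n • w) := by
      intro n
      have hn := εpos n
      rw [integral_newton_mul (by positivity) hφ cφ]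
      congr 1
      have h := Measure.integral_comp_smul (volume : Measure Cover)
        (fun v => 3 * ε n ^ 2 * newton (ε n ^ 2) v ^ 5 * φ v) (ε n)
      have hdim : Module.finrank ℝ Cover = 3 := by simp
      rw [hdim, abs_of_pos (by positivity), smul_eq_mul] at h
      have h2 : ∫ v, 3 * ε n ^ 2 * newton (ε n ^ 2) v ^ 5 * φ v = ε n ^ 3 *
          ∫ x, 3 * ε n ^ 2 * newton (ε n ^ 2) (ε n • x) ^ 5 * φ (ε n • x) := by
        rw [h, ← mul_assoc, mul_inv_cancel₀ (by positivity), one_mul]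
      rw [h2, ← integral_const_mul]
      refine integral_congr_ae (Eventually.of_forall fun w => ?_)
      simp only [newton_smul hn]
      field_simp
    simp only [hrw]
    refine Tendsto.neg ?_
    rw [← integrable_newton_five.2, ← integral_mul_const]
    obtain ⟨C, hC⟩ := cφ.exists_bound_of_continuous hφ.continuous
    have hs : ContDiff ℝ ∞ (newton 1) := contDiff_iff_contDiffAt.2 fun v =>
      contDiffAt_newton (by positivity)
    have hsc := hs.continuous
    have hφc := hφ.continuous
    refine tendsto_integral_of_dominated_convergence (fun w => 3 * newton 1 w ^ 5 * C)
      (fun n => ?_) (integrable_newton_five.1.mul_const C) (fun n => ?_) ?_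
    · exact (by fun_prop : Continuous fun w => 3 * newton 1 w ^ 5 * φ (ε n • w)).aestronglyMeasurable
    · refine Eventually.of_forall fun w => ?_
      have : 0 ≤ newton 1 w := by rw [newton]; positivity
      rw [norm_mul, Real.norm_of_nonneg (by positivity)]
      exact mul_le_mul_of_nonneg_left (hC _) (by positivity)
    · refine Eventually.of_forall fun w => Tendsto.const_mul _ ?_
      have : Tendsto (fun n => ε n • w) atTop (𝓝 0) := by simpa using εlim.smul_const w
      exact (hφc.tendsto 0).comp this
  exact tendsto_nhds_unique L1 L2

end FlatCylinder

end

/-! ### Cutting off the Newton kernel, and symmetries of the remainder. -/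

noncomputable section

namespace FlatCylinder

/-- The radial profile of the cutoff. -/
def cutoffProfile {r : ℝ} (hr : 0 < r) : ContDiffBump (0 : ℝ) :=
  ⟨r / 4, r / 2, by positivity, by linarith⟩

/-- A radial cutoff supported in the ball of radius `r / 2`. -/
def cutoff {r : ℝ} (hr : 0 < r) (v : Cover) : ℝ := cutoffProfile hr ‖v‖

variable {r : ℝ} (hr : 0 < r)

theorem cutoff_eventually_one : ∀ᶠ v in 𝓝 (0 : Cover), cutoff hr v = 1 := by
  have h := (cutoffProfile hr).eventuallyEq_one
  have h2 : Tendsto (fun v : Cover => ‖v‖) (𝓝 0) (𝓝 0) := by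
    simpa using (continuous_norm (E := Cover)).tendsto 0
  exact h2.eventually h

theorem cutoff_eq_zero {v : Cover} (hv : r / 2 ≤ ‖v‖) : cutoff hr v = 0 :=
  (cutoffProfile hr).zero_of_le_dist (by simpa [cutoffProfile] using hv)

theorem contDiff_cutoff : ContDiff ℝ ∞ (cutoff hr) := by
  refine contDiff_iff_contDiffAt.2 fun v => ?_
  by_cases hv : v = 0
  · subst hv
    exact contDiffAt_const.congr_of_eventuallyEq (cutoff_eventually_one hr)
  · exact (cutoffProfile hr).contDiff.contDiffAt.comp v (contDiffAt_norm ℝ hv)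

theorem hasCompactSupport_cutoff : HasCompactSupport (cutoff hr) := by
  refine HasCompactSupport.of_support_subset_isCompact (isCompact_closedBall 0 (r / 2)) fun v hv => ?_
  rw [mem_closedBall_zero_iff]
  by_contra! h
  exact hv (cutoff_eq_zero hr h.le)

/-- The regular part of the Newton kernel, equal to it away from the pole. -/
def regularPart (v : Cover) : ℝ := (1 - cutoff hr v) * (2 * ‖v‖)⁻¹

/-- The singular part of the Newton kernel, supported near the pole. -/
def singularPart (v : Cover) : ℝ := cutoff hr v * (2 * ‖v‖)⁻¹

theorem contDiffAt_inv_norm {v : Cover} (hv : v ≠ 0) :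
    ContDiffAt ℝ ∞ (fun v : Cover => (2 * ‖v‖)⁻¹) v :=
  (contDiffAt_const.mul (contDiffAt_norm ℝ hv)).inv (by simpa using hv)

theorem contDiff_regularPart : ContDiff ℝ ∞ (regularPart hr) := by
  refine contDiff_iff_contDiffAt.2 fun v => ?_
  by_cases hv : v = 0
  · subst hv
    have h : regularPart hr =ᶠ[𝓝 0] fun _ => 0 := by
      filter_upwards [cutoff_eventually_one hr] with v hv
      simp [regularPart, hv]
    exact contDiffAt_const.congr_of_eventuallyEq h
  · exact (contDiffAt_const.sub (contDiff_cutoff hr).contDiffAt).mul (contDiffAt_inv_norm hv)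

theorem contDiffAt_singularPart {v : Cover} (hv : v ≠ 0) : ContDiffAt ℝ ∞ (singularPart hr) v :=
  (contDiff_cutoff hr).contDiffAt.mul (contDiffAt_inv_norm hv)

theorem singularPart_eq_zero {v : Cover} (hv : r / 2 ≤ ‖v‖) : singularPart hr v = 0 := by
  rw [singularPart, cutoff_eq_zero hr hv, zero_mul]

theorem singularPart_eq_sub (v : Cover) :
    singularPart hr v = (2 * ‖v‖)⁻¹ - regularPart hr v := by
  rw [singularPart, regularPart]; ring

theorem tendsto_singularPart : Tendsto (singularPart hr) (𝓝[≠] 0) atTop := by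
  have h1 : Tendsto (fun v : Cover => (2 * ‖v‖)⁻¹) (𝓝[≠] 0) atTop := by
    refine Tendsto.inv_tendsto_nhdsGT_zero (tendsto_nhdsWithin_iff.2 ⟨?_, ?_⟩)
    · have : Tendsto (fun v : Cover => 2 * ‖v‖) (𝓝 0) (𝓝 0) := by
        have : Continuous fun v : Cover => 2 * ‖v‖ := by fun_prop
        simpa using this.tendsto 0
      exact this.mono_left nhdsWithin_le_nhds
    · filter_upwards [self_mem_nhdsWithin] with v hv
      have : 0 < ‖v‖ := norm_pos_iff.2 hv
      simp [this]
  refine h1.congr' ?_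
  filter_upwards [nhdsWithin_le_nhds (cutoff_eventually_one hr)] with v hv
  rw [singularPart, hv, one_mul]

/-- The smooth density by which the singular part fails to be a fundamental solution. -/
def remainder (v : Cover) : ℝ := ∑ i, dd i (regularPart hr) v

theorem contDiff_remainder : ContDiff ℝ ∞ (remainder hr) :=
  ContDiff.sum fun i _ => contDiff_dd (contDiff_regularPart hr) i

/-- Beyond the cutoff the regular part is 1/(2|v|) itself, which is harmonic away from the pole. -/
theorem remainder_eq_zero {v : Cover} (hv : r / 2 < ‖v‖) : remainder hr v = 0 := by
  have hv0 : 0 < ‖v‖ ^ 2 + 0 := by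
    have : 0 < ‖v‖ := by linarith
    positivity
  have hev : regularPart hr =ᶠ[𝓝 v] fun w => (1 / 2) * newton 0 w := by
    filter_upwards [(continuous_norm.continuousAt (x := v)).eventually (lt_mem_nhds hv)] with w hw
    rw [regularPart, cutoff_eq_zero hr hw.le, newton_zero, mul_inv]
    ring
  have h2 : ∀ i, dd i (fun w => (1 / 2) * newton 0 w) v = (1 / 2) * dd i (newton 0) v := by
    intro i
    have := iteratedFDeriv_const_smul_apply (a := (1/2:ℝ))
      ((contDiffAt_newton hv0).of_le (show ((2:ℕ):WithTop ℕ∞) ≤ ∞ by norm_cast))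
    have h3 := congrArg (fun m => m fun _ => EuclideanSpace.single i (1:ℝ)) this
    exact h3
  simp only [remainder, dd_congr hev, h2]
  rw [← Finset.mul_sum, sum_dd_newton hv0]
  ring

theorem tsupport_remainder : tsupport (remainder hr) ⊆ Metric.closedBall 0 (r / 2) := by
  refine closure_minimal (fun v hv => ?_) Metric.isClosed_closedBall
  rw [mem_closedBall_zero_iff]
  by_contra! h
  exact hv (remainder_eq_zero hr h)

theorem hasCompactSupport_remainder : HasCompactSupport (remainder hr) :=
  (isCompact_closedBall _ _).of_isClosed_subset (isClosed_tsupport _) (tsupport_remainder hr)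

theorem integrable_singularPart_mul {h : Cover → ℝ} (hh : Continuous h) :
    Integrable fun v => singularPart hr v * h v := by
  have h1 := integrable_inv_norm_mul (h := fun v => cutoff hr v * h v)
    ((contDiff_cutoff hr).continuous.mul hh) (hasCompactSupport_cutoff hr).mul_right
  refine (h1.const_mul (1 / 2)).congr (Eventually.of_forall fun v => ?_)
  simp only [singularPart, mul_inv]
  ring

/-- The singular part is the full kernel minus the regular part: the kernel contributes 2πφ(0), and
integrating the smooth regular part by parts produces the remainder. -/
theorem integral_singularPart_of_compact {φ : Cover → ℝ} (hφ : ContDiff ℝ ∞ φ)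
    (cφ : HasCompactSupport φ) :
    ∫ v, singularPart hr v * -∑ i, dd i φ v = 2 * Real.pi * φ 0 + ∫ v, remainder hr v * φ v := by
  set D : Cover → ℝ := fun v => ∑ i, dd i φ v with hD
  have Dc : Continuous D := continuous_finsetSum _ fun i _ => (contDiff_dd hφ i).continuous
  have Dcs : HasCompactSupport D := by
    refine cφ.mono' fun v hv => ?_
    by_contra hn
    exact hv (Finset.sum_eq_zero fun i _ => dd_eq_zero_of_notMem_tsupport hn i)
  have hS := contDiff_regularPart hr
  have i1 := integrable_inv_norm_mul Dc Dcs
  have i2 : Integrable fun v => regularPart hr v * D v :=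
    (hS.continuous.mul Dc).integrable_of_hasCompactSupport Dcs.mul_left
  have e1 : ∫ v, singularPart hr v * -D v =
      -(1 / 2) * (∫ v, ‖v‖⁻¹ * D v) + ∫ v, regularPart hr v * D v := by
    rw [← integral_const_mul, ← integral_add (i1.const_mul _) i2]
    refine integral_congr_ae (Eventually.of_forall fun v => ?_)
    simp only [singularPart_eq_sub, mul_inv]
    ring
  have e2 : ∫ v, regularPart hr v * D v = ∫ v, remainder hr v * φ v := by
    have j1 : ∀ i, Integrable fun v => regularPart hr v * dd i φ v := fun i =>
      (hS.continuous.mul (contDiff_dd hφ i).continuous).integrable_of_hasCompactSupport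
        (hasCompactSupport_dd hφ cφ i).mul_left
    have j2 : ∀ i, Integrable fun v => dd i (regularPart hr) v * φ v := fun i =>
      ((contDiff_dd hS i).continuous.mul hφ.continuous).integrable_of_hasCompactSupport cφ.mul_left
    simp only [hD, Finset.mul_sum, remainder, Finset.sum_mul]
    rw [integral_finsetSum _ fun i _ => j1 i, integral_finsetSum _ fun i _ => j2 i]
    simp only [integral_mul_dd hS hφ cφ]
  rw [e1, e2, integral_inv_norm_mul_laplacian hφ cφ]
  ring

/-- The singular part is a fundamental solution up to the remainder. -/
theorem integral_singularPart {φ : Cover → ℝ} (hφ : ContDiff ℝ ∞ φ) :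
    ∫ v, singularPart hr v * -∑ i, dd i φ v = 2 * Real.pi * φ 0 + ∫ v, remainder hr v * φ v := by
  -- Both integrands live in the ball of radius r/2, where ζ = 1, so replacing φ by ζφ changes
  -- nothing. The identity then also applies to constants, to the height, and to periodic lifts of
  -- functions on the cylinder.
  set ζ : ContDiffBump (0 : Cover) := ⟨r, 2 * r, hr, by linarith⟩
  have hev : ∀ v : Cover, ‖v‖ < r → (fun v => ζ v * φ v) =ᶠ[𝓝 v] φ := by
    intro v hv
    filter_upwards [(continuous_norm.continuousAt (x := v)).eventually (gt_mem_nhds hv)] with w hw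
    have : ζ w = 1 := ζ.one_of_mem_closedBall (by simpa using hw.le)
    rw [this, one_mul]
  have h := integral_singularPart_of_compact hr (φ := fun v => ζ v * φ v) (ζ.contDiff.mul hφ)
    ζ.hasCompactSupport.mul_right
  have h1 : ∫ v, singularPart hr v * -∑ i, dd i (fun v => ζ v * φ v) v =
      ∫ v, singularPart hr v * -∑ i, dd i φ v := by
    refine integral_congr_ae (Eventually.of_forall fun v => ?_)
    simp only
    rcases lt_or_ge ‖v‖ r with hv | hv
    · simp only [dd_congr (hev v hv)]
    · rw [singularPart_eq_zero hr (by linarith)]; simp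
  have h2 : ∫ v, remainder hr v * (ζ v * φ v) = ∫ v, remainder hr v * φ v := by
    refine integral_congr_ae (Eventually.of_forall fun v => ?_)
    simp only
    rcases lt_or_ge ‖v‖ r with hv | hv
    · rw [(hev v hv).eq_of_nhds]
    · rw [remainder_eq_zero hr (by linarith)]; simp
  have h3 : ζ 0 * φ 0 = φ 0 := (hev 0 (by simpa using hr)).eq_of_nhds
  rw [h1, h2, h3] at h
  exact h

/-- Test function 1. The mass fixes the slope of the Green's function at the two ends. -/
theorem integral_remainder : ∫ v, remainder hr v = -(2 * Real.pi) := by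
  have h := integral_singularPart hr (φ := fun _ => 1) contDiff_const
  have h0 : ∀ (v : Cover) (i : Fin 3), dd i (fun _ : Cover => (1:ℝ)) v = 0 := fun v i => by
    simp [dd, iteratedFDeriv_const_of_ne]
  simp only [h0, Finset.sum_const_zero, neg_zero, mul_zero, integral_zero, mul_one] at h
  linarith

/-- Test with the height, which is harmonic and vanishes at the pole. Without a first moment,
convolving |z| with the remainder leaves no constant term beyond its support. -/
theorem integral_remainder_mul_height : ∫ v, remainder hr v * v 2 = 0 := by
  have hs : ContDiff ℝ ∞ fun v : Cover => v 2 := by fun_prop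
  have h := integral_singularPart hr hs
  have h0 : ∀ (v : Cover) (i : Fin 3), dd i (fun v : Cover => v 2) v = 0 := fun v i => by
    refine dd_eq_of_hasDerivAt (f₁ := fun _ => (EuclideanSpace.single i (1:ℝ) : Cover) 2)
      (hs.contDiffAt.of_le (by norm_cast))
      (Eventually.of_forall fun w => ?_) (hasDerivAt_const _ _)
    simpa using (((hasDerivAt_id (0:ℝ)).mul_const
      ((EuclideanSpace.single i (1:ℝ) : Cover) 2)).const_add (w 2))
  simp only [h0, Finset.sum_const_zero, neg_zero, mul_zero, integral_zero, PiLp.zero_apply] at h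
  linarith

/-- The reflection of the universal cover in the horizontal plane. -/
def reflection : Cover ≃ₗᵢ[ℝ] Cover :=
  LinearIsometryEquiv.piLpCongrRight 2 fun i : Fin 3 =>
    if i = 2 then LinearIsometryEquiv.neg ℝ else LinearIsometryEquiv.refl ℝ ℝ

theorem reflection_apply_two (v : Cover) : reflection v 2 = -v 2 := by
  simp [reflection]

theorem reflection_apply_of_ne (v : Cover) {i : Fin 3} (hi : i ≠ 2) : reflection v i = v i := by
  simp [reflection, hi]

theorem reflection_single (i : Fin 3) : reflection (EuclideanSpace.single i (1:ℝ)) =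
    EuclideanSpace.single i 1 ∨
    reflection (EuclideanSpace.single i (1:ℝ)) = -EuclideanSpace.single i 1 := by
  by_cases hi : i = 2
  · right
    ext j
    by_cases hj : j = 2
    · subst hj; rw [reflection_apply_two]; simp
    · rw [reflection_apply_of_ne _ hj]; simp [hi, hj]
  · left
    ext j
    by_cases hj : j = 2
    · subst hj; rw [reflection_apply_two]; simp [Ne.symm hi]
    · rw [reflection_apply_of_ne _ hj]

/-- The reflection maps each coordinate axis to itself up to sign, and a second derivative is
quadratic in the direction, so the sign disappears. -/
theorem dd_reflection {f : Cover → ℝ} (hf : ContDiff ℝ ∞ f)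
    (hsymm : ∀ v, f (reflection v) = f v) (i : Fin 3) (v : Cover) :
    dd i f (reflection v) = dd i f v := by
  have h1 := (reflection.toContinuousLinearEquiv : Cover →L[ℝ] Cover).iteratedFDeriv_comp_right
    (f := f) (i := 2) (n := ∞) hf v (by norm_cast)
  have h2 : f ∘ (reflection.toContinuousLinearEquiv : Cover →L[ℝ] Cover) = f := funext hsymm
  rw [h2] at h1
  have h3 := congrArg (fun m => m fun _ => EuclideanSpace.single i (1:ℝ)) h1
  simp only [ContinuousMultilinearMap.compContinuousLinearMap_apply] at h3
  rw [dd, dd, h3]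
  have h4 : ((reflection.toContinuousLinearEquiv : Cover →L[ℝ] Cover) : Cover → Cover)
      = reflection := rfl
  rw [h4]
  rcases reflection_single i with h | h
  · rw [h]
  · rw [h]
    have h5 := (iteratedFDeriv ℝ 2 f (reflection v)).map_smul_univ (fun _ => (-1:ℝ))
      (fun _ => EuclideanSpace.single i (1:ℝ))
    simpa using h5.symm

theorem remainder_reflection (v : Cover) : remainder hr (reflection v) = remainder hr v := by
  refine Finset.sum_congr rfl fun i _ => dd_reflection (contDiff_regularPart hr) (fun w => ?_) i v
  have : cutoff hr (reflection w) = cutoff hr w := by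
    rw [cutoff, cutoff, LinearIsometryEquiv.norm_map]
  rw [regularPart, regularPart, this, LinearIsometryEquiv.norm_map]

end FlatCylinder

end

/-! ### Test functions and integration by parts on the cylinder. -/

noncomputable section

namespace FlatCylinder

variable {b : Module.Basis (Fin 2) ℝ Plane}

variable (b) in
/-- Translations of the cylinder along a coordinate axis of the universal cover. -/
def axisC (i : Fin 3) : ℝ →+ Cyl b := (coveringHom b).comp (axis i)

theorem continuous_axisC (i : Fin 3) : Continuous (axisC b i : ℝ → Cyl b) :=
  (continuous_covering b).comp (continuous_axis i)

theorem covering_add_axisC (v : Cover) (i : Fin 3) (t : ℝ) :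
    covering b v + axisC b i t = covering b (v + t • EuclideanSpace.single i 1) :=
  (covering_add b _ _).symm

/-- First partial derivatives on the cylinder. -/
def p1 (i : Fin 3) (f : Cyl b → ℝ) (x : Cyl b) : ℝ :=
  fderiv ℝ (inCoords b f x) 0 (EuclideanSpace.single i 1)

theorem p1_covering (i : Fin 3) (f : Cyl b → ℝ) (v : Cover) :
    p1 i f (covering b v) = fderiv ℝ (f ∘ covering b) v (EuclideanSpace.single i 1) := by
  rw [p1, inCoords_covering, fderiv_comp_add_left, add_zero]

section

variable {f : Cyl b → ℝ} (hf : ContDiff ℝ ∞ (f ∘ covering b)) (i : Fin 3)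
include hf

theorem hasDerivAt_cyl (x : Cyl b) : HasDerivAt (fun t => f (x + axisC b i t)) (p1 i f x) 0 := by
  obtain ⟨v, rfl⟩ := covering_surjective b x
  simp only [covering_add_axisC, p1_covering]
  exact hasDerivAt_line (hf.differentiable (by simp) v) _

theorem hasDerivAt_cyl_two (x : Cyl b) :
    HasDerivAt (fun t => p1 i f (x + axisC b i t)) (pd i f x) 0 := by
  obtain ⟨v, rfl⟩ := covering_surjective b x
  simp only [covering_add_axisC, p1_covering, pd_covering]
  exact hasDerivAt_line_two (hf.contDiffAt.of_le (by norm_cast)) i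

theorem continuous_of_smooth : Continuous f := continuous_iff_comp_covering.2 hf.continuous

theorem continuous_p1 : Continuous (p1 i f) := by
  rw [continuous_iff_comp_covering]
  have : p1 i f ∘ covering b = fun v => fderiv ℝ (f ∘ covering b) v (EuclideanSpace.single i 1) :=
    funext fun v => p1_covering i f v
  rw [this]
  exact continuous_fderiv_single hf _

theorem contDiff_pd : ContDiff ℝ ∞ (pd i f ∘ covering b) := by
  rw [pd_comp_covering]; exact contDiff_dd hf i

theorem continuous_pd : Continuous (pd i f) :=
  continuous_iff_comp_covering.2 (contDiff_pd hf i).continuous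

theorem support_p1_subset : Function.support (p1 i f) ⊆ tsupport f :=
  lineDeriv_support_subset (axisC b i) (continuous_axisC i) (hasDerivAt_cyl hf i)

theorem support_pd_subset : Function.support (pd i f) ⊆ tsupport f :=
  (lineDeriv_support_subset (axisC b i) (continuous_axisC i) (hasDerivAt_cyl_two hf i)).trans
    (closure_minimal (support_p1_subset hf i) (isClosed_tsupport f))

end

theorem integral_cyl_mul_pd {f g g₁ g₂ : Cyl b → ℝ} {i : Fin 3} (hg : Continuous g)
    (hg₁ : Continuous g₁) (hg₂ : Continuous g₂)
    (dg : ∀ x, HasDerivAt (fun t => g (x + axisC b i t)) (g₁ x) 0)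
    (dg₁ : ∀ x, HasDerivAt (fun t => g₁ (x + axisC b i t)) (g₂ x) 0)
    (hf : ContDiff ℝ ∞ (f ∘ covering b)) (cf : HasCompactSupport f) :
    ∫ x, g x * pd i f x ∂(cylMeasure b) = ∫ x, g₂ x * f x ∂(cylMeasure b) :=
  integral_mul_lineDeriv_two _ (axisC b i) (continuous_axisC i) hg hg₁ hg₂
    (continuous_of_smooth hf) (continuous_p1 hf i) (continuous_pd hf i) cf dg dg₁
    (hasDerivAt_cyl hf i) (hasDerivAt_cyl_two hf i)

/-- Smooth functions with compact support on the cylinder. -/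
structure IsTest (φ : Cyl b → ℝ) : Prop where
  smooth : ContDiff ℝ ∞ (φ ∘ covering b)
  compact : HasCompactSupport φ

theorem IsTestFunction.isTest {U : Set (Cyl b)} {φ : Cyl b → ℝ} (h : IsTestFunction b U φ) :
    IsTest φ := ⟨smooth_iff.1 h.1, h.2.1⟩

namespace IsTest

variable {φ ψ : Cyl b → ℝ}

theorem continuous (h : IsTest φ) : Continuous φ := continuous_of_smooth h.smooth

theorem pd (h : IsTest φ) (i : Fin 3) : IsTest (pd i φ) :=
  ⟨contDiff_pd h.smooth i, h.compact.mono' (support_pd_subset h.smooth i)⟩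

theorem add (h : IsTest φ) (h' : IsTest ψ) : IsTest (fun x => φ x + ψ x) :=
  ⟨h.smooth.add h'.smooth, h.compact.add h'.compact⟩

theorem neg (h : IsTest φ) : IsTest (fun x => -φ x) := ⟨h.smooth.neg, h.compact.neg⟩

theorem translate (h : IsTest φ) (a : Cyl b) : IsTest (fun x => φ (x + a)) := by
  obtain ⟨u, rfl⟩ := covering_surjective b a
  refine ⟨?_, h.compact.comp_homeomorph (Homeomorph.addRight _)⟩
  have : (fun x => φ (x + covering b u)) ∘ covering b = (φ ∘ covering b) ∘ fun v => v + u := by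
    funext v; simp [covering_add]
  rw [this]
  exact h.smooth.comp (by fun_prop)

theorem integrable (h : IsTest φ) : Integrable φ (cylMeasure b) :=
  h.continuous.integrable_of_hasCompactSupport h.compact

theorem integrable_mul (h : IsTest φ) {g : Cyl b → ℝ} (hg : Continuous g) :
    Integrable (fun x => g x * φ x) (cylMeasure b) :=
  (hg.mul h.continuous).integrable_of_hasCompactSupport h.compact.mul_left

end IsTest

theorem pd_translate (i : Fin 3) (φ : Cyl b → ℝ) (a x : Cyl b) :
    pd i (fun x => φ (x + a)) x = pd i φ (x + a) := by
  have : inCoords b (fun x => φ (x + a)) x = inCoords b φ (x + a) := by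
    funext v; simp only [inCoords]; rw [add_right_comm]
  rw [pd, pd, this]

/-- Minus the Laplacian. -/
def negLap (φ : Cyl b → ℝ) (x : Cyl b) : ℝ := -(pd 0 φ x + pd 1 φ x) + -pd 2 φ x

/-- Minus the Laplacian in the torus variable. -/
def negLapT (φ : Cyl b → ℝ) (x : Cyl b) : ℝ := -(pd 0 φ x + pd 1 φ x)

theorem neg_laplacian_eq (φ : Cyl b → ℝ) (x : Cyl b) : -laplacian b φ x = negLap φ x := by
  rw [laplacian_eq_sum_pd, Fin.sum_univ_three, negLap]; ring

theorem IsTest.negLap {φ : Cyl b → ℝ} (h : IsTest φ) : IsTest (negLap φ) :=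
  ((h.pd 0).add (h.pd 1)).neg.add (h.pd 2).neg

theorem IsTest.negLapT {φ : Cyl b → ℝ} (h : IsTest φ) : IsTest (negLapT φ) :=
  ((h.pd 0).add (h.pd 1)).neg

theorem negLap_support_subset {φ : Cyl b → ℝ} (h : IsTest φ) :
    Function.support (negLap φ) ⊆ tsupport φ := by
  intro x hx
  by_contra hn
  have h0 : ∀ i, pd i φ x = 0 := fun i => by
    by_contra hne
    exact hn (support_pd_subset h.smooth i hne)
  exact hx (by simp [negLap, h0])

theorem negLap_translate (φ : Cyl b → ℝ) (a x : Cyl b) :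
    negLap (fun x => φ (x + a)) x = negLap φ (x + a) := by
  simp only [negLap, pd_translate]

theorem negLapT_translate (φ : Cyl b → ℝ) (a x : Cyl b) :
    negLapT (fun x => φ (x + a)) x = negLapT φ (x + a) := by
  simp only [negLapT, pd_translate]

theorem hor_single (i : Fin 2) :
    hor (EuclideanSpace.single i.castSucc (1:ℝ)) = EuclideanSpace.single i 1 := by
  ext j
  fin_cases i <;> fin_cases j <;> simp [hor_apply]

theorem axisC_castSucc (i : Fin 2) (t : ℝ) : axisC b i.castSucc t = (axisT b i t, 0) := by
  change covering b (t • EuclideanSpace.single i.castSucc 1) = _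
  rw [covering_eq, map_smul, hor_single]
  refine Prod.ext rfl ?_
  fin_cases i <;> simp

theorem axisC_two (t : ℝ) : axisC b 2 t = (0, t) := by
  change covering b (t • EuclideanSpace.single 2 1) = _
  rw [covering_eq]
  refine Prod.ext ?_ (by simp)
  have : hor (t • EuclideanSpace.single 2 (1:ℝ)) = 0 := by
    ext j; fin_cases j <;> simp [hor_apply]
  rw [this]; rfl

/-- Horizontal translations fix the height, so w acts as a constant and continuity is enough. This
matters for w = exp(-μ|z|) and w = |z|, which have a kink at 0. -/
theorem integral_mode_mul_pd {e : Torus b → ℝ} {c : Fin 2 → ℝ} (he : IsMode e c)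
    {w : ℝ → ℝ} (hw : Continuous w) {φ : Cyl b → ℝ} (h : IsTest φ) (i : Fin 2) :
    ∫ x, w x.2 * e x.1 * pd i.castSucc φ x ∂(cylMeasure b) =
      -(c i) * ∫ x, w x.2 * e x.1 * φ x ∂(cylMeasure b) := by
  have hec : Continuous e := continuous_torus_iff.2 he.1.continuous
  have h1 := integral_cyl_mul_pd (i := i.castSucc) (g := fun x : Cyl b => w x.2 * e x.1)
    (g₁ := fun x => w x.2 * d1T i e x.1) (g₂ := fun x => w x.2 * ddT i e x.1)
    (by fun_prop) ((hw.comp continuous_snd).mul ((continuous_d1T he.1 i).comp continuous_fst))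
    ((hw.comp continuous_snd).mul ((continuous_ddT he.1 i).comp continuous_fst))
    (fun x => by
      simp only [axisC_castSucc, Prod.snd_add, Prod.fst_add, add_zero]
      exact (hasDerivAt_torus he.1 i x.1).const_mul _)
    (fun x => by
      simp only [axisC_castSucc, Prod.snd_add, Prod.fst_add, add_zero]
      exact (hasDerivAt_torus_two he.1 i x.1).const_mul _) h.smooth h.compact
  rw [h1, ← integral_const_mul]
  refine integral_congr_ae (Eventually.of_forall fun x => ?_)
  simp only [he.2]
  ring

theorem integral_mode_mul_negLapT {e : Torus b → ℝ} {c : Fin 2 → ℝ} (he : IsMode e c)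
    {w : ℝ → ℝ} (hw : Continuous w) {φ : Cyl b → ℝ} (h : IsTest φ) :
    ∫ x, w x.2 * e x.1 * negLapT φ x ∂(cylMeasure b) =
      (∑ i, c i) * ∫ x, w x.2 * e x.1 * φ x ∂(cylMeasure b) := by
  have hec : Continuous e := continuous_torus_iff.2 he.1.continuous
  have hg : Continuous fun x : Cyl b => w x.2 * e x.1 := by fun_prop
  have h0 := integral_mode_mul_pd he hw h 0
  have h1 := integral_mode_mul_pd he hw h 1
  have e1 : ∫ x, w x.2 * e x.1 * negLapT φ x ∂(cylMeasure b) =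
      -(∫ x, w x.2 * e x.1 * pd (Fin.castSucc 0) φ x ∂(cylMeasure b) +
        ∫ x, w x.2 * e x.1 * pd (Fin.castSucc 1) φ x ∂(cylMeasure b)) := by
    rw [← integral_add ((h.pd _).integrable_mul hg) ((h.pd _).integrable_mul hg), ← integral_neg]
    refine integral_congr_ae (Eventually.of_forall fun x => ?_)
    simp only [negLapT]
    change _ = -(w x.2 * e x.1 * pd 0 φ x + w x.2 * e x.1 * pd 1 φ x)
    ring
  rw [e1, h0, h1, Fin.sum_univ_two]
  ring

section Slice

variable {φ : Cyl b → ℝ} (h : IsTest φ) (q : Torus b)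
include h

theorem IsTest.hasDerivAt_slice (z : ℝ) : HasDerivAt (fun z => φ (q, z)) (p1 2 φ (q, z)) z := by
  have h1 := hasDerivAt_cyl h.smooth 2 (q, z)
  simp only [axisC_two, Prod.mk_add_mk, add_zero] at h1
  rw [← sub_self z] at h1
  simpa using h1.comp_sub_const z z

theorem IsTest.hasDerivAt_slice_two (z : ℝ) :
    HasDerivAt (fun z => p1 2 φ (q, z)) (FlatCylinder.pd 2 φ (q, z)) z := by
  have h1 := hasDerivAt_cyl_two h.smooth 2 (q, z)
  simp only [axisC_two, Prod.mk_add_mk, add_zero] at h1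
  rw [← sub_self z] at h1
  simpa using h1.comp_sub_const z z

theorem IsTest.slice_compact : HasCompactSupport fun z => φ (q, z) := by
  refine HasCompactSupport.of_support_subset_isCompact (h.compact.image continuous_snd)
    fun z hz => ⟨(q, z), subset_tsupport _ hz, rfl⟩

end Slice

theorem integral_cyl_eq {f : Cyl b → ℝ} (hf : Integrable f (cylMeasure b)) :
    ∫ x, f x ∂(cylMeasure b) = ∫ q, (∫ z, f (q, z)) ∂(torusMeasure b) := integral_prod f hf

/-- Integrating by parts on the torus turns the horizontal Laplacian into the factor μ². On each
vertical line the rest is the one-dimensional identity for exp(-μ|z|). -/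
theorem integral_mode_mul_negLap {e : Torus b → ℝ} {c : Fin 2 → ℝ} (he : IsMode e c)
    {μ : ℝ} (hμ : μ ^ 2 = ∑ i, c i) {φ : Cyl b → ℝ} (h : IsTest φ) :
    ∫ x, Real.exp (-μ * |x.2|) * e x.1 * negLap φ x ∂(cylMeasure b) =
      2 * μ * ∫ q, e q * φ (q, 0) ∂(torusMeasure b) := by
  have hec : Continuous e := continuous_torus_iff.2 he.1.continuous
  have hw : Continuous fun z : ℝ => Real.exp (-μ * |z|) := by fun_prop
  have hg : Continuous fun x : Cyl b => Real.exp (-μ * |x.2|) * e x.1 := by fun_prop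
  have h1 := integral_mode_mul_negLapT he hw h
  have i1 := h.negLapT.integrable_mul hg
  have i2 := (h.pd 2).neg.integrable_mul hg
  have i3 := h.integrable_mul hg
  have e1 : ∫ x, Real.exp (-μ * |x.2|) * e x.1 * negLap φ x ∂(cylMeasure b) =
      ∫ x, Real.exp (-μ * |x.2|) * e x.1 * negLapT φ x ∂(cylMeasure b) +
      ∫ x, Real.exp (-μ * |x.2|) * e x.1 * -pd 2 φ x ∂(cylMeasure b) := by
    rw [← integral_add i1 i2]
    refine integral_congr_ae (Eventually.of_forall fun x => ?_)
    simp only [negLap, negLapT]; ring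
  rw [e1, h1, ← hμ, ← integral_const_mul, ← integral_add (i3.const_mul _) i2]
  refine (integral_cyl_eq ((i3.const_mul (μ ^ 2)).add i2)).trans ?_
  rw [← integral_const_mul]
  refine integral_congr_ae (Eventually.of_forall fun q => ?_)
  have h2 := integral_exp_mul_helmholtz (h.hasDerivAt_slice q) (h.hasDerivAt_slice_two q)
    ((h.pd 2).continuous.comp (by fun_prop : Continuous fun z : ℝ => (q, z))) (h.slice_compact q) μ
  simp only
  rw [← mul_assoc, mul_comm _ (e q), mul_assoc, ← h2, ← integral_const_mul]
  refine integral_congr_ae (Eventually.of_forall fun z => ?_)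
  simp only [Pi.add_apply]
  ring

theorem isMode_one : IsMode (fun _ : Torus b => (1:ℝ)) 0 := by
  refine ⟨contDiff_const, fun i q => ?_⟩
  obtain ⟨v, rfl⟩ := QuotientAddGroup.mk_surjective q
  rw [ddT_mk]
  simp [dd, iteratedFDeriv_const_of_ne]

theorem integral_height_mul_negLap {w : ℝ → ℝ} (hw : Continuous w) {φ : Cyl b → ℝ}
    (h : IsTest φ) :
    ∫ x, w x.2 * negLap φ x ∂(cylMeasure b) =
      -∫ q, (∫ z, w z * pd 2 φ (q, z)) ∂(torusMeasure b) := by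
  have h1 := integral_mode_mul_negLapT isMode_one hw h
  simp only [mul_one, Pi.zero_apply, Finset.sum_const_zero, zero_mul] at h1
  have hg : Continuous fun x : Cyl b => w x.2 := by fun_prop
  have i1 := h.negLapT.integrable_mul hg
  have i2 := (h.pd 2).integrable_mul hg
  rw [← integral_cyl_eq i2, ← sub_eq_zero, sub_neg_eq_add, ← h1, ← integral_add _ i2]
  · refine integral_congr_ae (Eventually.of_forall fun x => ?_)
    simp only [negLap, negLapT]; ring
  · exact h.negLap.integrable_mul hg

theorem integral_abs_height_mul_negLap {φ : Cyl b → ℝ} (h : IsTest φ) :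
    ∫ x, |x.2| * negLap φ x ∂(cylMeasure b) = -(2 * ∫ q, φ (q, 0) ∂(torusMeasure b)) := by
  rw [integral_height_mul_negLap continuous_abs h, ← integral_const_mul]
  congr 1
  refine integral_congr_ae (Eventually.of_forall fun q => ?_)
  exact integral_abs_mul_second_deriv (h.hasDerivAt_slice q) (h.hasDerivAt_slice_two q)
    ((h.pd 2).continuous.comp (by fun_prop : Continuous fun z : ℝ => (q, z))) (h.slice_compact q)

/-- Affine functions of the height are weakly harmonic. -/
theorem integral_affine_mul_negLap (κ β : ℝ) {φ : Cyl b → ℝ} (h : IsTest φ) :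
    ∫ x, (κ * x.2 + β) * negLap φ x ∂(cylMeasure b) = 0 := by
  rw [integral_height_mul_negLap (w := fun z => κ * z + β) (by fun_prop) h]
  have h2 : ∀ q, ∫ z, (κ * z + β) * pd 2 φ (q, z) = 0 := by
    intro q
    have h3 := h.slice_compact q
    have h4 : HasCompactSupport fun z => p1 2 φ (q, z) := by
      have : deriv (fun z => φ (q, z)) = fun z => p1 2 φ (q, z) :=
        funext fun z => (h.hasDerivAt_slice q z).deriv
      exact this ▸ h3.deriv
    have hd : ∀ z, HasDerivAt (fun z => (κ * z + β) * p1 2 φ (q, z) - κ * φ (q, z))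
        ((κ * z + β) * pd 2 φ (q, z)) z := by
      intro z
      have h5 : HasDerivAt (fun z : ℝ => κ * z + β) κ z := by
        simpa using ((hasDerivAt_id z).const_mul κ).add_const β
      convert! (h5.mul (h.hasDerivAt_slice_two q z)).sub ((h.hasDerivAt_slice q z).const_mul κ) using 1
      ring
    have hc : HasCompactSupport fun z => (κ * z + β) * p1 2 φ (q, z) - κ * φ (q, z) :=
      h4.mul_left.sub h3.mul_left
    refine integral_eq_zero_of_hasDerivAt_of_integrable hd ?_ ?_
    · have c1 : Continuous fun z => pd 2 φ (q, z) :=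
        (h.pd 2).continuous.comp (by fun_prop : Continuous fun z : ℝ => (q, z))
      exact (by fun_prop : Continuous fun z => (κ * z + β) * pd 2 φ (q, z)
        ).integrable_of_hasCompactSupport ((h.pd 2).slice_compact q).mul_left
    · have c1 : Continuous fun z => φ (q, z) :=
        h.continuous.comp (by fun_prop : Continuous fun z : ℝ => (q, z))
      have c2 : Continuous fun z => p1 2 φ (q, z) :=
        (continuous_p1 h.smooth 2).comp (by fun_prop : Continuous fun z : ℝ => (q, z))
      exact (((by fun_prop : Continuous fun z : ℝ => κ * z + β).mul c2).sub (continuous_const.mul c1)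
        ).integrable_of_hasCompactSupport hc
  simp [h2]

end FlatCylinder

end

/-! ### The absolutely convergent kernel and the representation of test functions. -/

noncomputable section

namespace FlatCylinder

variable (b : Module.Basis (Fin 2) ℝ Plane)

/-- The Fourier coefficients of the oscillating part of the kernel. -/
def kernelCoeff (k : Fin 2 → ℤ) : ℝ := (area b * (lam b k * (2 * √(lam b k))))⁻¹

/-- As `lam b 0 = 0` and 0⁻¹ = 0, the zero mode is absent from the kernel; the term -|z|/(2 area)
accounts for it separately. -/
theorem kernelCoeff_zero : kernelCoeff b 0 = 0 := by simp [kernelCoeff, lam_zero]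

theorem kernelCoeff_nonneg (k : Fin 2 → ℤ) : 0 ≤ kernelCoeff b k := by
  have := area_pos b
  have := lam_nonneg b k
  unfold kernelCoeff
  positivity

/-- The coefficients are O(‖k‖⁻³), which is summable over ℤ². Without the extra division by lam they
would only be O(‖k‖⁻¹). -/
theorem summable_kernelCoeff : Summable (kernelCoeff b) := by
  obtain ⟨c, hc, h⟩ := exists_lam_ge b
  have hA := area_pos b
  have hs : Summable fun k : Fin 2 → ℤ => ‖k‖ ^ (-3 : ℝ) :=
    EisensteinSeries.summable_one_div_norm_rpow (by norm_num)
  refine Summable.of_nonneg_of_le (kernelCoeff_nonneg b) (fun k => ?_)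
    (hs.mul_left (area b * (c * (2 * √c)))⁻¹)
  by_cases hk : k = 0
  · subst hk
    rw [kernelCoeff_zero]; positivity
  · have h1 := one_le_norm_of_ne_zero hk
    have hn : 0 < ‖k‖ := by linarith
    have h2 : √c * ‖k‖ ≤ √(lam b k) := by
      rw [← Real.sqrt_sq hn.le, ← Real.sqrt_mul hc.le]
      exact Real.sqrt_le_sqrt (h k)
    have h3 : ‖k‖ ^ (-3 : ℝ) = (‖k‖ ^ 3)⁻¹ := by
      rw [Real.rpow_neg hn.le]; norm_cast
    have hsc := Real.sqrt_pos.2 hc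
    rw [h3, kernelCoeff, ← mul_inv]
    refine inv_anti₀ (by positivity) ?_
    calc area b * (c * (2 * √c)) * ‖k‖ ^ 3 = area b * ((c * ‖k‖ ^ 2) * (2 * (√c * ‖k‖))) := by ring
      _ ≤ _ := by
        have := h k
        have := lam_nonneg b k
        gcongr

/-- The terms of the oscillating part of the kernel. -/
def kernelTerm (k : Fin 2 → ℤ) (x : Cyl b) : ℝ :=
  kernelCoeff b k * (Real.exp (-√(lam b k) * |x.2|) * cosT b k x.1)

/-- The oscillating part of the kernel solving `(-Δ) (-Δ_T) K = δ` modulo functions of the height. -/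
def kernelOsc (x : Cyl b) : ℝ := ∑' k, kernelTerm b k x

theorem abs_exp_mul_le {μ : ℝ} (hμ : 0 ≤ μ) (z : ℝ) {e : ℝ} (he : |e| ≤ 1) :
    |Real.exp (-μ * |z|) * e| ≤ 1 := by
  rw [abs_mul, abs_of_pos (Real.exp_pos _)]
  have h1 : Real.exp (-μ * |z|) ≤ 1 :=
    Real.exp_le_one_iff.2 (by nlinarith [abs_nonneg z])
  exact mul_le_one₀ h1 (abs_nonneg _) he

theorem norm_kernelTerm_le (k : Fin 2 → ℤ) (x : Cyl b) : ‖kernelTerm b k x‖ ≤ kernelCoeff b k := by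
  rw [kernelTerm, norm_mul, Real.norm_of_nonneg (kernelCoeff_nonneg b k)]
  exact mul_le_of_le_one_right (kernelCoeff_nonneg b k)
    (abs_exp_mul_le (Real.sqrt_nonneg _) _ (abs_cosT_le b k _))

theorem continuous_kernelTerm (k : Fin 2 → ℤ) : Continuous (kernelTerm b k) := by
  have := continuous_cosT b k
  unfold kernelTerm
  fun_prop

theorem continuous_kernelOsc : Continuous (kernelOsc b) :=
  continuous_tsum (continuous_kernelTerm b) (summable_kernelCoeff b) (norm_kernelTerm_le b)

/-- Every nonzero mode decays at least as fast as the first eigenvalue dictates, and the zero mode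
is absent. -/
theorem abs_kernelOsc_le (x : Cyl b) :
    |kernelOsc b x| ≤ (∑' k, kernelCoeff b k) * Real.exp (-√(lamOne b) * |x.2|) := by
  rw [← tsum_mul_right, ← Real.norm_eq_abs]
  refine tsum_of_norm_bounded ((summable_kernelCoeff b).mul_right _).hasSum fun k => ?_
  rw [kernelTerm, norm_mul, Real.norm_of_nonneg (kernelCoeff_nonneg b k)]
  by_cases hk : k = 0
  · subst hk; simp [kernelCoeff_zero]
  refine mul_le_mul_of_nonneg_left ?_ (kernelCoeff_nonneg b k)
  rw [Real.norm_eq_abs, abs_mul, abs_of_pos (Real.exp_pos _)]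
  refine (mul_le_of_le_one_right (Real.exp_pos _).le (abs_cosT_le b k _)).trans ?_
  refine Real.exp_le_exp.2 ?_
  have := Real.sqrt_le_sqrt (lamOne_le b hk)
  nlinarith [abs_nonneg x.2]

theorem kernelOsc_eq_of_abs_eq {q : Torus b} {z z' : ℝ} (h : |z| = |z'|) :
    kernelOsc b (q, z) = kernelOsc b (q, z') := by
  simp only [kernelOsc, kernelTerm, h]

variable {b}

/-- The torus Laplacian contributes lam and the vertical identity contributes 2√lam; `kernelCoeff`
is chosen to cancel both and leave the factor 1/area of a Fourier coefficient. -/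
theorem kernelCoeff_mul_integral {e : Torus b → ℝ} {k : Fin 2 → ℤ} (hk : k ≠ 0)
    (he : IsMode e (freq b k)) {φ : Cyl b → ℝ} (h : IsTest φ) :
    kernelCoeff b k * ∫ x, Real.exp (-√(lam b k) * |x.2|) * e x.1 * negLapT (negLap φ) x
      ∂(cylMeasure b) = (area b)⁻¹ * ∫ q, e q * φ (q, 0) ∂(torusMeasure b) := by
  have hA := (area_pos b).ne'
  have hl := lam_pos b hk
  have hs := (Real.sqrt_pos.2 hl).ne'
  rw [integral_mode_mul_negLapT he (w := fun z => Real.exp (-√(lam b k) * |z|)) (by fun_prop)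
    h.negLap, integral_mode_mul_negLap he (μ := √(lam b k)) (Real.sq_sqrt hl.le) h]
  change kernelCoeff b k * (lam b k * _) = _
  rw [kernelCoeff]
  have := hl.ne'
  field_simp

theorem abs_integral_mode_le {e : Torus b → ℝ} (hec : Continuous e) (he1 : ∀ q, |e q| ≤ 1)
    {μ : ℝ} (hμ : 0 ≤ μ) {ψ : Cyl b → ℝ} (h : IsTest ψ) :
    ∫ x, ‖Real.exp (-μ * |x.2|) * e x.1 * ψ x‖ ∂(cylMeasure b) ≤ ∫ x, |ψ x| ∂(cylMeasure b) := by
  have hg : Continuous fun x : Cyl b => Real.exp (-μ * |x.2|) * e x.1 := by fun_prop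
  refine integral_mono (h.integrable_mul hg).norm h.integrable.norm fun x => ?_
  simp only
  rw [norm_mul]
  exact mul_le_of_le_one_left (norm_nonneg _) (abs_exp_mul_le hμ _ (he1 _))

/-- The previous identity read backwards bounds the Fourier coefficient at height 0 by `kernelCoeff`
times a fixed L¹ norm. -/
theorem summable_fourier_of_test {e : (Fin 2 → ℤ) → Torus b → ℝ}
    (he1 : ∀ k q, |e k q| ≤ 1) (he : ∀ k, IsMode (e k) (freq b k)) {φ : Cyl b → ℝ} (h : IsTest φ) :
    Summable fun k => ∫ q, e k q * φ (q, 0) ∂(torusMeasure b) := by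
  have hA := area_pos b
  set C := ∫ x, |negLapT (negLap φ) x| ∂(cylMeasure b)
  refine Summable.of_norm_bounded_eventually
    ((summable_kernelCoeff b).mul_right (area b * C)) ?_
  have : ({0} : Set (Fin 2 → ℤ))ᶜ ∈ cofinite := (finite_singleton 0).compl_mem_cofinite
  filter_upwards [this] with k hk
  have h1 := kernelCoeff_mul_integral hk (he k) h
  have h2 : ∫ q, e k q * φ (q, 0) ∂(torusMeasure b) = area b * (kernelCoeff b k *
      ∫ x, Real.exp (-√(lam b k) * |x.2|) * e k x.1 * negLapT (negLap φ) x ∂(cylMeasure b)) := by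
    rw [h1, ← mul_assoc, mul_inv_cancel₀ hA.ne', one_mul]
  rw [h2, norm_mul, norm_mul, Real.norm_of_nonneg hA.le,
    Real.norm_of_nonneg (kernelCoeff_nonneg b k), mul_left_comm]
  refine mul_le_mul_of_nonneg_left (mul_le_mul_of_nonneg_left ?_ hA.le) (kernelCoeff_nonneg b k)
  exact (norm_integral_le_integral_norm _).trans (abs_integral_mode_le
    (continuous_torus_iff.2 (he k).1.continuous) (he1 k) (Real.sqrt_nonneg _) h.negLap.negLapT)

/-- The kernel represents test functions. -/
theorem test_representation {φ : Cyl b → ℝ} (h : IsTest φ) :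
    ∫ x, -(|x.2| / (2 * area b)) * negLap φ x ∂(cylMeasure b) +
      ∫ x, kernelOsc b x * negLapT (negLap φ) x ∂(cylMeasure b) = φ 0 := by
  have hA := area_pos b
  set ψ := negLapT (negLap φ) with hψ
  have tψ : IsTest ψ := h.negLap.negLapT
  have hcont : Continuous fun q : Torus b => φ (q, 0) :=
    h.continuous.comp (by fun_prop)
  have hF := hasSum_fourier_zero hcont
    (summable_fourier_of_test (abs_cosT_le b) (isMode_cosT b) h)
    (summable_fourier_of_test (abs_sinT_le b) (isMode_sinT b) h)
  have hK : HasSum (fun k => ∫ x, kernelTerm b k x * ψ x ∂(cylMeasure b))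
      (∫ x, kernelOsc b x * ψ x ∂(cylMeasure b)) := by
    have h1 := hasSum_integral_of_summable_integral_norm (μ := cylMeasure b)
      (F := fun k x => kernelTerm b k x * ψ x)
      (fun k => tψ.integrable_mul (continuous_kernelTerm b k))
      (Summable.of_nonneg_of_le (fun k => integral_nonneg fun x => norm_nonneg _) (fun k => ?_)
        ((summable_kernelCoeff b).mul_right (∫ x, |ψ x| ∂(cylMeasure b))))
    · simp only [tsum_mul_right] at h1
      exact h1
    · rw [← integral_const_mul]
      refine integral_mono (tψ.integrable_mul (continuous_kernelTerm b k)).norm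
        (tψ.integrable.norm.const_mul _) fun x => ?_
      simp only
      rw [norm_mul]
      exact mul_le_mul_of_nonneg_right (norm_kernelTerm_le b k x) (norm_nonneg _)
  -- Each nonzero mode reproduces one term of the Fourier series of φ(·, 0) at the origin; the zero
  -- mode gives nothing.
  have hterm : ∀ k, ∫ x, kernelTerm b k x * ψ x ∂(cylMeasure b) =
      if k = 0 then 0 else (area b)⁻¹ * ∫ q, cosT b k q * φ (q, 0) ∂(torusMeasure b) := by
    intro k
    split_ifs with hk
    · subst hk; simp [kernelTerm, kernelCoeff_zero]
    · rw [← kernelCoeff_mul_integral hk (isMode_cosT b k) h, ← integral_const_mul]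
      refine integral_congr_ae (Eventually.of_forall fun x => ?_)
      simp only [kernelTerm]; ring
  simp only [hterm] at hK
  -- Restoring the zero mode completes the Fourier series, whose sum is φ 0. The restored term, the
  -- mean of φ(·, 0), is what the kernel -|z|/(2 area) yields.
  have h0 := (hasSum_ite_eq (0 : Fin 2 → ℤ)
    ((area b)⁻¹ * ∫ q, cosT b 0 q * φ (q, 0) ∂(torusMeasure b))).add hK
  have h1 := h0.unique (hF.congr_fun fun k => ?_)
  · change _ = φ (0, 0)
    rw [← h1]
    congr 1
    have h2 := integral_abs_height_mul_negLap h
    have h3 : ∫ x, -(|x.2| / (2 * area b)) * negLap φ x ∂(cylMeasure b) =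
        -(2 * area b)⁻¹ * ∫ x, |x.2| * negLap φ x ∂(cylMeasure b) := by
      rw [← integral_const_mul]
      refine integral_congr_ae (Eventually.of_forall fun x => ?_)
      simp only; ring
    rw [h3, h2]
    simp only [cosT_zero, one_mul]
    field_simp
  · by_cases hk : k = 0
    · subst hk; simp
    · simp [hk]

end FlatCylinder

end

/-! ### Decay of convolutions, and lifting the singular part to the cylinder. -/

noncomputable section

namespace FlatCylinder

open scoped Pointwise

section Convolution

open scoped Convolution

variable {E : Type} [NormedAddCommGroup E] [NormedSpace ℝ E]

/-- Shifting by u costs at most a factor exp(a|u 2|), which is bounded on the compact support of g.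
-/
theorem norm_convolution_le_exp {f : Cover → ℝ} {g : Cover → E} {a C : ℝ} (ha : 0 ≤ a)
    (hf : ∀ v, |f v| ≤ C * Real.exp (-a * |v 2|)) (hg : Continuous g) (cg : HasCompactSupport g) :
    ∃ C', ∀ v, ‖(f ⋆[ContinuousLinearMap.lsmul ℝ ℝ, volume] g) v‖ ≤
      C' * Real.exp (-a * |v 2|) := by
  have hC : 0 ≤ C := by
    have := (abs_nonneg _).trans (hf 0)
    simpa using this
  refine ⟨∫ u : Cover, C * Real.exp (a * |u 2|) * ‖g u‖, fun v => ?_⟩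
  rw [convolution_lsmul_swap, ← integral_mul_const]
  refine norm_integral_le_of_norm_le ?_ (Eventually.of_forall fun u => ?_)
  · exact ((by fun_prop : Continuous fun u : Cover => C * Real.exp (a * |u 2|) * ‖g u‖
      ).integrable_of_hasCompactSupport cg.norm.mul_left).mul_const _
  · rw [norm_smul, Real.norm_eq_abs]
    have h1 : |f (v - u)| ≤ C * Real.exp (a * |u 2|) * Real.exp (-a * |v 2|) := by
      refine (hf _).trans ?_
      rw [mul_assoc, ← Real.exp_add]
      refine mul_le_mul_of_nonneg_left (Real.exp_le_exp.2 ?_) hC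
      have h2 : |v 2| ≤ |(v - u) 2| + |u 2| := by
        have := abs_add_le ((v - u) 2) (u 2)
        simpa using this
      nlinarith
    calc _ ≤ C * Real.exp (a * |u 2|) * Real.exp (-a * |v 2|) * ‖g u‖ :=
          mul_le_mul_of_nonneg_right h1 (norm_nonneg _)
      _ = _ := by ring

/-- Derivatives of the convolution fall on g, so f need only be continuous. The target space varies
in the induction because g is replaced by its derivative, whose values lie in another space. -/
theorem norm_iteratedFDeriv_convolution_le_exp {f : Cover → ℝ} {a C : ℝ} (ha : 0 ≤ a)
    (hfc : Continuous f) (hf : ∀ v, |f v| ≤ C * Real.exp (-a * |v 2|)) (k : ℕ) :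
    ∀ {E : Type} [NormedAddCommGroup E] [NormedSpace ℝ E] {g : Cover → E},
      ContDiff ℝ ∞ g → HasCompactSupport g →
      ∃ C', ∀ v, ‖iteratedFDeriv ℝ k (f ⋆[ContinuousLinearMap.lsmul ℝ ℝ, volume] g) v‖ ≤
        C' * Real.exp (-a * |v 2|) := by
  induction k with
  | zero =>
    intro E _ _ g hg cg
    simpa only [norm_iteratedFDeriv_zero] using norm_convolution_le_exp ha hf hg.continuous cg
  | succ k ih =>
    intro E _ _ g hg cg
    obtain ⟨C', hC'⟩ := ih (g := fderiv ℝ g)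
      (hg.fderiv_right (m := ∞) (by norm_cast)) (cg.fderiv ℝ)
    refine ⟨C', fun v => ?_⟩
    rw [← norm_iteratedFDeriv_fderiv]
    have h1 : fderiv ℝ (f ⋆[ContinuousLinearMap.lsmul ℝ ℝ, volume] g) =
        f ⋆[ContinuousLinearMap.lsmul ℝ ℝ, volume] fderiv ℝ g := by
      funext w
      have h2 := (cg.hasFDerivAt_convolution_right (ContinuousLinearMap.lsmul ℝ ℝ)
        hfc.locallyIntegrable (hg.of_le (by norm_cast)) w (μ := volume)).fderiv
      rw [h2]
      rfl
    rw [h1]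
    exact hC' v

end Convolution

variable {b : Module.Basis (Fin 2) ℝ Plane}

section Fubini

variable {K : Cyl b → ℝ} {g : Cover → ℝ} {ψ : Cyl b → ℝ} (hK : Continuous K) (hg : Continuous g)
  (cg : HasCompactSupport g) (hψ : Continuous ψ) (cψ : HasCompactSupport ψ)
include hK hg cg hψ cψ

/-- Fubini and translation invariance move the convolution with g from the kernel to the test
function; the companion lemma then puts it entirely on the test function. -/
theorem integral_smear_mul_eq_left :
    ∫ x, (∫ u, K (x - covering b u) * g u) * ψ x ∂(cylMeasure b) =
      ∫ u, g u * ∫ x, K x * ψ (x + covering b u) ∂(cylMeasure b) := by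
  have hcov := continuous_covering b
  have hc : Continuous (Function.uncurry fun (x : Cyl b) (u : Cover) =>
      K (x - covering b u) * g u * ψ x) := by
    simp only [Function.uncurry_def]; fun_prop
  have hs : HasCompactSupport (Function.uncurry fun (x : Cyl b) (u : Cover) =>
      K (x - covering b u) * g u * ψ x) := by
    refine HasCompactSupport.of_support_subset_isCompact (cψ.isCompact.prod cg.isCompact) ?_
    rintro ⟨x, u⟩ hxu
    simp only [Function.mem_support, Function.uncurry_apply_pair] at hxu
    exact ⟨subset_tsupport _ (right_ne_zero_of_mul hxu),
      subset_tsupport _ (right_ne_zero_of_mul (left_ne_zero_of_mul hxu))⟩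
  have h := integral_integral_swap_of_hasCompactSupport hc hs (μ := cylMeasure b) (ν := volume)
  simp only [integral_mul_const] at h
  rw [h]
  refine integral_congr_ae (Eventually.of_forall fun u => ?_)
  simp only
  rw [← integral_const_mul, ← integral_add_right_eq_self (μ := cylMeasure b) _ (covering b u)]
  refine integral_congr_ae (Eventually.of_forall fun x => ?_)
  simp only [add_sub_cancel_right]
  ring

theorem integral_smear_mul_eq_right :
    ∫ u, g u * ∫ x, K x * ψ (x + covering b u) ∂(cylMeasure b) =
      ∫ x, K x * (∫ u, g u * ψ (x + covering b u)) ∂(cylMeasure b) := by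
  have hcov := continuous_covering b
  have hc : Continuous (Function.uncurry fun (u : Cover) (x : Cyl b) =>
      g u * (K x * ψ (x + covering b u))) := by
    simp only [Function.uncurry_def]; fun_prop
  have hs : HasCompactSupport (Function.uncurry fun (u : Cover) (x : Cyl b) =>
      g u * (K x * ψ (x + covering b u))) := by
    refine HasCompactSupport.of_support_subset_isCompact
      ((cg.isCompact.prod cψ.isCompact).image (f := fun p : Cover × Cyl b =>
        (p.1, p.2 - covering b p.1)) (by fun_prop)) ?_
    rintro ⟨u, x⟩ hxu
    simp only [Function.mem_support, Function.uncurry_apply_pair] at hxu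
    exact ⟨(u, x + covering b u), ⟨subset_tsupport _ (left_ne_zero_of_mul hxu),
      subset_tsupport _ (right_ne_zero_of_mul (right_ne_zero_of_mul hxu))⟩, by simp⟩
  have h := integral_integral_swap_of_hasCompactSupport hc hs (μ := volume) (ν := cylMeasure b)
  simp only [integral_const_mul] at h
  rw [h]
  refine integral_congr_ae (Eventually.of_forall fun x => ?_)
  simp only
  rw [← integral_const_mul]
  refine integral_congr_ae (Eventually.of_forall fun u => ?_)
  simp only
  ring

end Fubini

section CenteredLift

variable (b)

/-- Minus half the diagonal of the fundamental parallelogram. -/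
def centerShift : Plane := -(2⁻¹ : ℝ) • ∑ i, b i

theorem repr_centerShift (i : Fin 2) : b.repr (centerShift b) i = -2⁻¹ := by
  simp [centerShift, Finsupp.single_apply]
  fin_cases i <;> simp

/-- The representative of a torus point in the centred fundamental parallelogram. -/
def centeredLift (q : Torus b) : Plane :=
  centerShift b + ZSpan.fract b (Quotient.out q - centerShift b)

theorem mk_centeredLift (q : Torus b) : (QuotientAddGroup.mk (centeredLift b q) : Torus b) = q := by
  conv_rhs => rw [← QuotientAddGroup.out_eq' q]
  refine QuotientAddGroup.eq.2 ?_
  rw [centeredLift, ZSpan.fract_apply]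
  have : -(centerShift b + (Quotient.out q - centerShift b -
      (ZSpan.floor b (Quotient.out q - centerShift b) : Plane))) + Quotient.out q =
      (ZSpan.floor b (Quotient.out q - centerShift b) : Plane) := by abel
  rw [this]
  exact (ZSpan.floor b _).2

theorem centeredLift_mk {w : Plane} (hw : ∀ i, |b.repr w i| < 2⁻¹) :
    centeredLift b (QuotientAddGroup.mk w) = w := by
  set w' := Quotient.out (QuotientAddGroup.mk w : Torus b) with hw'
  have h0 : (QuotientAddGroup.mk w' : Torus b) = QuotientAddGroup.mk w := QuotientAddGroup.out_eq' _
  have h1 : ZSpan.fract b (w' - centerShift b) = ZSpan.fract b (w - centerShift b) := by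
    rw [ZSpan.fract_eq_fract]
    have := QuotientAddGroup.eq.1 h0
    have h2 : -(w' - centerShift b) + (w - centerShift b) = -w' + w := by abel
    rw [h2]
    exact this
  rw [centeredLift, ← hw', h1, ZSpan.fract_eq_self.2, add_sub_cancel]
  rw [ZSpan.mem_fundamentalDomain]
  intro i
  rw [map_sub, Finsupp.sub_apply, repr_centerShift]
  have := abs_lt.1 (hw i)
  constructor <;> linarith [this.1, this.2]

theorem mem_centered_iff (w : Plane) : w ∈ centerShift b +ᵥ ZSpan.fundamentalDomain b ↔
    ∀ i, b.repr w i ∈ Ico (-2⁻¹ : ℝ) 2⁻¹ := by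
  rw [mem_vadd_set_iff_neg_vadd_mem, ZSpan.mem_fundamentalDomain]
  refine forall_congr' fun i => ?_
  rw [vadd_eq_add, map_add, map_neg, Finsupp.add_apply, Finsupp.neg_apply, repr_centerShift]
  constructor <;> rintro ⟨h1, h2⟩ <;> constructor <;> linarith

theorem exists_radius : ∃ r : ℝ, 0 < r ∧ ∀ w : Plane, ‖w‖ < r → ∀ i, |b.repr w i| < 2⁻¹ := by
  have h : ∀ᶠ w : Plane in 𝓝 0, ∀ i, |b.repr w i| < 2⁻¹ := by
    refine eventually_all.2 fun i => ?_
    have hc : Continuous fun w : Plane => |b.repr w i| :=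
      (LinearMap.toContinuousLinearMap (b.coord i)).continuous.abs
    have : (fun w : Plane => |b.repr w i|) 0 < 2⁻¹ := by simp
    exact hc.continuousAt.eventually (gt_mem_nhds this)
  obtain ⟨r, hr, hball⟩ := Metric.eventually_nhds_iff.1 h
  exact ⟨r, hr, fun w hw => hball (by simpa using hw)⟩

/-- A radius below which the covering is injective on balls. -/
def injRadius : ℝ := (exists_radius b).choose

theorem injRadius_pos : 0 < injRadius b := (exists_radius b).choose_spec.1

variable {b}

theorem abs_repr_lt {w : Plane} (hw : ‖w‖ < injRadius b) (i : Fin 2) : |b.repr w i| < 2⁻¹ :=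
  (exists_radius b).choose_spec.2 w hw i

theorem norm_hor_le (v : Cover) : ‖hor v‖ ≤ ‖v‖ := by
  rw [EuclideanSpace.norm_eq, EuclideanSpace.norm_eq]
  refine Real.sqrt_le_sqrt ?_
  rw [Fin.sum_univ_two, Fin.sum_univ_three]
  simp [hor_apply]
  positivity

theorem abs_height_le_norm (v : Cover) : |v 2| ≤ ‖v‖ := by
  simpa using PiLp.norm_apply_le v 2

/-- The lift of a point of the cylinder to the centred fundamental prism. -/
def centeredLiftC (x : Cyl b) : Cover := joinHeight (centeredLift b x.1) x.2

theorem covering_centeredLiftC (x : Cyl b) : covering b (centeredLiftC x) = x := by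
  rw [centeredLiftC, covering_joinHeight, mk_centeredLift]

theorem centeredLiftC_covering {v : Cover} (hv : ‖v‖ < injRadius b) :
    centeredLiftC (covering b v) = v := by
  rw [centeredLiftC, covering_eq, centeredLift_mk b (abs_repr_lt ((norm_hor_le v).trans_lt hv)),
    joinHeight_hor]

end CenteredLift

section SingularPart

variable {r : ℝ} (hr : 0 < r)

/-- The singular part of the Newton kernel as a function on the cylinder. -/
def singularC (x : Cyl b) : ℝ := singularPart hr (centeredLiftC x)

theorem singularC_covering {v : Cover} (hv : ‖v‖ < injRadius b) :
    singularC hr (covering b v) = singularPart hr v := by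
  rw [singularC, centeredLiftC_covering hv]

theorem singularC_eq_zero {x : Cyl b} (hx : x ∉ covering b '' Metric.closedBall 0 (r / 2)) :
    singularC hr x = 0 := by
  refine singularPart_eq_zero hr ?_
  by_contra! h
  exact hx ⟨centeredLiftC x, by simpa using h.le, covering_centeredLiftC x⟩

theorem singularC_eventually_zero {x : Cyl b}
    (hx : x ∉ covering b '' Metric.closedBall 0 (r / 2)) :
    ∀ᶠ y in 𝓝 x, singularC hr y = 0 := by
  have hc : IsClosed (covering b '' Metric.closedBall 0 (r / 2)) :=
    ((isCompact_closedBall _ _).image (continuous_covering b)).isClosed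
  filter_upwards [hc.isOpen_compl.mem_nhds hx] with y hy using singularC_eq_zero hr hy

theorem notMem_image_of_height {x : Cyl b} (hx : r / 2 < |x.2|) :
    x ∉ covering b '' Metric.closedBall 0 (r / 2) := by
  rintro ⟨v, hv, rfl⟩
  rw [mem_closedBall_zero_iff] at hv
  exact absurd ((abs_height_le_norm v).trans hv) (not_le.2 hx)

variable (hrb : r ≤ injRadius b)
include hrb

/-- On the image of the ball of radius `injRadius b` the centred lift inverts the covering and the
function is `singularPart`; off the image of the closed ball of radius r/2 it vanishes. These open
sets cover the cylinder. -/
theorem smoothAt_singularC {x : Cyl b} (hx : x ≠ 0) : SmoothAt b (singularC hr) x := by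
  by_cases h : x ∈ covering b '' Metric.closedBall 0 (r / 2)
  · obtain ⟨v, hv, rfl⟩ := h
    rw [smoothAt_covering]
    have hv0 : v ≠ 0 := by
      rintro rfl; exact hx (covering_zero b)
    have hvr : ‖v‖ < injRadius b := by
      rw [mem_closedBall_zero_iff] at hv; linarith
    refine (contDiffAt_singularPart hr hv0).congr_of_eventuallyEq ?_
    filter_upwards [(continuous_norm.continuousAt (x := v)).eventually (gt_mem_nhds hvr)] with w hw
      using singularC_covering hr hw
  · obtain ⟨v, rfl⟩ := covering_surjective b x
    rw [smoothAt_covering]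
    exact contDiffAt_const.congr_of_eventuallyEq
      ((continuous_covering b).continuousAt.eventually (singularC_eventually_zero hr h))

theorem continuousAt_singularC {x : Cyl b} (hx : x ≠ 0) : ContinuousAt (singularC hr) x := by
  have h := smoothAt_singularC hr hrb hx
  obtain ⟨v, rfl⟩ := covering_surjective b x
  rw [continuousAt_iff_comp_covering]
  exact (smoothAt_covering.1 h).continuousAt

theorem measurable_singularC : Measurable (singularC hr : Cyl b → ℝ) := by
  refine measurable_of_continuousOn_compl_singleton 0 fun x hx => ?_
  exact (continuousAt_singularC hr hrb hx).continuousWithinAt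

/-- The integral is computed on the prism over the centred parallelogram, which contains the ball of
radius r. On the prism the lift of `singularC` is `singularPart` alone, with no contribution from
other lattice translates. -/
theorem integral_singularC_mul_aux {h : Cyl b → ℝ} (hh : Continuous h) :
    Integrable (fun x => singularC hr x * h x) (cylMeasure b) ∧
    ∫ x, singularC hr x * h x ∂(cylMeasure b) = ∫ v, singularPart hr v * h (covering b v) := by
  set D : Set Plane := centerShift b +ᵥ ZSpan.fundamentalDomain b with hD
  have hDm : MeasurableSet D := (ZSpan.fundamentalDomain_measurableSet b).const_vadd _
  set D₃ : Set Cover := splitEquiv ⁻¹' (D ×ˢ univ) with hD₃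
  have hD₃m : MeasurableSet D₃ := splitEquiv.measurable (hDm.prod MeasurableSet.univ)
  have hcyl : cylMeasure b = (volume.restrict D₃).map (covering b) := by
    rw [cylMeasure, ← torusMeasure_eq_map_vadd b (centerShift b), ← hD]
    have h1 : (volume : Measure ℝ) = (volume : Measure ℝ).map id := Measure.map_id.symm
    conv_lhs => rw [h1]
    rw [Measure.map_prod_map _ _ (measurable_torus_mk b) measurable_id]
    have h2 : (volume.restrict D).prod (volume : Measure ℝ) =
        (volume : Measure (Plane × ℝ)).restrict (D ×ˢ univ) := by
      rw [Measure.volume_eq_prod, ← Measure.prod_restrict, Measure.restrict_univ]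
    have h3 := (measurePreserving_splitEquiv.restrict_preimage
      (hDm.prod (MeasurableSet.univ (α := ℝ)))).map_eq
    rw [h2, ← h3, Measure.map_map ((measurable_torus_mk b).prodMap measurable_id)
      splitEquiv.measurable]
    rfl
  have hm : Measurable fun x : Cyl b => singularC hr x * h x :=
    (measurable_singularC hr hrb).mul hh.measurable
  have hcov : Measurable (covering b) := (continuous_covering b).measurable
  have hball : ∀ v : Cover, ‖v‖ < r → v ∈ D₃ := by
    intro v hv
    refine ⟨(mem_centered_iff b _).2 fun i => ?_, mem_univ _⟩
    have := abs_lt.1 (abs_repr_lt (b := b) ((norm_hor_le v).trans_lt (hv.trans_le hrb)) i)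
    exact ⟨this.1.le, this.2⟩
  have hlift : ∀ v ∈ D₃, singularC hr (covering b v) = singularPart hr v := by
    intro v hv
    by_cases hn : covering b v ∈ covering b '' Metric.closedBall 0 (r / 2)
    · obtain ⟨v', hv', he⟩ := hn
      rw [mem_closedBall_zero_iff] at hv'
      have hmem' : v' ∈ D₃ := hball v' (by linarith)
      -- Two points of the half-open prism with the same image have lattice coordinates differing by
      -- integers in (-1, 1), hence by 0.
      have : v' = v := by
        have h2 : v' 2 = v 2 := congrArg Prod.snd he
        have h1 : (QuotientAddGroup.mk (hor v') : Torus b) = QuotientAddGroup.mk (hor v) :=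
          congrArg Prod.fst he
        have h3 := (mem_lattice_iff b _).1 (QuotientAddGroup.eq.1 h1)
        have h4 : hor v' = hor v := by
          refine b.ext_elem fun i => ?_
          obtain ⟨n, hn⟩ := h3 i
          have a1 := (mem_centered_iff b _).1 hmem'.1 i
          have a2 := (mem_centered_iff b _).1 hv.1 i
          have a1' : b.repr (hor v') i ∈ Ico (-2⁻¹ : ℝ) 2⁻¹ := a1
          have a2' : b.repr (hor v) i ∈ Ico (-2⁻¹ : ℝ) 2⁻¹ := a2
          rw [map_add, map_neg, Finsupp.add_apply, Finsupp.neg_apply] at hn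
          have hn0 : n = 0 := by
            have l1 : (-1:ℝ) < n := by linarith [a1'.2, a2'.1]
            have l2 : (n:ℝ) < 1 := by linarith [a1'.1, a2'.2]
            have l1' : -1 < n := by exact_mod_cast l1
            have l2' : n < 1 := by exact_mod_cast l2
            omega
          rw [hn0] at hn
          push_cast at hn
          linarith
        rw [← joinHeight_hor v', ← joinHeight_hor v, h4, h2]
      rw [← this, singularC_covering hr (by linarith)]
    · rw [singularC_eq_zero hr hn, singularPart_eq_zero hr]
      by_contra! hlt
      exact hn ⟨v, by simpa using hlt.le, rfl⟩
  have hE : Continuous fun v : Cover => h (covering b v) := hh.comp (continuous_covering b)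
  have hI := integrable_singularPart_mul hr hE
  have hcongr : EqOn (fun v => singularC hr (covering b v) * h (covering b v))
      (fun v => singularPart hr v * h (covering b v)) D₃ := fun v hv => by
    simp only [hlift v hv]
  constructor
  · rw [hcyl, integrable_map_measure hm.aestronglyMeasurable hcov.aemeasurable]
    exact (IntegrableOn.congr_fun hI.integrableOn hcongr.symm hD₃m)
  · rw [hcyl, integral_map hcov.aemeasurable hm.aestronglyMeasurable,
      setIntegral_congr_fun hD₃m hcongr, setIntegral_eq_integral_of_forall_compl_eq_zero]
    intro v hv
    rw [singularPart_eq_zero hr, zero_mul]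
    by_contra! hlt
    exact hv (hball v (by linarith))

theorem integrable_singularC : Integrable (singularC hr) (cylMeasure b) := by
  simpa using (integral_singularC_mul_aux hr hrb (h := fun _ => 1) continuous_const).1

end SingularPart

end FlatCylinder

end

/-! ### The Green's function of the whole cylinder. -/

noncomputable section

namespace FlatCylinder

section Smear

open scoped Convolution

variable {b : Module.Basis (Fin 2) ℝ Plane}

/-- The convolution of a kernel on the cylinder with a density on the universal cover. -/
def smear (K : Cyl b → ℝ) (g : Cover → ℝ) (x : Cyl b) : ℝ := ∫ u, K (x - covering b u) * g u

theorem smear_comp_covering (K : Cyl b → ℝ) (g : Cover → ℝ) :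
    smear K g ∘ covering b =
      (K ∘ covering b) ⋆[ContinuousLinearMap.lsmul ℝ ℝ, volume] g := by
  funext v
  rw [convolution_lsmul_swap]
  simp [smear, covering_sub]

variable {K : Cyl b → ℝ} {g : Cover → ℝ} (hK : Continuous K)
include hK

theorem contDiff_smear (hg : ContDiff ℝ ∞ g) (cg : HasCompactSupport g) :
    ContDiff ℝ ∞ (smear K g ∘ covering b) := by
  rw [smear_comp_covering]
  exact cg.contDiff_convolution_right _ (hK.comp (continuous_covering b)).locallyIntegrable hg

theorem integrable_mul_integral_translate (hg : Continuous g) (cg : HasCompactSupport g)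
    {ψ : Cyl b → ℝ} (hψ : Continuous ψ) (cψ : HasCompactSupport ψ) :
    Integrable fun u => g u * ∫ x, K x * ψ (x + covering b u) ∂(cylMeasure b) := by
  have hcov := continuous_covering b
  have hc : Continuous (fun p : Cover × Cyl b =>
      g p.1 * (K p.2 * ψ (p.2 + covering b p.1))) := by fun_prop
  have hs : HasCompactSupport (fun p : Cover × Cyl b =>
      g p.1 * (K p.2 * ψ (p.2 + covering b p.1))) := by
    refine HasCompactSupport.of_support_subset_isCompact
      ((cg.isCompact.prod cψ.isCompact).image (f := fun p : Cover × Cyl b =>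
        (p.1, p.2 - covering b p.1)) (by fun_prop)) ?_
    rintro ⟨u, x⟩ hxu
    simp only [Function.mem_support] at hxu
    exact ⟨(u, x + covering b u), ⟨subset_tsupport _ (left_ne_zero_of_mul hxu),
      subset_tsupport _ (right_ne_zero_of_mul (right_ne_zero_of_mul hxu))⟩, by simp⟩
  have h := (hc.integrable_of_hasCompactSupport hs
    (μ := (volume : Measure Cover).prod (cylMeasure b))).integral_prod_left
  simpa only [integral_const_mul] using h

end Smear

variable {b : Module.Basis (Fin 2) ℝ Plane} {r : ℝ} (hr : 0 < r)

/-- Minus the horizontal Laplacian of the remainder. -/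
def remainderT (u : Cover) : ℝ := -(dd 0 (remainder hr) u + dd 1 (remainder hr) u)

theorem contDiff_remainderT : ContDiff ℝ ∞ (remainderT hr) :=
  ((contDiff_dd (contDiff_remainder hr) 0).add (contDiff_dd (contDiff_remainder hr) 1)).neg

theorem hasCompactSupport_remainderT : HasCompactSupport (remainderT hr) :=
  ((hasCompactSupport_dd (contDiff_remainder hr) (hasCompactSupport_remainder hr) 0).add
    (hasCompactSupport_dd (contDiff_remainder hr) (hasCompactSupport_remainder hr) 1)).neg

theorem remainderT_reflection (u : Cover) : remainderT hr (reflection u) = remainderT hr u := by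
  simp only [remainderT, dd_reflection (contDiff_remainder hr) (remainder_reflection hr)]

/-- The part of the Green's function which decays exponentially at both ends. -/
def oscPart (x : Cyl b) : ℝ := -smear (kernelOsc b) (remainderT hr) x

/-- The part of the Green's function which only depends on the height. -/
def heightPart (x : Cyl b) : ℝ := smear (fun x : Cyl b => |x.2| / (2 * area b)) (remainder hr) x

/-- The Green's function of the cylinder with pole at the origin, symmetric in the height. -/
def green (x : Cyl b) : ℝ := singularC hr x + heightPart hr x + oscPart hr x

theorem contDiff_oscPart : ContDiff ℝ ∞ (oscPart hr ∘ covering b) :=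
  (contDiff_smear (continuous_kernelOsc b) (contDiff_remainderT hr)
    (hasCompactSupport_remainderT hr)).neg

theorem contDiff_heightPart : ContDiff ℝ ∞ (heightPart hr ∘ covering b) :=
  contDiff_smear (by fun_prop) (contDiff_remainder hr) (hasCompactSupport_remainder hr)

theorem norm_iteratedFDeriv_oscPart_le (k : ℕ) : ∃ C, ∀ v,
    ‖iteratedFDeriv ℝ k (oscPart hr ∘ covering b) v‖ ≤ C * Real.exp (-√(lamOne b) * |v 2|) := by
  obtain ⟨C, hC⟩ := norm_iteratedFDeriv_convolution_le_exp (Real.sqrt_nonneg (lamOne b))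
    ((continuous_kernelOsc b).comp (continuous_covering b))
    (fun v => abs_kernelOsc_le b (covering b v)) k (contDiff_remainderT hr)
    (hasCompactSupport_remainderT hr)
  refine ⟨C, fun v => ?_⟩
  have : oscPart hr ∘ covering b = -(smear (kernelOsc b) (remainderT hr) ∘ covering b) := rfl
  rw [this, iteratedFDeriv_neg_apply, norm_neg, smear_comp_covering]
  exact hC v

theorem abs_oscPart_le : ∃ C, ∀ x : Cyl b,
    |oscPart hr x| ≤ C * Real.exp (-√(lamOne b) * |x.2|) := by
  obtain ⟨C, hC⟩ := norm_iteratedFDeriv_oscPart_le (b := b) hr 0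
  refine ⟨C, (covering_surjective b).forall.2 fun v => ?_⟩
  simpa using hC v

/-- The kernel depends on the height only through |z| and the density is invariant under reflection,
so reflecting the integration variable gives evenness. The method of images depends on it. -/
theorem oscPart_neg_height (q : Torus b) (z : ℝ) : oscPart hr (q, -z) = oscPart hr (q, z) := by
  rw [oscPart, oscPart, smear, smear]
  congr 1
  rw [← reflection.measurePreserving.integral_comp reflection.toHomeomorph.measurableEmbedding]
  refine integral_congr_ae (Eventually.of_forall fun u => ?_)
  simp only
  rw [remainderT_reflection]
  congr 1
  have h1 : covering b (reflection u) = ((covering b u).1, -u 2) := by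
    rw [covering_eq, covering_eq, reflection_apply_two, hor_apply, hor_apply,
      reflection_apply_of_ne u (by decide), reflection_apply_of_ne u (by decide)]
  rw [h1]
  refine kernelOsc_eq_of_abs_eq b ?_
  rw [covering_snd, ← abs_neg]
  congr 1
  simp only
  ring

/-- For |z| ≥ r/2 and u in the support of the remainder, |z - u 2| equals |z| - s (u 2) with s the
sign of z. Only the mass -2π and the vanishing first moment of the remainder then enter. -/
theorem heightPart_eq {x : Cyl b} (hx : r / 2 ≤ |x.2|) :
    heightPart hr x = -(Real.pi / area b) * |x.2| := by
  have hA := (area_pos b).ne'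
  have hsupp : ∀ u, remainder hr u ≠ 0 → |u 2| ≤ r / 2 := fun u hu =>
    (abs_height_le_norm u).trans (by
      by_contra! h
      exact hu (remainder_eq_zero hr h))
  have hint : Integrable (remainder hr) :=
    (contDiff_remainder hr).continuous.integrable_of_hasCompactSupport
      (hasCompactSupport_remainder hr)
  have hint2 : Integrable fun u => remainder hr u * u 2 :=
    Continuous.integrable_of_hasCompactSupport
      ((contDiff_remainder hr).continuous.mul (by fun_prop))
      (hasCompactSupport_remainder hr).mul_right
  have key : ∀ s : ℝ, (∀ u, remainder hr u ≠ 0 → |x.2 - u 2| = |x.2| - s * u 2) →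
      heightPart hr x = -(Real.pi / area b) * |x.2| := by
    intro s hs
    have h1 : ∀ u, |(x - covering b u).2| / (2 * area b) * remainder hr u =
        (2 * area b)⁻¹ * (|x.2| * remainder hr u - s * (remainder hr u * u 2)) := by
      intro u
      by_cases hu : remainder hr u = 0
      · simp [hu]
      · rw [Prod.snd_sub, covering_snd, hs u hu]; field_simp
    rw [heightPart, smear]
    simp only [h1]
    rw [integral_const_mul, integral_sub (hint.const_mul _) (hint2.const_mul _),
      integral_const_mul, integral_const_mul, integral_remainder, integral_remainder_mul_height]
    field_simp
    ring
  rcases le_total 0 x.2 with h | h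
  · refine key 1 fun u hu => ?_
    rw [abs_of_nonneg h] at hx
    have := abs_le.1 (hsupp u hu)
    rw [abs_of_nonneg h, abs_of_nonneg (by linarith [this.2])]; ring
  · refine key (-1) fun u hu => ?_
    rw [abs_of_nonpos h] at hx
    have := abs_le.1 (hsupp u hu)
    rw [abs_of_nonpos h, abs_of_nonpos (by linarith [this.1])]; ring

theorem green_eq_of_height {x : Cyl b} (hx : r / 2 < |x.2|) :
    green hr x = -(Real.pi / area b) * |x.2| + oscPart hr x := by
  rw [green, singularC_eq_zero hr (notMem_image_of_height hx), heightPart_eq hr hx.le, zero_add]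

section Poisson

variable {φ : Cyl b → ℝ} (h : IsTest φ)
include h

omit h in
theorem dd_translate_covering (i : Fin 3) (x : Cyl b) (u : Cover) :
    dd i (fun u => φ (x + covering b u)) u = pd i φ (x + covering b u) := by
  obtain ⟨v, rfl⟩ := covering_surjective b x
  have h1 : (fun u => φ (covering b v + covering b u)) = fun u => (φ ∘ covering b) (v + u) := by
    funext u; simp [covering_add]
  rw [h1, dd_comp_add_left, ← covering_add, pd_covering]

theorem integral_remainderT_mul (x : Cyl b) :
    ∫ u, remainderT hr u * φ (x + covering b u) =
      ∫ u, remainder hr u * negLapT φ (x + covering b u) := by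
  have hs : ContDiff ℝ ∞ fun u => φ (x + covering b u) := by
    obtain ⟨v, rfl⟩ := covering_surjective b x
    have h1 : (fun u => φ (covering b v + covering b u)) = fun u => (φ ∘ covering b) (v + u) := by
      funext u; simp [covering_add]
    rw [h1]
    exact h.smooth.comp (by fun_prop)
  have hrem := contDiff_remainder hr
  have crem := hasCompactSupport_remainder hr
  have hi : ∀ i, Integrable fun u => φ (x + covering b u) * dd i (remainder hr) u := fun i =>
    (hs.continuous.mul (contDiff_dd hrem i).continuous).integrable_of_hasCompactSupport
      (hasCompactSupport_dd hrem crem i).mul_left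
  have hj : ∀ i, Integrable fun u => dd i (fun u => φ (x + covering b u)) u * remainder hr u :=
    fun i => ((contDiff_dd hs i).continuous.mul hrem.continuous).integrable_of_hasCompactSupport
      crem.mul_left
  have e1 : ∀ u, remainderT hr u * φ (x + covering b u) =
      -(φ (x + covering b u) * dd 0 (remainder hr) u +
        φ (x + covering b u) * dd 1 (remainder hr) u) := fun u => by rw [remainderT]; ring
  have e2 : ∀ u, remainder hr u * negLapT φ (x + covering b u) =
      -(dd 0 (fun u => φ (x + covering b u)) u * remainder hr u +
        dd 1 (fun u => φ (x + covering b u)) u * remainder hr u) := fun u => by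
    rw [negLapT, dd_translate_covering, dd_translate_covering]; ring
  simp only [e1, e2]
  rw [integral_neg, integral_neg, integral_add (hi 0) (hi 1), integral_add (hj 0) (hj 1),
    integral_mul_dd hs hrem crem, integral_mul_dd hs hrem crem]

/-- Weakly, minus the Laplacian of the two smooth parts is minus the remainder, which compensates
the defect of the singular part. This is `test_representation` for the translates of φ, integrated
against the remainder. -/
theorem integral_smooth_parts_mul_negLap :
    ∫ x, (heightPart hr x + oscPart hr x) * negLap φ x ∂(cylMeasure b) =
      -∫ u, remainder hr u * φ (covering b u) := by
  have hK := continuous_kernelOsc b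
  have hH : Continuous fun x : Cyl b => |x.2| / (2 * area b) := by fun_prop
  have hrem := (contDiff_remainder hr).continuous
  have crem := hasCompactSupport_remainder hr
  have t1 := h.negLap
  have t2 := t1.negLapT
  have i1 : ∫ x, heightPart hr x * negLap φ x ∂(cylMeasure b) =
      ∫ u, remainder hr u * ∫ x, |x.2| / (2 * area b) * negLap φ (x + covering b u)
        ∂(cylMeasure b) :=
    integral_smear_mul_eq_left hH hrem crem t1.continuous t1.compact
  -- The horizontal Laplacian, carried by the density in `oscPart`, is moved onto the test function,
  -- where `test_representation` needs it.
  have i2 : ∫ x, oscPart hr x * negLap φ x ∂(cylMeasure b) =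
      -∫ u, remainder hr u * ∫ x, kernelOsc b x * negLapT (negLap φ) (x + covering b u)
        ∂(cylMeasure b) := by
    simp only [oscPart, neg_mul]
    rw [integral_neg, integral_smear_mul_eq_right hK hrem crem t2.continuous t2.compact]
    simp only [← integral_remainderT_mul hr t1]
    rw [← integral_smear_mul_eq_right hK (contDiff_remainderT hr).continuous
      (hasCompactSupport_remainderT hr) t1.continuous t1.compact]
    rw [← integral_smear_mul_eq_left hK (contDiff_remainderT hr).continuous
      (hasCompactSupport_remainderT hr) t1.continuous t1.compact]
    rfl
  simp only [add_mul]
  rw [integral_add (t1.integrable_mul (continuous_of_smooth (contDiff_heightPart hr)))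
    (t1.integrable_mul (continuous_of_smooth (contDiff_oscPart hr))), i1, i2,
    ← sub_eq_add_neg, ← integral_sub
      (integrable_mul_integral_translate hH hrem crem t1.continuous t1.compact)
      (integrable_mul_integral_translate hK hrem crem t2.continuous t2.compact),
    ← integral_neg]
  refine integral_congr_ae (Eventually.of_forall fun u => ?_)
  have h1 := test_representation (h.translate (covering b u))
  have h2 : negLap (fun x => φ (x + covering b u)) = fun x => negLap φ (x + covering b u) :=
    funext fun x => negLap_translate φ _ x
  have h3 : ∀ x, negLapT (fun x => negLap φ (x + covering b u)) x =
      negLapT (negLap φ) (x + covering b u) := fun x => negLapT_translate _ _ x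
  rw [h2] at h1
  simp only [h3, zero_add, neg_mul, integral_neg] at h1
  simp only [← h1]
  ring

end Poisson

variable (hrb : r ≤ injRadius b)
include hrb

/-- The remainder produced by the singular part cancels against that of the smooth parts, leaving
the point mass. -/
theorem integral_green_mul_negLap {φ : Cyl b → ℝ} (h : IsTest φ) :
    ∫ x, green hr x * negLap φ x ∂(cylMeasure b) = 2 * Real.pi * φ 0 := by
  obtain ⟨hi, he⟩ := integral_singularC_mul_aux hr hrb h.negLap.continuous
  have hsm : Continuous fun x : Cyl b => heightPart hr x + oscPart hr x :=
    (continuous_of_smooth (contDiff_heightPart hr)).add (continuous_of_smooth (contDiff_oscPart hr))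
  have e : ∀ x, green hr x * negLap φ x = singularC hr x * negLap φ x +
      (heightPart hr x + oscPart hr x) * negLap φ x := fun x => by rw [green]; ring
  simp only [e]
  rw [integral_add hi (h.negLap.integrable_mul hsm), he, integral_smooth_parts_mul_negLap hr h]
  have e2 : ∀ v, negLap φ (covering b v) = -∑ i, dd i (φ ∘ covering b) v := fun v => by
    rw [negLap, Fin.sum_univ_three]; simp only [pd_covering]; ring
  simp only [e2]
  rw [integral_singularPart hr h.smooth]
  simp only [Function.comp_apply, covering_zero]
  ring

theorem smoothAt_green {x : Cyl b} (hx : x ≠ 0) : SmoothAt b (green hr) x := by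
  have h := smoothAt_singularC hr hrb hx
  obtain ⟨v, rfl⟩ := covering_surjective b x
  rw [smoothAt_covering] at h ⊢
  exact (h.add (contDiff_heightPart hr).contDiffAt).add (contDiff_oscPart hr).contDiffAt

theorem locallyIntegrable_green : LocallyIntegrable (green hr) (cylMeasure b) :=
  ((integrable_singularC hr hrb).locallyIntegrable.add
    (continuous_of_smooth (contDiff_heightPart hr)).locallyIntegrable).add
    (continuous_of_smooth (contDiff_oscPart hr)).locallyIntegrable

omit hrb in
theorem tendsto_green_covering : Tendsto (green hr ∘ covering b) (𝓝[≠] 0) atTop := by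
  have h1 : Tendsto ((singularC hr : Cyl b → ℝ) ∘ covering b) (𝓝[≠] 0) atTop := by
    refine (tendsto_singularPart hr).congr' ?_
    have : ∀ᶠ v : Cover in 𝓝 0, ‖v‖ < injRadius b :=
      (continuous_norm.continuousAt (x := (0 : Cover))).eventually
        (gt_mem_nhds (by simpa using injRadius_pos b))
    filter_upwards [mem_nhdsWithin_of_mem_nhds this] with v hv
    exact (singularC_covering hr hv).symm
  have h2 : Tendsto (fun v => heightPart hr (covering b v) + oscPart hr (covering b v)) (𝓝[≠] 0)
      (𝓝 (heightPart hr (covering b 0) + oscPart hr (covering b 0))) :=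
    (((contDiff_heightPart hr).continuous.add (contDiff_oscPart hr).continuous).tendsto 0).mono_left
      nhdsWithin_le_nhds
  refine (h1.atTop_add h2).congr fun v => ?_
  simp only [Function.comp_apply, green]
  ring

end FlatCylinder

end

/-! ### Separation of variables: uniqueness in a slab and exact fiber averages. -/

noncomputable section

namespace FlatCylinder

variable {b : Module.Basis (Fin 2) ℝ Plane}

section ModeTest

variable {e : Torus b → ℝ} {c : Fin 2 → ℝ} (he : IsMode e c) {χ : ℝ → ℝ} (hχ : ContDiff ℝ ∞ χ)
  (cχ : HasCompactSupport χ)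

theorem tsupport_height_mul_subset (χ : ℝ → ℝ) (e : Torus b → ℝ) :
    tsupport (fun x : Cyl b => χ x.2 * e x.1) ⊆ Prod.snd ⁻¹' tsupport χ :=
  closure_minimal (fun _ hx => subset_tsupport _ (left_ne_zero_of_mul hx))
    ((isClosed_tsupport χ).preimage continuous_snd)

include he hχ cχ

theorem isTest_height_mul_mode : IsTest fun x : Cyl b => χ x.2 * e x.1 := by
  refine ⟨?_, ?_⟩
  · have h1 : ContDiff ℝ ∞ fun v : Cover => χ (v 2) := hχ.comp (by fun_prop)
    have h2 : ContDiff ℝ ∞ fun v : Cover => liftT e (hor v) := he.1.comp hor.contDiff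
    exact h1.mul h2
  · refine HasCompactSupport.of_support_subset_isCompact (isCompact_univ.prod cχ.isCompact)
      fun x hx => ⟨mem_univ _, subset_tsupport _ (left_ne_zero_of_mul hx)⟩

theorem pd_height_mul_mode (i : Fin 2) (x : Cyl b) :
    pd i.castSucc (fun x : Cyl b => χ x.2 * e x.1) x = -(c i) * (χ x.2 * e x.1) := by
  have h := (isTest_height_mul_mode he hχ cχ).smooth
  have h1 : ∀ x : Cyl b, p1 i.castSucc (fun x : Cyl b => χ x.2 * e x.1) x =
      χ x.2 * d1T i e x.1 := fun x => by
    refine (hasDerivAt_cyl h i.castSucc x).unique ?_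
    simp only [axisC_castSucc, Prod.snd_add, Prod.fst_add, add_zero]
    exact (hasDerivAt_torus he.1 i x.1).const_mul _
  have h2 := hasDerivAt_cyl_two h i.castSucc x
  simp only [h1, axisC_castSucc, Prod.snd_add, Prod.fst_add, add_zero] at h2
  rw [h2.unique ((hasDerivAt_torus_two he.1 i x.1).const_mul _), he.2]
  ring

theorem pd_two_height_mul_mode (x : Cyl b) :
    pd 2 (fun x : Cyl b => χ x.2 * e x.1) x = deriv (deriv χ) x.2 * e x.1 := by
  have h := isTest_height_mul_mode he hχ cχ
  obtain ⟨q, z⟩ := x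
  have hd : Differentiable ℝ χ := hχ.differentiable (by simp)
  have hd' : Differentiable ℝ (deriv χ) :=
    ((contDiff_infty_iff_deriv.1 hχ).2).differentiable (by simp)
  have h1 : ∀ z : ℝ, p1 2 (fun x : Cyl b => χ x.2 * e x.1) (q, z) = deriv χ z * e q := fun z =>
    (h.hasDerivAt_slice q z).unique ((hd z).hasDerivAt.mul_const (e q))
  have h2 := h.hasDerivAt_slice_two q z
  simp only [h1] at h2
  exact h2.unique ((hd' z).hasDerivAt.mul_const (e q))

theorem negLap_height_mul_mode (x : Cyl b) :
    negLap (fun x : Cyl b => χ x.2 * e x.1) x =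
      e x.1 * ((∑ i, c i) * χ x.2 - deriv (deriv χ) x.2) := by
  have h0 := pd_height_mul_mode he hχ cχ 0 x
  have h1 := pd_height_mul_mode he hχ cχ 1 x
  have e0 : Fin.castSucc (0 : Fin 2) = 0 := rfl
  have e1 : Fin.castSucc (1 : Fin 2) = 1 := rfl
  rw [e0] at h0
  rw [e1] at h1
  rw [negLap, pd_two_height_mul_mode he hχ cχ, h0, h1, Fin.sum_univ_two]
  ring

end ModeTest

theorem integrable_mul_of_support_subset {V : Cyl b → ℝ} {U K : Set (Cyl b)}
    (hV : LocallyIntegrableOn V U (cylMeasure b)) (hK : IsCompact K) (hKU : K ⊆ U)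
    {φ : Cyl b → ℝ} (hφ : Continuous φ) (hs : Function.support φ ⊆ K) :
    Integrable (fun x => V x * φ x) (cylMeasure b) := by
  have h1 := (hV.integrableOn_compact_subset hKU hK).mul_continuousOn hφ.continuousOn hK
  refine (integrableOn_iff_integrable_of_support_subset ?_).1 h1
  exact fun x hx => hs (right_ne_zero_of_mul hx)

theorem isOpen_slab (R : ℝ) : IsOpen {x : Cyl b | |x.2| < R} :=
  isOpen_lt (by fun_prop) continuous_const

section Slices

variable {D : Cyl b → ℝ} {e : Torus b → ℝ} {R : ℝ}

theorem integrableOn_sliceIntegral (hD : LocallyIntegrableOn D {x | |x.2| < R} (cylMeasure b))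
    (he : Continuous e) {l : ℝ} (hl : l < R) :
    IntegrableOn (fun z => ∫ q, D (q, z) * e q ∂(torusMeasure b)) (Icc (-l) l) := by
  have hK : IsCompact ((univ : Set (Torus b)) ×ˢ Icc (-l) l) := isCompact_univ.prod isCompact_Icc
  have h1 := (hD.integrableOn_compact_subset (fun x hx => (abs_le.2 hx.2).trans_lt hl) hK
    ).mul_continuousOn (he.comp continuous_fst).continuousOn hK
  rw [IntegrableOn, cylMeasure, ← Measure.prod_restrict, Measure.restrict_univ] at h1
  exact h1.integral_prod_right

theorem continuousOn_sliceIntegral (hD : ContinuousOn D ({x | |x.2| ≤ R} ∩ {x | x.2 ≠ 0}))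
    (he : Continuous e) :
    ContinuousOn (fun z => ∫ q, D (q, z) * e q ∂(torusMeasure b)) (Icc (-R) R \ {0}) := by
  refine continuousOn_integral_of_compact_support (f := fun z q => D (q, z) * e q)
    isCompact_univ ?_ (fun _ _ _ h => absurd (mem_univ _) h)
  refine ContinuousOn.mul (hD.comp (g := D) (f := fun p : ℝ × Torus b => (p.2, p.1))
    (by fun_prop) fun p hp => ⟨abs_le.2 hp.1.1, hp.1.2⟩) (by fun_prop)

/-- Testing with products χ(z) e(q) turns the weak equation on the slab into a weak ordinary
differential equation for the coefficient of D along e. -/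
theorem weak_sliceIntegral (hD : LocallyIntegrableOn D {x | |x.2| < R} (cylMeasure b))
    {c : Fin 2 → ℝ} (he : IsMode e c)
    (hw : ∀ χ : ℝ → ℝ, ContDiff ℝ ∞ χ → HasCompactSupport χ → tsupport χ ⊆ Ioo (-R) R →
      ∫ x, D x * negLap (fun x : Cyl b => χ x.2 * e x.1) x ∂(cylMeasure b) = 0)
    {χ : ℝ → ℝ} (hχ : ContDiff ℝ ∞ χ) (cχ : HasCompactSupport χ) (sχ : tsupport χ ⊆ Ioo (-R) R) :
    ∫ z, (∫ q, D (q, z) * e q ∂(torusMeasure b)) * ((∑ i, c i) * χ z - deriv (deriv χ) z) = 0 := by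
  have ht := isTest_height_mul_mode he hχ cχ
  have hint : Integrable (fun x => D x * negLap (fun x : Cyl b => χ x.2 * e x.1) x)
      ((torusMeasure b).prod volume) :=
    integrable_mul_of_support_subset hD ht.compact.isCompact
      ((tsupport_height_mul_subset χ e).trans fun x hx => abs_lt.2 (sχ hx)) ht.negLap.continuous
      (negLap_support_subset ht)
  have h1 := hw χ hχ cχ sχ
  rw [cylMeasure, integral_prod_symm _ hint] at h1
  rw [← h1]
  refine integral_congr_ae (Eventually.of_forall fun z => ?_)
  simp only [negLap_height_mul_mode he hχ cχ]
  rw [← integral_mul_const]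
  refine integral_congr_ae (Eventually.of_forall fun q => ?_)
  simp only
  ring

end Slices

/-- A weakly harmonic function on a slab, possibly singular at one point of the middle fiber,
vanishes if it vanishes on the boundary. -/
theorem eq_zero_of_weakly_harmonic {D : Cyl b → ℝ} {R : ℝ} {p : Cyl b} (hp : p.2 = 0)
    (hR : 0 < R) (hD : LocallyIntegrableOn D {x | |x.2| < R} (cylMeasure b))
    (hc : ContinuousOn D ({x | |x.2| ≤ R} \ {p})) (hbd : ∀ x : Cyl b, |x.2| = R → D x = 0)
    (hw : ∀ φ, IsTestFunction b {x | |x.2| < R} φ → ∫ x, D x * negLap φ x ∂(cylMeasure b) = 0)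
    {x : Cyl b} (hx : |x.2| ≤ R) (hxp : x ≠ p) : D x = 0 := by
  have hc' : ContinuousOn D ({x | |x.2| ≤ R} ∩ {x | x.2 ≠ 0}) :=
    hc.mono fun x hx => ⟨hx.1, fun h => hx.2 (by rw [mem_singleton_iff.1 h, hp])⟩
  -- Each Fourier coefficient of the fibers solves a'' = λa weakly across z = 0, is continuous off z
  -- = 0, and vanishes at ±R. The weak equation at 0 makes up for the possible singularity at p.
  have hmode : ∀ {e : Torus b → ℝ} {c : Fin 2 → ℝ}, IsMode e c → 0 ≤ ∑ i, c i →
      ∀ z : ℝ, z ≠ 0 → |z| ≤ R → ∫ q, D (q, z) * e q ∂(torusMeasure b) = 0 := by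
    intro e c he hpos z hz hzR
    have hec : Continuous e := continuous_torus_iff.2 he.1.continuous
    refine eq_zero_of_weak (a := fun z => ∫ q, D (q, z) * e q ∂(torusMeasure b)) hpos
      (fun l hl => integrableOn_sliceIntegral hD hec hl) (continuousOn_sliceIntegral hc' hec)
      ?_ ?_ (fun χ hχ cχ sχ => weak_sliceIntegral hD he ?_ hχ cχ sχ) hz hzR
    · simp [hbd _ (show |((_ : Torus b), R).2| = R from abs_of_pos hR)]
    · simp [hbd _ (show |((_ : Torus b), -R).2| = R by rw [abs_neg, abs_of_pos hR])]
    · intro χ hχ cχ sχ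
      have ht := isTest_height_mul_mode he hχ cχ
      exact hw _ ⟨smooth_iff.2 ht.smooth, ht.compact,
        (tsupport_height_mul_subset χ e).trans fun x hx => abs_lt.2 (sχ hx)⟩
  have hne : ∀ x : Cyl b, x.2 ≠ 0 → |x.2| ≤ R → D x = 0 := by
    rintro ⟨q, z⟩ hz hzR
    have hcont : Continuous fun q : Torus b => D (q, z) :=
      hc'.comp_continuous (by fun_prop) fun q => ⟨hzR, hz⟩
    refine eq_zero_of_fourier_eq_zero hcont (fun k => ?_) (fun k => ?_) q
    · simpa only [mul_comm] using hmode (isMode_cosT b k) (lam_nonneg b k) z hz hzR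
    · simpa only [mul_comm] using hmode (isMode_sinT b k) (lam_nonneg b k) z hz hzR
  -- A point x ≠ p of the middle fiber is approached along its vertical line, where D is already
  -- zero, and D is continuous at x.
  by_cases hx0 : x.2 = 0
  · have hcx : ContinuousWithinAt D ({x | |x.2| ≤ R} \ {p}) x := hc x ⟨hx, hxp⟩
    obtain ⟨q, z⟩ := x
    simp only at hx0
    subst hx0
    have h1 : Tendsto (fun t : ℝ => ((q, t) : Cyl b)) (𝓝[≠] 0)
        (𝓝[{x | |x.2| ≤ R} \ {p}] ((q, 0) : Cyl b)) := by
      refine tendsto_nhdsWithin_iff.2 ⟨?_, ?_⟩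
      · exact ((by fun_prop : Continuous fun t : ℝ => ((q, t) : Cyl b)).tendsto 0).mono_left
          nhdsWithin_le_nhds
      · have h2 : ∀ᶠ t : ℝ in 𝓝 0, |t| < R :=
          (continuous_abs.continuousAt (x := (0:ℝ))).eventually (gt_mem_nhds (by simpa using hR))
        filter_upwards [self_mem_nhdsWithin, mem_nhdsWithin_of_mem_nhds h2] with t ht htR
        refine ⟨htR.le, fun h => ht ?_⟩
        rw [mem_singleton_iff] at h ⊢
        rw [← hp, ← h]
    have h3 : Tendsto (fun t : ℝ => D (q, t)) (𝓝[≠] 0) (𝓝 0) := by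
      refine tendsto_const_nhds.congr' ?_
      have h2 : ∀ᶠ t : ℝ in 𝓝 0, |t| < R :=
        (continuous_abs.continuousAt (x := (0:ℝ))).eventually (gt_mem_nhds (by simpa using hR))
      filter_upwards [self_mem_nhdsWithin, mem_nhdsWithin_of_mem_nhds h2] with t ht htR
      exact (hne (q, t) ht htR.le).symm
    exact tendsto_nhds_unique (hcx.tendsto.comp h1) h3
  · exact hne x hx0 hx

theorem IsDirichletGreen.eqOn {p : Cyl b} {R : ℝ} (hp : p.2 = 0) (hR : 0 < R) {V W : Cyl b → ℝ}
    (hV : IsDirichletGreen b p R V) (hW : IsDirichletGreen b p R W) :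
    EqOn V W ({x | |x.2| ≤ R} \ {p}) := by
  intro x hx
  rw [← sub_eq_zero]
  refine eq_zero_of_weakly_harmonic (D := fun x => V x - W x) hp hR (hV.1.2.1.sub hW.1.2.1)
    (hV.2.1.sub hW.2.1) (fun x hx => ?_) (fun φ hφ => ?_) hx.1 hx.2
  · simp only [hV.2.2 x hx, hW.2.2 x hx, sub_zero]
  · have h1 := hV.1.2.2 φ hφ
    have h2 := hW.1.2.2 φ hφ
    simp only [neg_laplacian_eq] at h1 h2
    have ht := hφ.isTest
    have hi : ∀ {V : Cyl b → ℝ}, LocallyIntegrableOn V {x | |x.2| < R} (cylMeasure b) →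
        Integrable (fun x => V x * negLap φ x) (cylMeasure b) := fun hV =>
      integrable_mul_of_support_subset hV ht.compact.isCompact hφ.2.2 ht.negLap.continuous
        (negLap_support_subset ht)
    simp only [sub_mul]
    rw [integral_sub (hi hV.1.2.1) (hi hW.1.2.1), h1, h2, sub_self]

section FiberAverage

variable {r : ℝ} (hr : 0 < r) (hrb : r ≤ injRadius b)
include hrb

/-- Adding π|z|/A to the Green's function cancels its point mass after integration over fibers, so
the fiber integral a of the sum satisfies a'' = 0 weakly on the whole line. At height l it is
O(exp(-√λ₁|l|)), so the maximum principle on [-l, l] with l → ∞ forces a = 0 off the origin. -/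
theorem fiberAverage_green {z : ℝ} (hz : z ≠ 0) :
    fiberAverage b (green hr) z = -(Real.pi / area b) * |z| := by
  have hA := area_pos b
  set D : Cyl b → ℝ := fun x => green hr x + Real.pi / area b * |x.2| with hD
  have habs : Continuous fun x : Cyl b => Real.pi / area b * |x.2| := by fun_prop
  have hcg : ∀ x : Cyl b, x ≠ 0 → ContinuousAt (green hr) x := by
    intro x hx
    have h := smoothAt_green hr hrb hx
    obtain ⟨v, rfl⟩ := covering_surjective b x
    rw [continuousAt_iff_comp_covering]
    exact (smoothAt_covering.1 h).continuousAt
  have hDc : ∀ x : Cyl b, x.2 ≠ 0 → ContinuousAt D x := fun x hx =>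
    (hcg x fun h => hx (by rw [h]; rfl)).add habs.continuousAt
  have hDi : LocallyIntegrable D (cylMeasure b) :=
    (locallyIntegrable_green hr hrb).add habs.locallyIntegrable
  set a : ℝ → ℝ := fun z => ∫ q, D (q, z) * 1 ∂(torusMeasure b) with ha
  obtain ⟨C, hC⟩ := abs_oscPart_le (b := b) hr
  have hbound : ∀ l, r / 2 < |l| → |a l| ≤ area b * (C * Real.exp (-√(lamOne b) * |l|)) := by
    intro l hl
    have h1 := norm_integral_le_of_norm_le_const (μ := torusMeasure b)
      (f := fun q => D (q, l) * 1) (C := C * Real.exp (-√(lamOne b) * |l|))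
      (Eventually.of_forall fun q => by
        rw [hD, mul_one, Real.norm_eq_abs]
        simp only
        rw [green_eq_of_height hr (x := (q, l)) hl]
        have := hC (q, l)
        convert! this using 2
        ring)
    rw [← Real.norm_eq_abs]
    refine h1.trans_eq ?_
    rw [area, mul_comm]
  have hsq : ∀ l, |z| < l → a z ^ 2 ≤ max (a (-l) ^ 2) (a l ^ 2) := by
    intro l hl
    have hweak : ∀ χ : ℝ → ℝ, ContDiff ℝ ∞ χ → HasCompactSupport χ →
        tsupport χ ⊆ Ioo (-(l + 1)) (l + 1) →
        ∫ x, D x * negLap (fun x : Cyl b => χ x.2 * 1) x ∂(cylMeasure b) = 0 := by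
      intro χ hχ cχ _
      have ht := isTest_height_mul_mode (b := b) isMode_one hχ cχ
      have hg : Integrable (fun x => green hr x * negLap (fun x : Cyl b => χ x.2 * 1) x)
          (cylMeasure b) :=
        integrable_mul_of_support_subset
          ((locallyIntegrable_green hr hrb).locallyIntegrableOn univ) ht.compact.isCompact
          (subset_univ _) ht.negLap.continuous (negLap_support_subset ht)
      have h2 := integral_green_mul_negLap hr hrb ht
      have h3 := integral_abs_height_mul_negLap ht
      have hi := ht.negLap.integrable_mul habs
      simp only [hD, add_mul]
      rw [integral_add hg hi, h2]
      simp only [mul_assoc]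
      rw [integral_const_mul, h3]
      simp only [mul_one, integral_const, smul_eq_mul, Prod.snd_zero]
      rw [← area]
      field_simp
      ring
    refine sq_le_max_of_weak (R := l + 1) (lam := ∑ i, (0 : Fin 2 → ℝ) i) (by simp)
      (fun l' hl' => integrableOn_sliceIntegral (hDi.locallyIntegrableOn _)
        continuous_const hl') (continuousOn_sliceIntegral (fun x hx =>
          (hDc x hx.2).continuousWithinAt) continuous_const)
      (fun χ hχ cχ sχ => weak_sliceIntegral (hDi.locallyIntegrableOn _) isMode_one hweak hχ cχ sχ)
      hz hl (by linarith)
  have hz0 : a z = 0 := by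
    have hlim : Tendsto (fun l : ℝ => (area b * (C * Real.exp (-√(lamOne b) * l))) ^ 2) atTop
        (𝓝 0) := by
      have h1 : Tendsto (fun l : ℝ => Real.exp (-√(lamOne b) * l)) atTop (𝓝 0) := by
        refine Real.tendsto_exp_atBot.comp ?_
        exact tendsto_id.const_mul_atTop_of_neg (neg_lt_zero.2 (Real.sqrt_pos.2 (lamOne_pos b)))
      simpa using ((h1.const_mul C).const_mul (area b)).pow 2
    have hle : a z ^ 2 ≤ 0 := by
      refine ge_of_tendsto hlim ?_
      filter_upwards [eventually_gt_atTop |z|, eventually_gt_atTop (r / 2)] with l h1 h2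
      have hl : 0 < l := (abs_nonneg z).trans_lt h1
      have habsl : |l| = l := abs_of_pos hl
      refine (hsq l h1).trans (max_le ?_ ?_)
      · rw [← sq_abs]
        have := hbound (-l) (by rw [abs_neg, habsl]; exact h2)
        rw [abs_neg, habsl] at this
        exact pow_le_pow_left₀ (abs_nonneg _) this 2
      · rw [← sq_abs]
        have := hbound l (by rw [habsl]; exact h2)
        rw [habsl] at this
        exact pow_le_pow_left₀ (abs_nonneg _) this 2
    exact pow_eq_zero_iff (two_ne_zero) |>.1 (le_antisymm hle (sq_nonneg _))
  have hcont : Continuous fun q : Torus b => green hr (q, z) :=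
    continuous_iff_continuousAt.2 fun q =>
      (hcg (q, z) fun h => hz (congrArg Prod.snd h)).comp (f := fun q : Torus b => (q, z))
        (by fun_prop)
  simp only [ha, hD, mul_one] at hz0
  rw [integral_add (integrable_torus hcont) (integrable_const _), integral_const, smul_eq_mul,
    ← area] at hz0
  rw [fiberAverage, average_eq, smul_eq_mul, ← area, eq_neg_of_add_eq_zero_left hz0]
  field_simp

end FiberAverage

end FlatCylinder

end

/-! ### The method of images in a slab. -/

noncomputable section

namespace FlatCylinder

/-- A series of smooth functions whose derivatives are summable uniformly on an open set. -/
theorem contDiffAt_tsum_of_isOpen {E : Type*} [NormedAddCommGroup E] [NormedSpace ℝ E]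
    [FiniteDimensional ℝ E] {f : ℕ → E → ℝ} {u : ℕ → ℝ} {U : Set E} (hU : IsOpen U)
    (hu : Summable u) (hf : ∀ n, ContDiff ℝ ∞ (f n))
    (hb : ∀ k : ℕ, ∃ C, ∀ n, ∀ x ∈ U, ‖iteratedFDeriv ℝ k (f n) x‖ ≤ C * u n) {x : E}
    (hx : x ∈ U) : ContDiffAt ℝ ∞ (fun x => ∑' n, f n x) x := by
  have : HasContDiffBump E := inferInstance
  obtain ⟨ε, hε, hball⟩ := Metric.isOpen_iff.1 hU x hx
  -- Differentiating the series is justified by bounds on the whole space, so each term is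
  -- multiplied by a bump supported in U and equal to 1 near x; Leibniz' rule transfers the bounds.
  set ζ : ContDiffBump x := ⟨ε / 4, ε / 2, by positivity, by linarith⟩ with hζ
  have hζU : tsupport ζ ⊆ U := by
    rw [ζ.tsupport_eq]
    exact (Metric.closedBall_subset_ball (by change ε / 2 < ε; linarith)).trans hball
  choose C hC using hb
  have hM : ∀ k : ℕ, ∃ M, ∀ y, ‖iteratedFDeriv ℝ k ζ y‖ ≤ M := fun k =>
    (ζ.hasCompactSupport.iteratedFDeriv k).exists_bound_of_continuous
      (ζ.contDiff.continuous_iteratedFDeriv (n := ∞) (by norm_cast; exact le_top))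
  choose M hM using hM
  have hsum : ContDiff ℝ ∞ fun y => ∑' n, ζ y * f n y := by
    refine contDiff_tsum (N := ⊤) (v := fun k n =>
      (∑ i ∈ Finset.range (k + 1), (k.choose i : ℝ) * M i * C (k - i)) * u n)
      (fun n => ζ.contDiff.mul (hf n)) (fun k _ => hu.mul_left _) (fun k n y _ => ?_)
    have hM0 : ∀ i, 0 ≤ M i := fun i => (norm_nonneg _).trans (hM i x)
    by_cases hy : y ∈ tsupport ζ
    · refine (norm_iteratedFDeriv_mul_le (N := ∞) ζ.contDiff (hf n) y
        (by norm_cast)).trans ?_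
      rw [Finset.sum_mul]
      refine Finset.sum_le_sum fun i _ => ?_
      rw [mul_assoc ((k.choose i : ℝ) * M i)]
      exact mul_le_mul (mul_le_mul_of_nonneg_left (hM i y) (Nat.cast_nonneg _))
        (hC _ n y (hζU hy)) (norm_nonneg _) (mul_nonneg (Nat.cast_nonneg _) (hM0 i))
    · have h0 : iteratedFDeriv ℝ k (fun y => ζ y * f n y) y = 0 := by
        have h1 : (fun y => ζ y * f n y) =ᶠ[𝓝 y] fun _ => 0 := by
          filter_upwards [(notMem_tsupport_iff_eventuallyEq.1 hy)] with w hw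
          rw [hw]; simp
        rw [(h1.iteratedFDeriv ℝ k).eq_of_nhds]
        simp
      rw [h0, norm_zero, Finset.sum_mul]
      refine Finset.sum_nonneg fun i _ => ?_
      rw [mul_assoc ((k.choose i : ℝ) * M i)]
      exact mul_nonneg (mul_nonneg (Nat.cast_nonneg _) (hM0 i))
        ((norm_nonneg _).trans (hC (k - i) n x hx))
  refine hsum.contDiffAt.congr_of_eventuallyEq ?_
  filter_upwards [ζ.eventuallyEq_one] with y hy
  simp [hy]

variable {b : Module.Basis (Fin 2) ℝ Plane} {r : ℝ} (hr : 0 < r) (R : ℝ)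

/-- The `n`-th pair of reflected images in the method of images for the slab `|z| ≤ R`. -/
def imagePair (n : ℕ) (x : Cyl b) : ℝ :=
  (-1) ^ (n + 1) * (oscPart hr (x + (0, 2 * (n + 1) * R)) + oscPart hr (x - (0, 2 * (n + 1) * R)))

/-- The correction turning the Green's function of the cylinder into that of the slab. -/
def imageSum (x : Cyl b) : ℝ := ∑' n, imagePair hr R n x

theorem covering_joinHeight_zero (s : ℝ) : covering b (joinHeight 0 s) = (0, s) := by
  rw [covering_joinHeight]; rfl

theorem imagePair_comp_covering (n : ℕ) : (imagePair hr R n : Cyl b → ℝ) ∘ covering b = fun v =>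
    (-1) ^ (n + 1) * ((oscPart hr ∘ covering b) (v + joinHeight 0 (2 * (n + 1) * R)) +
      (oscPart hr ∘ covering b) (v + -joinHeight 0 (2 * (n + 1) * R))) := by
  funext v
  simp [imagePair, covering_add, covering_neg, covering_joinHeight_zero, sub_eq_add_neg]

theorem contDiff_imagePair (n : ℕ) : ContDiff ℝ ∞ ((imagePair hr R n : Cyl b → ℝ) ∘ covering b) := by
  rw [imagePair_comp_covering]
  have h := contDiff_oscPart (b := b) hr
  exact contDiff_const.mul ((h.comp (contDiff_id.add contDiff_const)).add
    (h.comp (contDiff_id.add contDiff_const)))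

/-- The two images sit at heights ±2(n + 1)R, and m is any lower bound for the vertical distance to
them. The constant depends on neither R nor n, as the limit R → ∞ requires. -/
theorem norm_iteratedFDeriv_imagePair_le (k : ℕ) : ∃ C, 0 ≤ C ∧ ∀ (R : ℝ) (n : ℕ) (v : Cover) (m : ℝ),
    m ≤ 2 * (n + 1) * R - |v 2| →
    ‖iteratedFDeriv ℝ k ((imagePair hr R n : Cyl b → ℝ) ∘ covering b) v‖ ≤
      C * Real.exp (-√(lamOne b) * m) := by
  obtain ⟨C, hC⟩ := norm_iteratedFDeriv_oscPart_le (b := b) hr k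
  have hC0 : 0 ≤ C := by
    have := (norm_nonneg _).trans (hC 0)
    simpa using this
  refine ⟨2 * C, by positivity, fun R n v m hm => ?_⟩
  set w : Cover := joinHeight 0 (2 * (n + 1) * R) with hw
  have hw2 : w 2 = 2 * (n + 1) * R := joinHeight_two _ _
  have h := contDiff_oscPart (b := b) hr
  have hk : ((k : ℕ) : WithTop ℕ∞) ≤ ∞ := by norm_cast; exact le_top
  have hs : ∀ a : Cover, ContDiffAt ℝ k (fun v => (oscPart (b := b) hr ∘ covering b) (v + a)) v :=
    fun a => ((h.comp (contDiff_id.add contDiff_const)).contDiffAt).of_le hk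
  have e1 : ((imagePair hr R n : Cyl b → ℝ) ∘ covering b) = ((-1 : ℝ) ^ (n + 1)) •
      ((fun v => (oscPart (b := b) hr ∘ covering b) (v + w)) +
        fun v => (oscPart (b := b) hr ∘ covering b) (v + -w)) := imagePair_comp_covering hr R n
  have hexp : ∀ a : Cover, |a 2| = |2 * (n + 1) * R| →
      ‖iteratedFDeriv ℝ k (oscPart (b := b) hr ∘ covering b) (v + a)‖ ≤
        C * Real.exp (-√(lamOne b) * m) := by
    intro a ha
    refine (hC _).trans (mul_le_mul_of_nonneg_left (Real.exp_le_exp.2 ?_) hC0)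
    have h1 : |a 2| ≤ |(v + a) 2| + |v 2| := by
      have := abs_sub ((v + a) 2) (v 2)
      simpa using this
    have h2 := le_abs_self (2 * (n + 1) * R)
    have h3 : m ≤ |(v + a) 2| := by linarith
    have := mul_le_mul_of_nonneg_left h3 (Real.sqrt_nonneg (lamOne b))
    linarith
  rw [e1, iteratedFDeriv_const_smul_apply (ContDiffAt.add (hs w) (hs (-w)) : ContDiffAt ℝ k (_ + _) v),
    iteratedFDeriv_add_apply (hs w) (hs (-w)), iteratedFDeriv_comp_add_right,
    iteratedFDeriv_comp_add_right, norm_smul, norm_pow, norm_neg, norm_one, one_pow, one_mul]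
  refine (norm_add_le _ _).trans ?_
  have h1 := hexp w (by rw [hw2])
  have h2 := hexp (-w) (by rw [PiLp.neg_apply, hw2, abs_neg])
  linarith

theorem abs_imagePair_le : ∃ C, 0 ≤ C ∧ ∀ (R : ℝ) (n : ℕ) (x : Cyl b) (m : ℝ), m ≤ 2 * (n + 1) * R - |x.2| →
    |imagePair hr R n x| ≤ C * Real.exp (-√(lamOne b) * m) := by
  obtain ⟨C, hC0, hC⟩ := norm_iteratedFDeriv_imagePair_le (b := b) hr 0
  refine ⟨C, hC0, fun R n x m hm => ?_⟩
  obtain ⟨v, rfl⟩ := covering_surjective b x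
  simpa using hC R n v m hm

variable {R} (hR : 0 < R)

variable (b) in
/-- The ratio of the geometric series dominating the sum over the images. -/
def imageRatio (R : ℝ) : ℝ := Real.exp (-√(lamOne b) * (2 * R))

theorem exp_eq_imageRatio_pow (n : ℕ) :
    Real.exp (-√(lamOne b) * (2 * n * R)) = imageRatio b R ^ n := by
  rw [imageRatio, ← Real.exp_nat_mul]; congr 1; ring

include hR

theorem imageRatio_lt_one : imageRatio b R < 1 := by
  rw [imageRatio, Real.exp_lt_one_iff]
  have := Real.sqrt_pos.2 (lamOne_pos b)
  nlinarith [mul_pos this hR]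

theorem summable_imageRatio : Summable fun n : ℕ => imageRatio b R ^ n :=
  summable_geometric_of_lt_one (Real.exp_pos _).le (imageRatio_lt_one hR)

/-- For |z| ≤ 2R the vertical distance to the n-th pair is at least 2nR, which gives a geometric
series. -/
theorem summable_imagePair {x : Cyl b} (hx : |x.2| ≤ 2 * R) :
    Summable fun n => imagePair hr R n x := by
  obtain ⟨C, -, hC⟩ := abs_imagePair_le (b := b) hr
  refine Summable.of_norm_bounded ((summable_imageRatio (b := b) hR).mul_left C) fun n => ?_
  rw [← exp_eq_imageRatio_pow]
  exact hC R n x _ (by linarith)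

theorem smoothAt_imageSum {x : Cyl b} (hx : |x.2| < 2 * R) : SmoothAt b (imageSum hr R) x := by
  obtain ⟨v, rfl⟩ := covering_surjective b x
  rw [smoothAt_covering]
  have hU : IsOpen {v : Cover | |v 2| < 2 * R} := isOpen_lt (by fun_prop) continuous_const
  refine contDiffAt_tsum_of_isOpen (f := fun n => imagePair hr R n ∘ covering b) hU
    (summable_imageRatio (b := b) hR) (contDiff_imagePair hr R) (fun k => ?_) hx
  obtain ⟨C, -, hC⟩ := norm_iteratedFDeriv_imagePair_le (b := b) hr k
  refine ⟨C, fun n w hw => ?_⟩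
  rw [← exp_eq_imageRatio_pow]
  exact hC R n w _ (by have : |w 2| < 2 * R := hw; linarith)

omit hR in
-- For |z| ≤ R and R ≥ 1 the distance to the n-th pair is at least (2n + 1)R ≥ 2n + R. The factor
-- exp(-√λ₁ R) splits off and the remaining geometric series is the one for R = 1, so C is uniform
-- in R.
theorem abs_imageSum_le : ∃ C, ∀ R, 1 ≤ R → ∀ x : Cyl b, |x.2| ≤ R →
    |imageSum hr R x| ≤ C * Real.exp (-√(lamOne b) * R) := by
  obtain ⟨C, hC0, hC⟩ := abs_imagePair_le (b := b) hr
  refine ⟨C * ∑' n : ℕ, imageRatio b 1 ^ n, fun R hR x hx => ?_⟩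
  have hs := ((summable_imageRatio (b := b) one_pos).mul_left
    (C * Real.exp (-√(lamOne b) * R))).hasSum
  rw [tsum_mul_left] at hs
  refine le_of_le_of_eq (b := C * Real.exp (-√(lamOne b) * R) * ∑' n : ℕ, imageRatio b 1 ^ n)
    (tsum_of_norm_bounded (f := fun n => imagePair hr R n x) hs fun n => ?_) (by ring)
  refine (hC R n x (2 * n * 1 + R) ?_).trans_eq ?_
  · have hn : (0:ℝ) ≤ n := Nat.cast_nonneg n
    nlinarith
  · rw [← exp_eq_imageRatio_pow, mul_assoc C, ← Real.exp_add]
    congr 2; ring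

omit hR in
theorem imageSum_neg_height (q : Torus b) (z : ℝ) :
    imageSum hr R (q, -z) = imageSum hr R (q, z) := by
  refine tsum_congr fun n => ?_
  simp only [imagePair, Prod.mk_add_mk, Prod.mk_sub_mk, add_zero, sub_zero]
  rw [show -z + 2 * (n + 1) * R = -(z - 2 * (n + 1) * R) by ring,
    show -z - 2 * (n + 1) * R = -(z + 2 * (n + 1) * R) by ring, oscPart_neg_height,
    oscPart_neg_height, add_comm (oscPart hr _)]

/-- By evenness it is enough to take z = R. The n-th pair then contributes ± the values of `oscPart`
at heights (2n + 1)R and (2n + 3)R with a common alternating sign, so the sum telescopes to its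
first term, minus the value at height R. -/
theorem imageSum_boundary {x : Cyl b} (hx : |x.2| = R) : imageSum hr R x = -oscPart hr x := by
  suffices h : ∀ q : Torus b, imageSum hr R (q, R) = -oscPart hr (q, R) by
    obtain ⟨q, z⟩ := x
    simp only at hx
    rcases le_total 0 z with h0 | h0
    · rw [abs_of_nonneg h0] at hx
      rw [hx, h]
    · rw [abs_of_nonpos h0] at hx
      rw [← neg_neg z, hx, imageSum_neg_height, oscPart_neg_height, h]
  intro q
  set c : ℕ → ℝ := fun n => (-1) ^ (n + 1) * oscPart hr (q, (2 * n + 1) * R) with hc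
  have hterm : ∀ n, imagePair hr R n (q, R) = c n - c (n + 1) := by
    intro n
    simp only [imagePair, Prod.mk_add_mk, Prod.mk_sub_mk, add_zero, sub_zero, hc]
    rw [show R - 2 * (n + 1) * R = -((2 * n + 1) * R) by ring, oscPart_neg_height,
      show R + 2 * (n + 1) * R = (2 * (n + 1 : ℕ) + 1) * R by push_cast; ring]
    ring
  have hs := (summable_imagePair (b := b) hr hR (x := (q, R))
    (by rw [abs_of_pos hR]; linarith)).hasSum.tendsto_sum_nat
  have hc0 : Tendsto c atTop (𝓝 0) := by
    obtain ⟨C, hC⟩ := abs_oscPart_le (b := b) hr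
    have hlim := ((summable_imageRatio (b := b) hR).tendsto_atTop_zero).const_mul |C|
    rw [mul_zero] at hlim
    refine squeeze_zero_norm (fun n => ?_) hlim
    rw [hc, norm_mul, norm_pow, norm_neg, norm_one, one_pow, one_mul, Real.norm_eq_abs]
    refine (hC _).trans ((mul_le_mul_of_nonneg_right (le_abs_self C) (Real.exp_pos _).le).trans ?_)
    rw [← exp_eq_imageRatio_pow]
    refine mul_le_mul_of_nonneg_left (Real.exp_le_exp.2 ?_) (abs_nonneg C)
    have hn : (0:ℝ) ≤ n := Nat.cast_nonneg n
    simp only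
    rw [abs_of_nonneg (by positivity)]
    nlinarith [mul_nonneg (Real.sqrt_nonneg (lamOne b)) hR.le]
  simp only [hterm, Finset.sum_range_sub'] at hs
  have h1 : Tendsto (fun n => c 0 - c n) atTop (𝓝 (c 0 - 0)) := tendsto_const_nhds.sub hc0
  have h2 := tendsto_nhds_unique hs h1
  rw [imageSum]
  simp only [hterm]
  rw [h2, hc]
  simp

end FlatCylinder

end

/-! ### Superposition of poles, linear asymptotics, change of sign. -/

noncomputable section

namespace FlatCylinder

variable {b : Module.Basis (Fin 2) ℝ Plane}

section SmoothAt

variable {f g : Cyl b → ℝ} {x : Cyl b}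

theorem smoothAt_comp_sub (f : Cyl b → ℝ) (p x : Cyl b) :
    SmoothAt b (fun x => f (x - p)) x ↔ SmoothAt b f (x - p) := by
  have : inCoords b (fun x => f (x - p)) x = inCoords b f (x - p) := by
    funext v; simp only [inCoords]; congr 1; abel
  rw [SmoothAt, SmoothAt, this]

theorem SmoothAt.add (hf : SmoothAt b f x) (hg : SmoothAt b g x) :
    SmoothAt b (fun x => f x + g x) x := ContDiffAt.add hf hg

theorem smoothAt_const (c : ℝ) : SmoothAt b (fun _ => c) x := contDiffAt_const

theorem SmoothAt.sum {ι : Type*} {s : Finset ι} {f : ι → Cyl b → ℝ}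
    (h : ∀ i ∈ s, SmoothAt b (f i) x) : SmoothAt b (fun x => ∑ i ∈ s, f i x) x := ContDiffAt.sum h

theorem SmoothAt.continuousAt (h : SmoothAt b f x) : ContinuousAt f x := by
  obtain ⟨v, rfl⟩ := covering_surjective b x
  rw [continuousAt_iff_comp_covering]
  exact (smoothAt_covering.1 h).continuousAt

end SmoothAt

variable {r : ℝ} (hr : 0 < r) (hrb : r ≤ injRadius b)

theorem normNabla_nonneg (k : ℕ) (f : Cyl b → ℝ) (x : Cyl b) : 0 ≤ normNabla b k f x :=
  norm_nonneg _

section Translate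

include hrb

theorem smoothAt_green_sub {p x : Cyl b} (hx : x ≠ p) : SmoothAt b (fun x => green hr (x - p)) x :=
  (smoothAt_comp_sub _ p x).2 (smoothAt_green hr hrb (sub_ne_zero.2 hx))

theorem locallyIntegrable_green_sub (p : Cyl b) :
    LocallyIntegrable (fun x => green hr (x - p)) (cylMeasure b) := by
  have hsub : Continuous fun x : Cyl b => x - p := by fun_prop
  exact (((integrable_singularC hr hrb).comp_sub_right p).locallyIntegrable.add
    ((continuous_of_smooth (contDiff_heightPart hr)).comp hsub).locallyIntegrable).add
    ((continuous_of_smooth (contDiff_oscPart hr)).comp hsub).locallyIntegrable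

theorem integral_green_sub_mul_negLap (p : Cyl b) {φ : Cyl b → ℝ} (h : IsTest φ) :
    ∫ x, green hr (x - p) * negLap φ x ∂(cylMeasure b) = 2 * Real.pi * φ p := by
  rw [← integral_add_right_eq_self (μ := cylMeasure b) _ p]
  have h1 := integral_green_mul_negLap hr hrb (h.translate p)
  simpa only [negLap_translate, add_sub_cancel_right, zero_add] using h1

omit hrb in
theorem continuous_fiber_of_continuousAt {f : Cyl b → ℝ} {z : ℝ}
    (h : ∀ q, ContinuousAt f (q, z)) : Continuous fun q => f (q, z) :=
  continuous_iff_continuousAt.2 fun q =>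
    (h q).comp (f := fun q : Torus b => (q, z)) (by fun_prop)

theorem fiberAverage_green_sub (p : Cyl b) {z : ℝ} (hz : z ≠ p.2) :
    fiberAverage b (fun x => green hr (x - p)) z = -(Real.pi / area b) * |z - p.2| := by
  rw [← fiberAverage_green hr hrb (sub_ne_zero.2 hz), fiberAverage, fiberAverage, average_eq,
    average_eq]
  congr 1
  exact integral_sub_right_eq_self (fun q => green hr (q, z - p.2)) p.1

end Translate

/-- The superposition of Green's functions with poles in `P`. -/
def multiGreen (P : Finset (Cyl b)) (c : ℝ) (x : Cyl b) : ℝ := ∑ p ∈ P, green hr (x - p) + c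

variable (P : Finset (Cyl b)) (c : ℝ)

theorem solvesPoisson_multiGreen (hrb : r ≤ injRadius b) :
    SolvesPoisson b univ P (multiGreen hr P c) := by
  have hloc : ∀ p : Cyl b, LocallyIntegrable (fun x => green hr (x - p)) (cylMeasure b) :=
    locallyIntegrable_green_sub hr hrb
  refine ⟨fun x _ hx => ?_, ?_, fun φ hφ => ?_⟩
  · exact (SmoothAt.sum fun p hp => smoothAt_green_sub hr hrb (p := p) fun h => hx (by rw [h]; exact hp)).add
      (smoothAt_const c)
  · refine LocallyIntegrable.locallyIntegrableOn ?_ univ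
    exact (locallyIntegrable_finsetSum P fun p _ => hloc p).add (locallyIntegrable_const c)
  · simp only [neg_laplacian_eq]
    have ht := hφ.isTest
    have hi : ∀ p ∈ P, Integrable (fun x => green hr (x - p) * negLap φ x) (cylMeasure b) :=
      fun p _ => integrable_mul_of_support_subset ((hloc p).locallyIntegrableOn univ)
        ht.compact.isCompact (subset_univ _) ht.negLap.continuous (negLap_support_subset ht)
    have hc := integral_affine_mul_negLap 0 c ht
    simp only [zero_mul, zero_add] at hc
    simp only [multiGreen, add_mul, Finset.sum_mul]
    rw [integral_add (integrable_finsetSum _ hi) (ht.negLap.integrable_mul continuous_const), hc,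
      add_zero, integral_finsetSum _ hi, Finset.mul_sum]
    exact Finset.sum_congr rfl fun p _ => integral_green_sub_mul_negLap hr hrb p ht

/-- The slope of the linear asymptotics on the end of the cylinder with the sign `s`. -/
def endSlope (s : ℝ) : ℝ := -(s * (Real.pi * P.card / area b))

/-- The constant term of the linear asymptotics on the end of the cylinder with the sign `s`. -/
def endConst (s : ℝ) : ℝ := s * (Real.pi / area b) * ∑ p ∈ P, p.2 + c

theorem sum_neg_pi_div_area_mul (s z : ℝ) :
    ∑ p ∈ P, -(Real.pi / area b) * (s * (z - p.2)) + c = endSlope P s * z + endConst P c s := by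
  rw [← Finset.mul_sum, ← Finset.mul_sum, Finset.sum_sub_distrib, Finset.sum_const, nsmul_eq_mul,
    endSlope, endConst]
  ring

/-- The sign s = ±1 treats both ends at once: s (z - p.2) > 0 means that z lies beyond p on the end
labelled s. -/
theorem abs_eq_mul_of_pos {s y : ℝ} (hs : s = 1 ∨ s = -1) (hy : 0 < s * y) : |y| = s * y := by
  rcases hs with rfl | rfl
  · rw [one_mul] at hy ⊢; exact abs_of_pos hy
  · have : y < 0 := by linarith
    rw [abs_of_neg this]; ring

section Ends

variable {s : ℝ} (hs : s = 1 ∨ s = -1)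
include hs

theorem fiberAverage_multiGreen (hrb : r ≤ injRadius b) {z : ℝ}
    (hz : ∀ p ∈ P, 0 < s * (z - p.2)) :
    fiberAverage b (multiGreen hr P c) z = endSlope P s * z + endConst P c s := by
  have hA := (area_pos b).ne'
  have hne : ∀ p ∈ P, z ≠ p.2 := fun p hp h => by
    have := hz p hp
    rw [h, sub_self, mul_zero] at this
    exact lt_irrefl _ this
  have hcont : ∀ p ∈ P, Continuous fun q : Torus b => green hr ((q, z) - p) := fun p hp =>
    continuous_fiber_of_continuousAt (f := fun x => green hr (x - p)) fun q =>
      (smoothAt_green_sub hr hrb fun h => hne p hp (congrArg Prod.snd h)).continuousAt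
  have havg : ∀ p ∈ P, (area b)⁻¹ * ∫ q, green hr ((q, z) - p) ∂(torusMeasure b) =
      -(Real.pi / area b) * (s * (z - p.2)) := fun p hp => by
    rw [← abs_eq_mul_of_pos hs (hz p hp), ← fiberAverage_green_sub hr hrb p (hne p hp),
      fiberAverage, average_eq, smul_eq_mul, area]
  rw [← sum_neg_pi_div_area_mul, fiberAverage, average_eq, smul_eq_mul, ← area]
  simp only [multiGreen]
  rw [integral_add (integrable_finsetSum _ fun p hp => integrable_torus (hcont p hp))
    (integrable_const c), integral_finsetSum _ fun p hp => integrable_torus (hcont p hp),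
    integral_const, smul_eq_mul, ← area, mul_add, Finset.mul_sum, Finset.sum_congr rfl havg]
  field_simp

theorem multiGreen_eq {x : Cyl b} (hx : ∀ p ∈ P, r / 2 < s * (x.2 - p.2)) :
    multiGreen hr P c x - (endSlope P s * x.2 + endConst P c s) = ∑ p ∈ P, oscPart hr (x - p) := by
  rw [← sum_neg_pi_div_area_mul, multiGreen, add_sub_add_right_eq_sub, ← Finset.sum_sub_distrib]
  refine Finset.sum_congr rfl fun p hp => ?_
  have h1 : |(x - p).2| = s * (x.2 - p.2) := abs_eq_mul_of_pos hs ((half_pos hr).trans (hx p hp))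
  rw [green_eq_of_height hr (h1 ▸ hx p hp), h1]
  ring

/-- Beyond all the cutoffs the difference is a sum of translated decaying parts. This holds on a
neighbourhood, hence for derivatives, and translation by p only costs the factor exp(√λ₁ s p.2). -/
theorem normNabla_multiGreen_le (k : ℕ) : ∃ C, ∀ x : Cyl b,
    (∀ p ∈ P, r / 2 < s * (x.2 - p.2)) →
    normNabla b k (fun x => multiGreen hr P c x - (endSlope P s * x.2 + endConst P c s)) x ≤
      C * Real.exp (-√(lamOne b) * (s * x.2)) := by
  obtain ⟨C, hC⟩ := norm_iteratedFDeriv_oscPart_le (b := b) hr k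
  choose w hw using covering_surjective b
  refine ⟨∑ p ∈ P, C * Real.exp (√(lamOne b) * (s * p.2)), fun x hx => ?_⟩
  obtain ⟨v, rfl⟩ := covering_surjective b x
  have hk : ((k : ℕ) : WithTop ℕ∞) ≤ ∞ := by norm_cast; exact le_top
  have hev : ((fun x => multiGreen hr P c x - (endSlope P s * x.2 + endConst P c s)) ∘ covering b)
      =ᶠ[𝓝 v] fun v => ∑ p ∈ P, (oscPart hr ∘ covering b) (v - w p) := by
    have hall : ∀ᶠ v' : Cover in 𝓝 v, ∀ p ∈ P, r / 2 < s * (v' 2 - p.2) := by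
      refine (Finset.eventually_all P).2 fun p hp => ?_
      have hc : Continuous fun v' : Cover => s * (v' 2 - p.2) := by fun_prop
      exact hc.continuousAt.eventually (lt_mem_nhds (hx p hp))
    filter_upwards [hall] with v' hv'
    simp only [Function.comp_apply]
    rw [multiGreen_eq hr P c hs (x := covering b v') hv']
    simp only [covering_sub, hw]
  rw [normNabla_covering, (hev.iteratedFDeriv ℝ k).eq_of_nhds,
    iteratedFDeriv_fun_sum_apply (f := fun p v => (oscPart hr ∘ covering b) (v - w p))
      fun p _ => (((contDiff_oscPart (b := b) hr).comp
        (contDiff_id.sub contDiff_const)).contDiffAt.of_le hk), Finset.sum_mul]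
  refine (norm_sum_le _ _).trans (Finset.sum_le_sum fun p hp => ?_)
  rw [iteratedFDeriv_comp_sub]
  refine (hC _).trans_eq ?_
  have hwp : w p 2 = p.2 := by rw [← covering_snd b (w p), hw]
  rw [mul_assoc, ← Real.exp_add, PiLp.sub_apply, hwp, ← covering_snd b v,
    abs_eq_mul_of_pos hs ((half_pos hr).trans (hx p hp))]
  congr 2
  ring

end Ends

theorem exists_height_above : ∃ Z : ℝ, ∀ p ∈ P, p.2 + r / 2 ≤ Z := by
  obtain ⟨Z, hZ⟩ := (P.image fun p => p.2 + r / 2).bddAbove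
  exact ⟨Z, fun p hp => hZ (Finset.mem_coe.2 (Finset.mem_image_of_mem _ hp))⟩

theorem exists_height_below : ∃ Z : ℝ, ∀ p ∈ P, Z ≤ p.2 - r / 2 := by
  obtain ⟨Z, hZ⟩ := (P.image fun p => p.2 - r / 2).bddBelow
  exact ⟨Z, fun p hp => hZ (Finset.mem_coe.2 (Finset.mem_image_of_mem _ hp))⟩

theorem linearAtTop_multiGreen (hrb : r ≤ injRadius b) :
    LinearAtTop b P (lamOne b) (multiGreen hr P c) (endSlope P 1) (endConst P c 1) := by
  refine ⟨fun z hz => fiberAverage_multiGreen hr P c (Or.inl rfl) hrb fun p hp => ?_, fun k => ?_⟩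
  · linarith [hz p hp]
  · obtain ⟨C, hC⟩ := normNabla_multiGreen_le hr P c (Or.inl rfl) k
    obtain ⟨Z, hZ⟩ := exists_height_above (r := r) P
    refine IsBigO.of_bound C ?_
    filter_upwards [tendsto_comap.eventually (eventually_gt_atTop Z)] with x hx
    rw [Real.norm_of_nonneg (normNabla_nonneg _ _ _), Real.norm_of_nonneg (Real.exp_pos _).le]
    refine (hC x fun p hp => ?_).trans_eq (by rw [one_mul])
    linarith [hZ p hp]

theorem linearAtBot_multiGreen (hrb : r ≤ injRadius b) :
    LinearAtBot b P (lamOne b) (multiGreen hr P c) (endSlope P (-1)) (endConst P c (-1)) := by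
  refine ⟨fun z hz => fiberAverage_multiGreen hr P c (Or.inr rfl) hrb fun p hp => ?_, fun k => ?_⟩
  · linarith [hz p hp]
  · obtain ⟨C, hC⟩ := normNabla_multiGreen_le hr P c (Or.inr rfl) k
    obtain ⟨Z, hZ⟩ := exists_height_below (r := r) P
    refine IsBigO.of_bound C ?_
    filter_upwards [tendsto_comap.eventually (eventually_lt_atBot Z)] with x hx
    rw [Real.norm_of_nonneg (normNabla_nonneg _ _ _), Real.norm_of_nonneg (Real.exp_pos _).le]
    refine (hC x fun p hp => ?_).trans_eq (by congr 2; ring)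
    linarith [hZ p hp]

theorem tendsto_multiGreen_pole (hrb : r ≤ injRadius b) {p : Cyl b} (hp : p ∈ P) :
    Tendsto (fun v => multiGreen hr P c (p + covering b v)) (𝓝[≠] 0) atTop := by
  classical
  have h1 := tendsto_green_covering (b := b) hr
  have hcov := continuous_covering b
  have h2 : ContinuousAt (fun v => ∑ p' ∈ P.erase p, green hr (p + covering b v - p') + c) 0 := by
    refine ContinuousAt.add (tendsto_finsetSum _ fun p' hp' => ?_) continuousAt_const
    have hne : p + covering b 0 ≠ p' := by
      rw [covering_zero, add_zero]; exact (Finset.ne_of_mem_erase hp').symm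
    exact ContinuousAt.comp (f := fun v => p + covering b v) (g := fun x => green hr (x - p'))
      (smoothAt_green_sub hr hrb hne).continuousAt (by fun_prop)
  refine (h1.atTop_add (h2.tendsto.mono_left nhdsWithin_le_nhds)).congr fun v => ?_
  rw [multiGreen, ← Finset.add_sum_erase P _ hp, add_sub_cancel_left, Function.comp_apply]
  ring

theorem eventually_notMem_of_pole (p : Cyl b) : ∀ᶠ v in 𝓝[≠] (0 : Cover), p + covering b v ∉ P := by
  have h : ∀ᶠ v in 𝓝[≠] (0 : Cover), ∀ p' ∈ P, p + covering b v ≠ p' := by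
    refine (Finset.eventually_all P).2 fun p' _ => ?_
    by_cases hpp : p' = p
    · have hn : ∀ᶠ v : Cover in 𝓝 0, ‖v‖ < injRadius b :=
        (continuous_norm.continuousAt (x := (0 : Cover))).eventually
          (gt_mem_nhds (by simpa using injRadius_pos b))
      filter_upwards [self_mem_nhdsWithin, mem_nhdsWithin_of_mem_nhds hn] with v hv hvn heq
      rw [hpp, add_eq_left] at heq
      refine hv ?_
      rw [mem_singleton_iff, ← centeredLiftC_covering hvn, heq, ← covering_zero b,
        centeredLiftC_covering (by simpa using injRadius_pos b)]
    · have hc : Continuous fun v => p + covering b v := by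
        have hcov := continuous_covering b
        fun_prop
      refine mem_nhdsWithin_of_mem_nhds (hc.continuousAt.eventually_ne ?_)
      rw [covering_zero, add_zero]
      exact Ne.symm hpp
  filter_upwards [h] with v hv hmem using hv _ hmem rfl

/-- The function tends to +∞ at each pole. On the upper end it is a bounded perturbation of an
affine function of negative slope, so it becomes negative there. -/
theorem signChanging_multiGreen (hrb : r ≤ injRadius b) (hP : P.Nonempty) :
    SignChanging b P (multiGreen hr P c) := by
  have hA := area_pos b
  constructor
  · obtain ⟨p, hp⟩ := hP
    obtain ⟨v, hv⟩ := (((tendsto_multiGreen_pole hr P c hrb hp).eventually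
      (eventually_gt_atTop 0)).and (eventually_notMem_of_pole P p)).exists
    exact ⟨_, hv.2, hv.1⟩
  · obtain ⟨C, hC⟩ := normNabla_multiGreen_le hr P c (Or.inl rfl) 0
    obtain ⟨Z, hZ⟩ := exists_height_above (r := r) P
    have hslope : endSlope P 1 < 0 := by
      have : (0:ℝ) < P.card := by exact_mod_cast hP.card_pos
      rw [endSlope, neg_lt_zero]; positivity
    have hlim : Tendsto (fun z : ℝ => endSlope P 1 * z + (endConst P c 1 + |C|)) atTop atBot :=
      (tendsto_id.const_mul_atTop_of_neg hslope).atBot_add tendsto_const_nhds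
    obtain ⟨z, ⟨hz, hzZ⟩, hz0⟩ := (((hlim.eventually (eventually_lt_atBot 0)).and
      (eventually_gt_atTop Z)).and (eventually_ge_atTop 0)).exists
    refine ⟨(0, z), fun h => ?_, ?_⟩
    · have := hZ _ h
      simp only at this
      linarith
    · have h1 := hC (0, z) fun p hp => by simp only; linarith [hZ p hp]
      rw [normNabla, norm_iteratedFDeriv_zero, inCoords, covering_zero, add_zero,
        Real.norm_eq_abs] at h1
      have h2 : C * Real.exp (-√(lamOne b) * (1 * z)) ≤ |C| := by
        refine (le_abs_self _).trans ?_
        rw [abs_mul, abs_of_pos (Real.exp_pos _)]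
        refine mul_le_of_le_one_right (abs_nonneg C) (Real.exp_le_one_iff.2 ?_)
        have := mul_nonneg (Real.sqrt_nonneg (lamOne b)) hz0
        linarith
      have h3 := (le_abs_self _).trans (h1.trans h2)
      simp only at h3
      linarith

end FlatCylinder

end

/-! ### The Dirichlet Green's function and its renormalised limit. -/

noncomputable section

namespace FlatCylinder

variable {b : Module.Basis (Fin 2) ℝ Plane}

section WeaklyHarmonic

variable {r : ℝ} (hr : 0 < r) (hrb : r ≤ injRadius b)
include hrb

/-- The exponentially decaying part of the Green's function is weakly harmonic away from the
middle of the cylinder. -/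
theorem integral_oscPart_add_mul_negLap (a : Cyl b) {φ : Cyl b → ℝ} (h : IsTest φ)
    (hφ : ∀ x ∈ tsupport φ, r / 2 < |(x + a).2|) :
    ∫ x, oscPart hr (x + a) * negLap φ x ∂(cylMeasure b) = 0 := by
  have ht := h.translate (-a)
  have hzero : ∀ x : Cyl b, |x.2| ≤ r / 2 → φ (x + -a) = 0 := fun x hx => by
    by_contra hne
    have := hφ _ (subset_tsupport _ hne)
    rw [neg_add_cancel_right] at this
    exact absurd this (not_lt.2 hx)
  rw [← integral_add_right_eq_self (μ := cylMeasure b) _ (-a)]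
  have habs : Continuous fun x : Cyl b => |x.2| := by fun_prop
  -- On the support of the translated test function `oscPart` equals `green` plus π|z|/A. Both of
  -- these are weakly harmonic off height 0, where that test function vanishes.
  have e : ∀ x : Cyl b, oscPart hr (x + -a + a) * negLap φ (x + -a) =
      green hr x * negLap (fun x => φ (x + -a)) x +
        Real.pi / area b * (|x.2| * negLap (fun x => φ (x + -a)) x) := fun x => by
    rw [negLap_translate, neg_add_cancel_right]
    by_cases hx : negLap φ (x + -a) = 0
    · simp [hx]
    · have h1 := hφ _ (negLap_support_subset h hx)
      rw [neg_add_cancel_right] at h1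
      rw [green_eq_of_height hr h1]
      ring
  have hr2 : (0:ℝ) ≤ r / 2 := by positivity
  simp only [e]
  rw [integral_add, integral_const_mul, integral_green_mul_negLap hr hrb ht,
    integral_abs_height_mul_negLap ht]
  · have h0 : φ (0 + -a) = 0 := hzero 0 (by simpa using hr2)
    rw [zero_add] at h0
    have h1 : ∀ q : Torus b, φ ((q, 0) + -a) = 0 := fun q => hzero _ (by simpa using hr2)
    simp [h0, h1]
  · exact integrable_mul_of_support_subset
      ((locallyIntegrable_green hr hrb).locallyIntegrableOn univ) ht.compact.isCompact
      (subset_univ _) ht.negLap.continuous (negLap_support_subset ht)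
  · exact (ht.negLap.integrable_mul habs).const_mul _

variable {R : ℝ} (hrR : r ≤ R) {p : Cyl b} (hp : p.2 = 0)
include hrR hp

/-- The images lie at heights of absolute value at least 2R, hence more than R ≥ r > r/2 away from
the slab |z| < R, and both terms are weakly harmonic there. -/
theorem integral_imagePair_mul_negLap (n : ℕ) {φ : Cyl b → ℝ} (h : IsTest φ)
    (hφ : tsupport φ ⊆ {x | |x.2| < R}) :
    ∫ x, imagePair hr R n (x - p) * negLap φ x ∂(cylMeasure b) = 0 := by
  have hR : 0 < R := hr.trans_le hrR
  have hn : (0:ℝ) ≤ n := Nat.cast_nonneg n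
  have hs : 2 * R ≤ 2 * (n + 1) * R := by nlinarith [mul_nonneg hn hR.le]
  have key : ∀ a : Cyl b, |a.2| = 2 * (n + 1) * R →
      ∫ x, oscPart hr (x + a) * negLap φ x ∂(cylMeasure b) = 0 := fun a ha => by
    refine integral_oscPart_add_mul_negLap hr hrb a h fun x hx => ?_
    have h1 : |x.2| < R := hφ hx
    have h2 : |a.2| ≤ |(x + a).2| + |x.2| := by
      have := abs_sub ((x + a).2) x.2
      simpa using this
    linarith
  have hi : ∀ a : Cyl b, Integrable (fun x => oscPart hr (x + a) * negLap φ x) (cylMeasure b) :=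
    fun a => h.negLap.integrable_mul ((continuous_of_smooth (contDiff_oscPart hr)).comp
      (continuous_id.add continuous_const))
  set a₁ : Cyl b := -p + (0, 2 * (n + 1) * R) with ha₁
  set a₂ : Cyl b := -p - (0, 2 * (n + 1) * R) with ha₂
  have e : ∀ x : Cyl b, imagePair hr R n (x - p) * negLap φ x = (-1) ^ (n + 1) *
      (oscPart hr (x + a₁) * negLap φ x + oscPart hr (x + a₂) * negLap φ x) := fun x => by
    rw [imagePair, ha₁, ha₂, show x + (-p + (0, 2 * (n + 1) * R)) = x - p + (0, 2 * (n + 1) * R) by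
      abel, show x + (-p - (0, 2 * (n + 1) * R)) = x - p - (0, 2 * (n + 1) * R) by abel]
    ring
  have hpos : 0 ≤ 2 * (n + 1) * R := by positivity
  simp only [e]
  rw [integral_const_mul, integral_add (hi a₁) (hi a₂), key a₁, key a₂, add_zero, mul_zero]
  · simp [ha₂, hp, abs_of_nonneg hpos]
  · simp [ha₁, hp, abs_of_nonneg hpos]

theorem integral_imageSum_mul_negLap {φ : Cyl b → ℝ} (h : IsTest φ)
    (hφ : tsupport φ ⊆ {x | |x.2| < R}) :
    ∫ x, imageSum hr R (x - p) * negLap φ x ∂(cylMeasure b) = 0 := by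
  have hR : 0 < R := hr.trans_le hrR
  obtain ⟨C, hC0, hC⟩ := abs_imagePair_le (b := b) hr
  have hi : ∀ n, Integrable (fun x => imagePair hr R n (x - p) * negLap φ x) (cylMeasure b) :=
    fun n => h.negLap.integrable_mul ((continuous_of_smooth (contDiff_imagePair hr R n)).comp
      (continuous_id.sub continuous_const))
  have hbound : ∀ n (x : Cyl b), ‖imagePair hr R n (x - p) * negLap φ x‖ ≤
      C * imageRatio b R ^ n * |negLap φ x| := fun n x => by
    by_cases hx : negLap φ x = 0
    · simp [hx]
    · have h1 : |x.2| < R := hφ (negLap_support_subset h hx)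
      rw [norm_mul, Real.norm_eq_abs, Real.norm_eq_abs, ← exp_eq_imageRatio_pow]
      refine mul_le_mul_of_nonneg_right (hC R n _ _ ?_) (abs_nonneg _)
      rw [Prod.snd_sub, hp, sub_zero]
      linarith
  have hsum := hasSum_integral_of_summable_integral_norm hi (by
    refine Summable.of_nonneg_of_le (fun n => integral_nonneg fun x => norm_nonneg _) (fun n => ?_)
      (((summable_imageRatio (b := b) hR).mul_left C).mul_right
        (∫ x, |negLap φ x| ∂(cylMeasure b)))
    rw [← integral_const_mul]
    exact integral_mono (hi n).norm (h.negLap.integrable.abs.const_mul _) (hbound n))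
  simp only [integral_imagePair_mul_negLap hr hrb hrR hp _ h hφ, tsum_mul_right] at hsum
  exact hsum.unique hasSum_zero

end WeaklyHarmonic

section Dirichlet

variable (b) in
/-- A cutoff radius adapted to the slab of half-width `R`. -/
def slabRadius (R : ℝ) : ℝ := if 0 < R then min (injRadius b) R else injRadius b

variable (b) in
theorem slabRadius_pos (R : ℝ) : 0 < slabRadius b R := by
  rw [slabRadius]
  split_ifs with h
  · exact lt_min (injRadius_pos b) h
  · exact injRadius_pos b

theorem slabRadius_le_injRadius (R : ℝ) : slabRadius b R ≤ injRadius b := by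
  rw [slabRadius]
  split_ifs
  · exact min_le_left _ _
  · exact le_rfl

theorem slabRadius_le {R : ℝ} (hR : 0 < R) : slabRadius b R ≤ R := by
  rw [slabRadius, if_pos hR]; exact min_le_right _ _

/-- For large R the cutoff radius no longer depends on R, so all the functions V_R are built from
one and the same `green`. -/
theorem slabRadius_eq {R : ℝ} (hR : injRadius b ≤ R) : slabRadius b R = injRadius b := by
  rw [slabRadius, if_pos ((injRadius_pos b).trans_le hR), min_eq_left hR]

/-- The Dirichlet Green's function of a slab, constructed by the method of images. -/
def slabGreen (p : Cyl b) (R : ℝ) (x : Cyl b) : ℝ :=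
  green (slabRadius_pos b R) (x - p) + Real.pi / area b * R + imageSum (slabRadius_pos b R) R (x - p)

/-- The image sum is smooth and weakly harmonic in the slab, so only the pole at p remains. On |z| =
R the linear parts -π|z|/A and πR/A cancel, and the images cancel the decaying part. -/
theorem isDirichletGreen_slabGreen {p : Cyl b} (hp : p.2 = 0) {R : ℝ} (hR : 0 < R) :
    IsDirichletGreen b p R (slabGreen p R) := by
  set hr := slabRadius_pos b R
  have hrb := slabRadius_le_injRadius (b := b) R
  have hrR := slabRadius_le (b := b) hR
  have hheight : ∀ x : Cyl b, (x - p).2 = x.2 := fun x => by rw [Prod.snd_sub, hp, sub_zero]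
  have himg : ∀ x : Cyl b, |x.2| < 2 * R → SmoothAt b (fun x => imageSum hr R (x - p)) x :=
    fun x hx => (smoothAt_comp_sub _ p x).2 (smoothAt_imageSum hr hR (by rwa [hheight]))
  have hsmooth : ∀ x : Cyl b, |x.2| < 2 * R → x ≠ p → SmoothAt b (slabGreen p R) x :=
    fun x hx hxp => ((smoothAt_green_sub hr hrb hxp).add (smoothAt_const _)).add (himg x hx)
  have hgc : LocallyIntegrable (fun x => green hr (x - p) + Real.pi / area b * R) (cylMeasure b) :=
    (locallyIntegrable_green_sub hr hrb p).add (locallyIntegrable_const _)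
  have himgloc : LocallyIntegrableOn (fun x => imageSum hr R (x - p)) {x : Cyl b | |x.2| < R}
      (cylMeasure b) := by
    refine ContinuousOn.locallyIntegrableOn (fun x hx => ?_) (isOpen_slab R).measurableSet
    have hx' : |x.2| < R := hx
    exact (himg x (by linarith)).continuousAt.continuousWithinAt
  refine ⟨⟨fun x hx hxp => ?_, ?_, fun φ hφ => ?_⟩, fun x hx => ?_, fun x hx => ?_⟩
  · have hx' : |x.2| < R := hx
    exact hsmooth x (by linarith) (by simpa using hxp)
  · exact (hgc.locallyIntegrableOn _).add himgloc
  · simp only [neg_laplacian_eq, Finset.sum_singleton]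
    have ht := hφ.isTest
    have hi : ∀ {V : Cyl b → ℝ}, LocallyIntegrableOn V {x | |x.2| < R} (cylMeasure b) →
        Integrable (fun x => V x * negLap φ x) (cylMeasure b) := fun hV =>
      integrable_mul_of_support_subset hV ht.compact.isCompact hφ.2.2 ht.negLap.continuous
        (negLap_support_subset ht)
    have hc := integral_affine_mul_negLap 0 (Real.pi / area b * R) ht
    simp only [zero_mul, zero_add] at hc
    simp only [slabGreen, add_mul _ _ (negLap φ _)]
    have i1 := hi ((locallyIntegrable_green_sub hr hrb p).locallyIntegrableOn _)
    have i2 : Integrable (fun x => Real.pi / area b * R * negLap φ x) (cylMeasure b) :=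
      ht.negLap.integrable_mul continuous_const
    have i12 : Integrable (fun x => green hr (x - p) * negLap φ x +
      Real.pi / area b * R * negLap φ x) (cylMeasure b) := i1.add i2
    rw [integral_add i12 (hi himgloc), integral_add i1 i2, hc,
      integral_green_sub_mul_negLap hr hrb p ht,
      integral_imageSum_mul_negLap hr hrb hrR hp ht hφ.2.2, add_zero, add_zero]
  · have hx' : |x.2| ≤ R := hx.1
    exact (hsmooth x (by linarith) hx.2).continuousAt.continuousWithinAt
  · have h1 : |(x - p).2| = R := by rw [hheight, hx]
    rw [slabGreen, imageSum_boundary _ hR h1, green_eq_of_height _ (by rw [h1]; linarith), h1]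
    ring

theorem abs_slabGreen_sub_le (p : Cyl b) (hp : p.2 = 0) : ∃ C, ∀ R, 1 ≤ R → injRadius b ≤ R →
    ∀ x : Cyl b, |x.2| ≤ R →
    |slabGreen p R x - (green (injRadius_pos b) (x - p) + Real.pi / area b * R)| ≤
      C * Real.exp (-√(lamOne b) * R) := by
  obtain ⟨C, hC⟩ := abs_imageSum_le (b := b) (injRadius_pos b)
  refine ⟨C, fun R hR hRi x hx => ?_⟩
  -- The proof of positivity depends on the radius, so the equality of radii is transported by
  -- substitution rather than rewriting.
  have hcongr : ∀ {r r' : ℝ} (hr : 0 < r) (hr' : 0 < r'), r = r' → ∀ y : Cyl b,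
      green hr y = green hr' y ∧ imageSum hr R y = imageSum hr' R y := by
    rintro r r' hr hr' rfl y
    exact ⟨rfl, rfl⟩
  obtain ⟨h1, h2⟩ := hcongr (slabRadius_pos b R) (injRadius_pos b) (slabRadius_eq hRi) (x - p)
  rw [slabGreen, h1, h2, add_sub_cancel_left]
  exact hC R hR _ (by rwa [Prod.snd_sub, hp, sub_zero])

end Dirichlet

section UnitSphere

variable (p : Cyl b)

theorem continuous_cylDist : Continuous fun x => cylDist b x p := by
  unfold cylDist
  fun_prop

theorem abs_height_sub_le_cylDist (x : Cyl b) : |x.2 - p.2| ≤ cylDist b x p :=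
  Real.abs_le_sqrt (by nlinarith [sq_nonneg (dist x.1 p.1)])

theorem isCompact_unitSphere : IsCompact {x : Cyl b | cylDist b x p = 1} := by
  have hK : IsCompact ((univ : Set (Torus b)) ×ˢ Icc (p.2 - 1) (p.2 + 1)) :=
    isCompact_univ.prod isCompact_Icc
  refine hK.of_isClosed_subset (isClosed_eq (continuous_cylDist p) continuous_const) fun x hx => ?_
  have h := abs_height_sub_le_cylDist p x
  rw [show cylDist b x p = 1 from hx, abs_le] at h
  exact ⟨mem_univ _, by linarith [h.1], by linarith [h.2]⟩

theorem unitSphere_nonempty : {x : Cyl b | cylDist b x p = 1}.Nonempty :=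
  ⟨(p.1, p.2 + 1), by simp [cylDist]⟩

theorem self_notMem_unitSphere : p ∉ {x : Cyl b | cylDist b x p = 1} := by
  simp [cylDist]

/-- Suprema are 1-Lipschitz for the uniform distance and commute with adding a constant. Here c is
πR/A, the divergent constant common to V_R and C_R. -/
theorem abs_sSup_image_sub_le {X : Type*} {f g : X → ℝ} {S : Set X} {c ε : ℝ} (hS : S.Nonempty)
    (hg : BddAbove (g '' S)) (h : ∀ x ∈ S, |f x - (g x + c)| ≤ ε) :
    |sSup (f '' S) - (sSup (g '' S) + c)| ≤ ε := by
  have hle : ∀ x ∈ S, f x ≤ sSup (g '' S) + c + ε := fun x hx => by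
    have h1 := (abs_le.1 (h x hx)).2
    have h2 := le_csSup hg (mem_image_of_mem g hx)
    linarith
  have hf : BddAbove (f '' S) := ⟨_, forall_mem_image.2 hle⟩
  rw [abs_le]
  constructor
  · have : sSup (g '' S) ≤ sSup (f '' S) - c + ε := by
      refine csSup_le (hS.image g) (forall_mem_image.2 fun x hx => ?_)
      have h1 := (abs_le.1 (h x hx)).1
      have h2 := le_csSup hf (mem_image_of_mem f hx)
      linarith
    linarith
  · have := csSup_le (hS.image f) (forall_mem_image.2 hle)
    linarith

end UnitSphere

/-- V_R and its supremum over the unit sphere each differ by πR/A + O(exp(-√λ₁ R)) from the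
corresponding quantity for `green`, so πR/A cancels in the difference. The error is the image sum,
which is regular at p, so K may even contain the pole. -/
theorem tendstoUniformlyOn_slabGreen {p : Cyl b} (hp : p.2 = 0) {K : Set (Cyl b)}
    (hK : IsCompact K) :
    TendstoUniformlyOn (fun R x => slabGreen p R x - supUnitSphere b (slabGreen p R) p)
      (multiGreen (injRadius_pos b) {p}
        (-supUnitSphere b (fun x => green (injRadius_pos b) (x - p)) p)) atTop K := by
  obtain ⟨C, hC⟩ := abs_slabGreen_sub_le p hp
  obtain ⟨Z, hZ⟩ := (hK.image (continuous_abs.comp continuous_snd)).bddAbove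
  have hlim : Tendsto (fun R : ℝ => C * Real.exp (-√(lamOne b) * R) +
      C * Real.exp (-√(lamOne b) * R)) atTop (𝓝 0) := by
    have h1 : Tendsto (fun R : ℝ => Real.exp (-√(lamOne b) * R)) atTop (𝓝 0) :=
      Real.tendsto_exp_atBot.comp
        (tendsto_id.const_mul_atTop_of_neg (neg_lt_zero.2 (Real.sqrt_pos.2 (lamOne_pos b))))
    simpa using (h1.const_mul C).add (h1.const_mul C)
  have hbdd : BddAbove ((fun x => green (injRadius_pos b) (x - p)) ''
      {x : Cyl b | cylDist b x p = 1}) := by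
    refine ((isCompact_unitSphere p).image_of_continuousOn fun x hx => ?_).bddAbove
    exact (smoothAt_green_sub _ le_rfl fun h =>
      self_notMem_unitSphere p (by rw [h] at hx; exact hx)).continuousAt.continuousWithinAt
  rw [Metric.tendstoUniformlyOn_iff]
  intro ε hε
  filter_upwards [hlim.eventually (gt_mem_nhds hε), eventually_ge_atTop 1,
    eventually_ge_atTop (injRadius b), eventually_ge_atTop Z] with R hRε hR1 hRi hRZ x hx
  have h1 := hC R hR1 hRi x ((hZ (mem_image_of_mem _ hx)).trans hRZ)
  have h2 := abs_sSup_image_sub_le (unitSphere_nonempty p) hbdd fun x hx => hC R hR1 hRi x (by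
    have := abs_height_sub_le_cylDist p x
    rw [hp, sub_zero, show cylDist b x p = 1 from hx] at this
    exact this.trans hR1)
  refine lt_of_le_of_lt ?_ hRε
  rw [dist_comm, Real.dist_eq, multiGreen, Finset.sum_singleton, supUnitSphere, supUnitSphere]
  have h3 := abs_sub _ _ |>.trans (add_le_add h1 h2)
  convert! h3 using 2
  ring

theorem endSlope_neg_one (P : Finset (Cyl b)) :
    endSlope P (-1) = Real.pi * P.card / area b := by rw [endSlope]; ring

theorem endSlope_neg_one_pos {P : Finset (Cyl b)} (hP : P.Nonempty) : 0 < endSlope P (-1) := by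
  have hA := area_pos b
  have : (0:ℝ) < P.card := by exact_mod_cast hP.card_pos
  rw [endSlope_neg_one]
  positivity

theorem endSlope_one (P : Finset (Cyl b)) : endSlope P (-1) = -endSlope P 1 := by
  rw [endSlope, endSlope]; ring

end FlatCylinder

end

/-! ### Assembly. -/

theorem theorem2 (b : Module.Basis (Fin 2) ℝ Plane) :
    ∃ lam : ℝ, IsFirstEigenvalue b lam ∧
      -- one pole at height zero: the Green's function obtained by exhaustion
      (∀ p : Cyl b, p.2 = 0 →
        ∃ (G : ℝ → Cyl b → ℝ) (V : Cyl b → ℝ),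
          (∀ R : ℝ, 0 < R →
            IsDirichletGreen b p R (G R) ∧
            ∀ W : Cyl b → ℝ, IsDirichletGreen b p R W →
              EqOn W (G R) ({x | |x.2| ≤ R} \ {p})) ∧
          (∀ K : Set (Cyl b), IsCompact K → p ∉ K →
            TendstoUniformlyOn (fun R x => G R x - supUnitSphere b (G R) p) V atTop K) ∧
          SolvesPoisson b univ {p} V ∧
          SignChanging b {p} V ∧
          ∃ κm κp βm βp : ℝ,
            κm = -κp ∧ κm = Real.pi / area b ∧ 0 < κm ∧
            LinearAtBot b {p} lam V κm βm ∧ LinearAtTop b {p} lam V κp βp) ∧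
      -- finitely many poles
      (∀ P : Finset (Cyl b), P.Nonempty →
        ∃ V : Cyl b → ℝ,
          SolvesPoisson b univ P V ∧
          SignChanging b P V ∧
          ∃ κm κp βm βp : ℝ,
            κm = -κp ∧ κm = Real.pi * P.card / area b ∧ 0 < κm ∧
            LinearAtBot b P lam V κm βm ∧ LinearAtTop b P lam V κp βp) := by
  refine ⟨lamOne b, isFirstEigenvalue_lamOne, fun p hp => ?_, fun P hP => ?_⟩
  -- The limit is the Green's function normalised to have supremum 0 over the unit sphere around p.
  · refine ⟨slabGreen p, multiGreen (injRadius_pos b) {p}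
      (-supUnitSphere b (fun x => green (injRadius_pos b) (x - p)) p), fun R hR =>
        ⟨isDirichletGreen_slabGreen hp hR, fun W hW =>
          hW.eqOn hp hR (isDirichletGreen_slabGreen hp hR)⟩,
      fun K hK _ => tendstoUniformlyOn_slabGreen hp hK,
      solvesPoisson_multiGreen _ _ _ le_rfl,
      signChanging_multiGreen _ _ _ le_rfl (Finset.singleton_nonempty p),
      endSlope {p} (-1), endSlope {p} 1, _, _, endSlope_one _, ?_, ?_,
      linearAtBot_multiGreen _ _ _ le_rfl, linearAtTop_multiGreen _ _ _ le_rfl⟩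
    · rw [endSlope_neg_one]; simp
    · exact endSlope_neg_one_pos (Finset.singleton_nonempty p)
  -- With several poles no normalisation is prescribed, so the additive constant is taken to be 0.
  · exact ⟨multiGreen (injRadius_pos b) P 0, solvesPoisson_multiGreen _ _ _ le_rfl,
      signChanging_multiGreen _ _ _ le_rfl hP, endSlope P (-1), endSlope P 1, _, _,
      endSlope_one _, endSlope_neg_one _, endSlope_neg_one_pos hP,
      linearAtBot_multiGreen _ _ _ le_rfl, linearAtTop_multiGreen _ _ _ le_rfl⟩
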